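/- Let $N \ge 3$ and let $F_N$ be the free group of rank $N$. The free factor graph $\mathcal{AF}_N$ is the graph whose vertices are the nontrivial proper free factors of $F_N$ (subgroups generated by a subset of some basis of $F_N$; actual subgroups, not conjugacy classes), two distinct free factors being joined by an edge if and only if one is contained in the other. Let $\mathcal{F}_{(2)}$ be the full subgraph of $\mathcal{AF}_N$ spanned by the free factors of rank $1$ and $2$. Then every graph automorphism of $\mathcal{F}_{(2)}$ extends to a unique graph automorphism of $\mathcal{AF}_N$. Consequently $\mathrm{Aut}(\mathcal{F}_{(2)}) \cong \mathrm{Aut}(\mathcal{AF}_N)$; more precisely, sending an automorphism of $\mathcal{F}_{(2)}$ to its unique extension is an isomorphism of groups $\mathrm{Aut}(\mathcal{F}_{(2)}) \to \mathrm{Aut}(\mathcal{AF}_N)$. -/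

import Mathlib

/-- A subgroup of the free group `F_N` is a free factor if it is generated by a subset of
some basis of `F_N`. -/
def IsFreeFactor {N : ℕ} (A : Subgroup (FreeGroup (Fin N))) : Prop :=
  ∃ (b : FreeGroupBasis (Fin N) (FreeGroup (Fin N))) (S : Set (Fin N)),
    A = Subgroup.closure (b '' S)

/-- The subgroup `A` is free of rank `k`, i.e. `A` has a basis with `k` elements. -/
def HasFreeRank {N : ℕ} (A : Subgroup (FreeGroup (Fin N))) (k : ℕ) : Prop :=
  Nonempty (FreeGroupBasis (Fin k) A)

/-- The vertices of the free factor graph: the nontrivial proper free factors of `F_N`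
(genuine subgroups, not conjugacy classes). -/
def FreeFactorVertex (N : ℕ) : Type :=
  {A : Subgroup (FreeGroup (Fin N)) // IsFreeFactor A ∧ A ≠ ⊥ ∧ A ≠ ⊤}

/-- The free factor graph `AF_N`: two distinct free factors are adjacent when one of them
contains the other. -/
def freeFactorGraph (N : ℕ) : SimpleGraph (FreeFactorVertex N) where
  Adj A B := A.1 < B.1 ∨ B.1 < A.1
  symm := ⟨fun _ _ h => h.symm⟩
  loopless := ⟨fun A h => h.elim (lt_irrefl A.1) (lt_irrefl A.1)⟩

/-- The set of vertices of `AF_N` that are free factors of rank one or two. -/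
def rankOneTwoVertices (N : ℕ) : Set (FreeFactorVertex N) :=
  {A | HasFreeRank A.1 1 ∨ HasFreeRank A.1 2}

/-- The full subgraph `F_(2)` of `AF_N` spanned by the free factors of rank one and two. -/
abbrev rankOneTwoGraph (N : ℕ) : SimpleGraph (rankOneTwoVertices N) :=
  (freeFactorGraph N).induce (rankOneTwoVertices N)

/-- The automorphism `Φ` of `AF_N` extends the automorphism `φ` of `F_(2)`. -/
def IsExtension {N : ℕ} (φ : rankOneTwoGraph N ≃g rankOneTwoGraph N)
    (Φ : freeFactorGraph N ≃g freeFactorGraph N) : Prop :=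
  ∀ A : rankOneTwoVertices N, Φ (A : FreeFactorVertex N) = (φ A : FreeFactorVertex N)

/-! Call factors of rank one, two and `N - 1` points, lines and hyperplanes. Inside `F_(2)` a line
has a partner: a point off it, joined by a line to every point on it. A point has no partner. So an
automorphism of `F_(2)` keeps the two types apart and is a collineation. A factor is generated by
its points, which makes an extension unique. For existence it suffices that a collineation `f`
carries the points of a factor of rank `k ≥ 2` onto the points of a factor of rank `k`
(`IsCollineation.exists_image`).

This goes by induction on `k`. Split off one basis element `z` of `A`, leaving `B`, and let `B'` be
the factor whose points are the images of those of `B`. Every point of `B'` lies on a line with `f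
z`. By `exists_basis_of_collinear`, this forces a basis of `B'` together with a generator of `f z`
to be part of a basis of `F_N`; let `A'` be the factor so spanned. That `A` and `A'` have
corresponding points follows from `FreeGroup.primitive_mem_of_lineClosed`: all points of a factor
arise from those of one basis by repeatedly adding the points of a line spanned by two members of a
basis that have already been reached.

Both results rest on Whitehead's method. A proper factor has a nontrivial almost invariant set,
whence the cut vertex lemma `FreeGroup.exists_cut`. A cut yields an automorphism shortening a word
(`FreeGroup.exists_shortening`), which multiplies generators by powers of a single letter and hence
moves each generator inside one line. For `exists_basis_of_collinear`, the second point is brought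
to a shortest double coset representative modulo the factor; a well chosen primitive word in the
factor then produces a cut that would shorten it further unless it is a single letter.

Conversely, an automorphism of the whole graph preserves ranks one and two, because these are
visible in links and partners. Restriction is therefore a homomorphism, and extension is its
inverse. -/

open Subgroup

/-! ### Bases and free factors -/

namespace FreeGroupBasis

variable {ι κ G H : Type*} [Group G] [Group H]

theorem lift_coe (b : FreeGroupBasis ι G) (f : ι → H) (i : ι) : b.lift f (b i) = f i :=
  congrFun (b.lift.symm_apply_apply f) i

theorem closure_range (b : FreeGroupBasis ι G) : closure (Set.range b) = ⊤ := by
  have h : Set.range b = b.repr.symm.toMonoidHom '' (Set.range (FreeGroup.of : ι → _)) := by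
    rw [← Set.range_comp]; rfl
  rw [h, ← MonoidHom.map_closure, FreeGroup.closure_range_of, ← MonoidHom.range_eq_map]
  exact MonoidHom.range_eq_top.2 b.repr.symm.surjective

/-- A family whose free lift is injective is a basis of the subgroup it generates. -/
noncomputable def ofInjectiveLift (v : ι → G) (h : Function.Injective (FreeGroup.lift v)) :
    FreeGroupBasis ι (closure (Set.range v)) :=
  .ofRepr ((MonoidHom.ofInjective h).trans
    (MulEquiv.subgroupCongr FreeGroup.range_lift_eq_closure)).symm

@[simp] theorem ofInjectiveLift_coe (v : ι → G) (h : Function.Injective (FreeGroup.lift v))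
    (i : ι) : (ofInjectiveLift v h i : G) = v i := by
  change ((FreeGroup.lift v) (FreeGroup.of i)) = v i
  simp

/-- Transport of a basis along an equality of subgroups. -/
noncomputable def subgroupCongr {A B : Subgroup G} (b : FreeGroupBasis ι A) (h : A = B) :
    FreeGroupBasis ι B :=
  b.map (MulEquiv.subgroupCongr h)

theorem injective_lift_subset (b : FreeGroupBasis ι G) (S : Set ι) :
    Function.Injective (FreeGroup.lift (fun i : S => b i)) := by
  have : FreeGroup.lift (fun i : S => b i) =
      b.repr.symm.toMonoidHom.comp (FreeGroup.map (Subtype.val : S → ι)) :=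
    FreeGroup.ext_hom _ _ fun i => by
      simp only [FreeGroup.lift_apply_of, MonoidHom.comp_apply, FreeGroup.map.of]; rfl
  rw [this]
  exact b.repr.symm.injective.comp (FreeGroup.map_injective Subtype.val_injective)

@[simp] theorem subgroupCongr_coe {A B : Subgroup G} (b : FreeGroupBasis ι A) (h : A = B) (i : ι) :
    (b.subgroupCongr h i : G) = b i := rfl

/-- The part of a basis indexed by `S` is a basis of the subgroup generated by it. -/
noncomputable def restrict (b : FreeGroupBasis ι G) (S : Set ι) :
    FreeGroupBasis S (closure (b '' S)) :=
  (ofInjectiveLift _ (b.injective_lift_subset S)).subgroupCongr (by rw [Set.image_eq_range])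

@[simp] theorem restrict_coe (b : FreeGroupBasis ι G) (S : Set ι) (i : S) :
    (b.restrict S i : G) = b i := by
  simp [restrict]

/-- A basis from two mutually inverse endomorphisms. -/
theorem exists_of_inverse (b : FreeGroupBasis ι G) (f g : G →* G)
    (hfg : ∀ i, f (g (b i)) = b i) (hgf : ∀ i, g (f (b i)) = b i) :
    ∃ b' : FreeGroupBasis ι G, ∀ i, b' i = f (b i) :=
  ⟨b.map (MonoidHom.toMulEquiv f g (b.ext_hom _ _ hgf) (b.ext_hom _ _ hfg)), fun _ => rfl⟩

/-- In a basis, the part spanning a factor may be replaced by any other basis of that factor. -/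
theorem exists_replace (b : FreeGroupBasis ι G) (T : Set ι)
    (β : FreeGroupBasis T (closure (b '' T))) :
    ∃ b' : FreeGroupBasis ι G, (∀ i ∉ T, b' i = b i) ∧ ∀ i : T, b' i = β i := by
  classical
  let A := closure (b '' T)
  have hb (i : T) : b i ∈ A := subset_closure ⟨i, i.2, rfl⟩
  -- On `A`, replacing each `β j` by `b j` undoes the substitution `f` of `β j` for `b j`; both are
  -- completed by the identity on the other generators.
  let φ : A →* G := β.lift (fun j => b j)
  let f : G →* G := b.lift (fun i => if h : i ∈ T then (β ⟨i, h⟩ : G) else b i)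
  let g : G →* G := b.lift (fun i => if h : i ∈ T then φ ⟨b i, hb ⟨i, h⟩⟩ else b i)
  have f1 (i : T) : f (b i) = β i := by simp [f]
  have f2 (i : ι) (h : i ∉ T) : f (b i) = b i := by simp [f, h]
  have g1 (i : T) : g (b i) = φ ⟨b i, hb i⟩ := by simp [g]
  have g2 (i : ι) (h : i ∉ T) : g (b i) = b i := by simp [g, h]
  have hfφ : f.comp φ = A.subtype := β.ext_hom _ _ fun i => by
    simp [φ, f1]
  have hgφ : g.comp A.subtype = φ := (b.restrict T).ext_hom _ _ fun i => by
    have : b.restrict T i = ⟨b i, hb i⟩ := Subtype.ext (by simp)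
    rw [this]; exact g1 i
  obtain ⟨b', hb'⟩ := b.exists_of_inverse f g
    (fun i => by
      by_cases h : i ∈ T
      · rw [g1 ⟨i, h⟩]; exact DFunLike.congr_fun hfφ ⟨b i, hb ⟨i, h⟩⟩
      · rw [g2 i h, f2 i h])
    (fun i => by
      by_cases h : i ∈ T
      · rw [f1 ⟨i, h⟩]
        exact (DFunLike.congr_fun hgφ (β ⟨i, h⟩)).trans (lift_coe _ _ _)
      · rw [f2 i h, g2 i h])
  exact ⟨b', fun i h => (hb' i).trans (f2 i h), fun i => (hb' i).trans (f1 i)⟩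

/-- Two bases of the same group have equivalent index types. -/
noncomputable def indexEquiv (b : FreeGroupBasis ι G) (c : FreeGroupBasis κ G) : ι ≃ κ :=
  Equiv.ofFreeGroupEquiv (b.repr.symm.trans c.repr)

end FreeGroupBasis

/-- A subgroup of a group is a free factor if it is generated by part of a free basis. -/
def IsFactor {G : Type} [Group G] (A : Subgroup G) : Prop :=
  ∃ (ι : Type) (b : FreeGroupBasis ι G) (S : Set ι), A = closure (b '' S)

namespace IsFactor

variable {G H : Type} [Group G] [Group H]

theorem map_equiv {A : Subgroup G} (h : IsFactor A) (e : G ≃* H) :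
    IsFactor (A.map e.toMonoidHom) := by
  obtain ⟨ι, b, S, rfl⟩ := h
  refine ⟨ι, b.map e, S, ?_⟩
  rw [MonoidHom.map_closure, ← Set.image_comp]; rfl

theorem exists_basis {A : Subgroup G} (h : IsFactor A) {ι : Type} (c : FreeGroupBasis ι G) :
    ∃ (b : FreeGroupBasis ι G) (S : Set ι), A = closure (b '' S) := by
  obtain ⟨κ, b, S, rfl⟩ := h
  let e := b.indexEquiv c
  refine ⟨b.reindex e, e '' S, ?_⟩
  rw [← Set.image_comp]
  congr 1
  ext x; simp

/-- A basis of a factor extends to a basis of the group. -/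
theorem exists_extend {ι κ : Type} (b : FreeGroupBasis ι G) (T : Set ι)
    (β : FreeGroupBasis κ (closure (b '' T))) :
    ∃ (b' : FreeGroupBasis ι G) (e : κ ≃ T), (∀ i ∉ T, b' i = b i) ∧ ∀ k : κ, b' (e k) = β k := by
  let e : κ ≃ T := β.indexEquiv (b.restrict T)
  obtain ⟨b', h1, h2⟩ := b.exists_replace T (β.reindex e)
  exact ⟨b', e, h1, fun k => by rw [h2]; simp⟩

theorem trans {A : Subgroup G} (hA : IsFactor A) {K : Subgroup A} (hK : IsFactor K) :
    IsFactor (K.map A.subtype) := by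
  obtain ⟨ι, b, T, rfl⟩ := hA
  obtain ⟨κ, β, S, rfl⟩ := hK
  obtain ⟨b', e, -, h⟩ := exists_extend b T β
  refine ⟨ι, b', (fun k => (e k : ι)) '' S, ?_⟩
  rw [MonoidHom.map_closure, ← Set.image_comp, ← Set.image_comp]
  congr 1
  exact Set.image_congr fun k _ => (h k).symm

end IsFactor

/-! ### Schreier transversals and intersections of factors with subgroups -/

namespace FreeGroupBasis

variable {ι G : Type} [Group G]

/-- The value of a letter (a generator or its inverse) in a basis. -/
def letterVal (b : FreeGroupBasis ι G) (t : ι × Bool) : G := cond t.2 (b t.1) (b t.1)⁻¹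

/-- The value of a word in a basis. -/
def wordVal (b : FreeGroupBasis ι G) (L : List (ι × Bool)) : G := (L.map b.letterVal).prod

@[simp] theorem wordVal_cons (b : FreeGroupBasis ι G) (t : ι × Bool) (L : List (ι × Bool)) :
    b.wordVal (t :: L) = b.letterVal t * b.wordVal L := by simp [wordVal]

theorem letterVal_mem (b : FreeGroupBasis ι G) {S : Set ι} {t : ι × Bool} (h : t.1 ∈ S) :
    b.letterVal t ∈ closure (b '' S) := by
  have : b t.1 ∈ closure (b '' S) := subset_closure ⟨_, h, rfl⟩
  obtain ⟨x, _ | _⟩ := t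
  · exact inv_mem this
  · exact this

theorem mem_closure_iff_exists_word (b : FreeGroupBasis ι G) (S : Set ι) (g : G) :
    g ∈ closure (b '' S) ↔ ∃ L : List (ι × Bool), (∀ t ∈ L, t.1 ∈ S) ∧ b.wordVal L = g := by
  constructor
  · intro h
    rw [← mem_toSubmonoid, closure_toSubmonoid] at h
    obtain ⟨l, hl, rfl⟩ := Submonoid.exists_list_of_mem_closure h
    clear h
    induction l with
    | nil => exact ⟨[], by simp, rfl⟩
    | cons x l ih =>
      obtain ⟨L, hL, hLv⟩ := ih fun y hy => hl y (List.mem_cons_of_mem _ hy)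
      have : ∃ t : ι × Bool, t.1 ∈ S ∧ b.letterVal t = x := by
        rcases hl x List.mem_cons_self with ⟨i, hi, rfl⟩ | ⟨i, hi, h⟩
        · exact ⟨(i, true), hi, rfl⟩
        · exact ⟨(i, false), hi, by simp [letterVal, h]⟩
      obtain ⟨t, ht, rfl⟩ := this
      exact ⟨t :: L, by simpa [ht] using hL, by simp [hLv]⟩
  · rintro ⟨L, hL, rfl⟩
    refine Subgroup.list_prod_mem _ fun x hx => ?_
    obtain ⟨t, ht, rfl⟩ := List.mem_map.1 hx
    exact b.letterVal_mem (hL t ht)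

theorem exists_word (b : FreeGroupBasis ι G) (g : G) : ∃ L, b.wordVal L = g := by
  have : g ∈ closure (b '' Set.univ) := by rw [Set.image_univ, b.closure_range]; trivial
  obtain ⟨L, -, h⟩ := (b.mem_closure_iff_exists_word _ _).1 this
  exact ⟨L, h⟩

/-- A Schreier transversal of the left cosets of `H` whose representatives of cosets meeting the
factor spanned by `S` lie in that factor. -/
theorem exists_schreier (b : FreeGroupBasis ι G) (S : Set ι) (H : Subgroup G) :
    ∃ τ : G ⧸ H → G, (∀ q, (τ q : G ⧸ H) = q) ∧ τ ((1 : G) : G ⧸ H) = 1 ∧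
      (∀ p : G ⧸ H → Prop, p ((1 : G) : G ⧸ H) →
        (∀ t q, p q → τ (b.letterVal t • q) = b.letterVal t * τ q → p (b.letterVal t • q)) →
        ∀ q, p q) ∧
      ∀ a ∈ closure (b '' S), τ ((a : G) : G ⧸ H) ∈ closure (b '' S) := by
  classical
  -- Letters outside `S` are counted before length, so a coset meeting the factor has all its
  -- minimal words written in `S`.
  let wt : List (ι × Bool) → ℕ ×ₗ ℕ := fun L => toLex (L.countP (fun t => t.1 ∉ S), L.length)
  have hmin (q : G ⧸ H) : ∃ L, ((b.wordVal L : G) : G ⧸ H) = q ∧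
      ∀ L', ((b.wordVal L' : G) : G ⧸ H) = q → ¬ wt L' < wt L := by
    obtain ⟨g, rfl⟩ := QuotientGroup.mk_surjective q
    obtain ⟨L, rfl⟩ := b.exists_word g
    obtain ⟨m, hm, h⟩ := (InvImage.wf wt wellFounded_lt).has_min
      {L' | ((b.wordVal L' : G) : G ⧸ H) = (b.wordVal L : G)} ⟨L, rfl⟩
    exact ⟨m, hm, h⟩
  choose Lm hLm hLmin using hmin
  let m : G ⧸ H → ℕ ×ₗ ℕ := fun q => wt (Lm q)
  have hm (L) : m ((b.wordVal L : G) : G ⧸ H) ≤ wt L := not_lt.1 (hLmin _ L rfl)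
  have hwt (t L) : wt L < wt (t :: L) := by
    simp only [wt, Prod.Lex.toLex_lt_toLex, List.countP_cons, List.length_cons]
    split_ifs <;> simp
  -- Dropping the first letter of a minimal word leads to a parent coset of smaller weight. These
  -- parents form the Schreier tree, and `τ` is read off along it by recursion; the tail itself need
  -- not be the chosen word of the parent.
  have hparent (q : G ⧸ H) (hq : q ≠ ((1 : G) : G ⧸ H)) : ∃ (t : ι × Bool) (q' : G ⧸ H),
      q = b.letterVal t • q' ∧ m q' < m q ∧
      ((∃ a ∈ closure (b '' S), (a : G ⧸ H) = q) →
        t.1 ∈ S ∧ ∃ a ∈ closure (b '' S), (a : G ⧸ H) = q') := by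
    match hL : Lm q with
    | [] =>
      have := hLm q
      rw [hL] at this
      exact absurd this.symm hq
    | t :: L =>
      have h1 := hLm q
      rw [hL] at h1
      refine ⟨t, (b.wordVal L : G), ?_, ?_, ?_⟩
      · rw [← h1, wordVal_cons]; rfl
      · refine (hm L).trans_lt ?_
        change _ < wt (Lm q)
        rw [hL]; exact hwt t L
      · rintro ⟨a, ha, rfl⟩
        obtain ⟨L', hL', rfl⟩ := (b.mem_closure_iff_exists_word _ _).1 ha
        have h2 : wt (t :: L) ≤ wt L' := by rw [← hL]; exact hm L'
        have h3 : L'.countP (fun t => t.1 ∉ S) = 0 := by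
          rw [List.countP_eq_zero]; intro t ht; simpa using hL' t ht
        have h4 : (t :: L).countP (fun t => t.1 ∉ S) = 0 := by
          simp only [wt, Prod.Lex.toLex_le_toLex, h3] at h2
          omega
        rw [List.countP_eq_zero] at h4
        have h5 : ∀ u ∈ t :: L, u.1 ∈ S := fun u hu => by simpa using h4 u hu
        exact ⟨h5 t (by simp), _,
          (b.mem_closure_iff_exists_word _ _).2 ⟨L, fun u hu => h5 u (by simp [hu]), rfl⟩, rfl⟩
  choose pt pq hpq hpm hpS using hparent
  have wf : WellFounded (fun q q' : G ⧸ H => m q < m q') := InvImage.wf m wellFounded_lt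
  let F : ∀ q : G ⧸ H, (∀ q', m q' < m q → G) → G := fun q ih =>
    if h : q = ((1 : G) : G ⧸ H) then 1 else b.letterVal (pt q h) * ih (pq q h) (hpm q h)
  let τ : G ⧸ H → G := wf.fix F
  have τ1 : τ ((1 : G) : G ⧸ H) = 1 := by
    change wf.fix F _ = 1
    rw [wf.fix_eq]; simp [F]
  have τ2 (q) (h : q ≠ ((1 : G) : G ⧸ H)) : τ q = b.letterVal (pt q h) * τ (pq q h) := by
    change wf.fix F _ = _
    rw [wf.fix_eq]; simp [F, h, τ]
  refine ⟨τ, ?_, τ1, ?_, ?_⟩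
  · intro q
    induction q using wf.induction with
    | _ q ih =>
      by_cases h : q = ((1 : G) : G ⧸ H)
      · rw [h, τ1]
      · rw [τ2 q h]
        conv_rhs => rw [hpq q h, ← ih _ (hpm q h)]
        rfl
  · intro p h1 h2 q
    induction q using wf.induction with
    | _ q ih =>
      by_cases h : q = ((1 : G) : G ⧸ H)
      · rwa [h]
      · have := h2 (pt q h) (pq q h) (ih _ (hpm q h)) (by rw [← hpq q h, τ2 q h])
        rwa [← hpq q h] at this
  · have key : ∀ q : G ⧸ H, (∃ a ∈ closure (b '' S), (a : G ⧸ H) = q) →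
        τ q ∈ closure (b '' S) := by
      intro q
      induction q using wf.induction with
      | _ q ih =>
        intro hq
        by_cases h : q = ((1 : G) : G ⧸ H)
        · rw [h, τ1]; exact one_mem _
        · rw [τ2 q h]
          exact mul_mem (b.letterVal_mem (hpS q h hq).1) (ih _ (hpm q h) (hpS q h hq).2)
    exact fun a ha => key _ ⟨a, ha, rfl⟩

end FreeGroupBasis

/-- The intersection of a free factor with a subgroup `H` is a free factor of `H`. -/
theorem IsFactor.subgroupOf {G : Type} [Group G] {A : Subgroup G} (hA : IsFactor A)
    (H : Subgroup G) : IsFactor (A.subgroupOf H) := by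
  classical
  obtain ⟨ι, b, S, rfl⟩ := hA
  obtain ⟨τ, hτ, τ1, τind, τA⟩ := b.exists_schreier S H
  let o : G ⧸ H := ((1 : G) : G ⧸ H)
  have hmem (g : G) (q : G ⧸ H) : (τ (g • q))⁻¹ * (g * τ q) ∈ H := by
    rw [← QuotientGroup.eq, hτ]
    conv_lhs => rw [← hτ q]
    rfl
  -- The Schreier cocycle: `g` closed up to a loop by the representatives of its two end cosets. Its
  -- values at generators generate `H`, and `κ` keeps only the nontrivial ones.
  let e : G → G ⧸ H → H := fun g q => ⟨_, hmem g q⟩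
  have e_mul (g g' q) : e (g * g') q = e g (g' • q) * e g' q := by
    ext; simp [e, mul_smul, mul_assoc]
  have e_inv (g q) : e g⁻¹ q = (e g (g⁻¹ • q))⁻¹ := by
    ext; simp [e, mul_assoc]
  let κ : Type := {p : ι × (G ⧸ H) // e (b p.1) p.2 ≠ 1}
  let v : κ → H := fun p => e (b p.1.1) p.1.2
  let lab : ι → G ⧸ H → FreeGroup κ := fun x q =>
    if h : e (b x) q ≠ 1 then FreeGroup.of ⟨(x, q), h⟩ else 1
  -- the action of `G` on `(G ⧸ H) × FreeGroup κ` twisted by the edge labels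
  let ρ : G →* Equiv.Perm ((G ⧸ H) × FreeGroup κ) := b.lift fun x =>
    { toFun := fun y => (b x • y.1, lab x y.1 * y.2)
      invFun := fun y => ((b x)⁻¹ • y.1, (lab x ((b x)⁻¹ • y.1))⁻¹ * y.2)
      left_inv := fun y => by simp
      right_inv := fun y => by simp }
  let c : G → G ⧸ H → FreeGroup κ := fun g q => (ρ g (q, 1)).2
  have hρ (g) : ∀ y, ρ g y = (g • y.1, c g y.1 * y.2) := by
    have htop : g ∈ closure (Set.range b) := by rw [b.closure_range]; trivial
    induction htop using closure_induction with
    | mem g hg =>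
      obtain ⟨x, rfl⟩ := hg
      intro y; simp [ρ, c]
    | one => intro y; simp [c]
    | mul g g' _ _ ih ih' =>
      intro y
      have h1 : c (g * g') y.1 = c g (g' • y.1) * c g' y.1 := by
        change (ρ (g * g') (y.1, 1)).2 = _
        rw [map_mul, Equiv.Perm.mul_apply, ih', ih]; simp
      rw [map_mul, Equiv.Perm.mul_apply, ih', ih, h1, mul_smul, mul_assoc]
    | inv g _ ih =>
      have h0 (y) : ρ g⁻¹ y = (g⁻¹ • y.1, (c g (g⁻¹ • y.1))⁻¹ * y.2) := by
        rw [map_inv, Equiv.Perm.inv_eq_iff_eq, ih]; simp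
      intro y
      rw [h0 y]
      change _ = (_, (ρ g⁻¹ (y.1, 1)).2 * y.2)
      rw [h0]; simp
  have c_mul (g g' q) : c (g * g') q = c g (g' • q) * c g' q := by
    change (ρ (g * g') (q, 1)).2 = _
    rw [map_mul, Equiv.Perm.mul_apply, hρ g', hρ g]; simp
  have c_inv (g q) : c g⁻¹ q = (c g (g⁻¹ • q))⁻¹ := by
    have := c_mul g g⁻¹ q
    rw [mul_inv_cancel] at this
    have h1 : c 1 q = 1 := by simp [c]
    rw [h1] at this
    exact (inv_eq_of_mul_eq_one_right this.symm).symm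
  have c_gen (x q) : c (b x) q = lab x q := by simp [c, ρ]
  have lab_one (x q) (h : e (b x) q = 1) : lab x q = 1 := by simp [lab, h]
  -- By induction along the tree: a tree edge has trivial Schreier generator, hence trivial label.
  have c_τ : ∀ q, c (τ q) o = 1 := by
    refine τind _ (by rw [τ1]; simp [c]) ?_
    rintro ⟨x, ε⟩ q hq ht
    have hτo : τ q • o = q := by
      conv_rhs => rw [← hτ q]
      change ((τ q * 1 : G) : G ⧸ H) = _
      rw [mul_one]
    rw [ht, c_mul, hq, mul_one, hτo]
    cases ε with
    | true =>
      change c (b x) q = 1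
      rw [c_gen]
      refine lab_one _ _ (Subtype.ext ?_)
      change (τ (b x • q))⁻¹ * (b x * τ q) = 1
      rw [inv_mul_eq_one]; exact ht
    | false =>
      change c (b x)⁻¹ q = 1
      rw [c_inv, c_gen, inv_eq_one]
      refine lab_one _ _ (Subtype.ext ?_)
      change (τ (b x • (b x)⁻¹ • q))⁻¹ * (b x * τ ((b x)⁻¹ • q)) = 1
      rw [smul_inv_smul, inv_mul_eq_one]
      have : τ ((b x)⁻¹ • q) = (b x)⁻¹ * τ q := ht
      rw [this]; simp
  have hHo (h : H) : (h : G) • o = o := by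
    change (((h : G) * 1 : G) : G ⧸ H) = _
    rw [QuotientGroup.eq]; simp
  -- Reading labels along a loop at the base coset sends each Schreier generator to its own symbol,
  -- so this is a left inverse of the lift of `v` and the generators are free.
  let ψ : H →* FreeGroup κ :=
    { toFun := fun h => c h o
      map_one' := by simp [c]
      map_mul' := fun h h' => by simp only [coe_mul]; rw [c_mul, hHo] }
  have ψv (k : κ) : ψ (v k) = FreeGroup.of k := by
    obtain ⟨⟨x, q⟩, hk⟩ := k
    have hτo (q) : τ q • o = q := by
      conv_rhs => rw [← hτ q]
      change ((τ q * 1 : G) : G ⧸ H) = _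
      rw [mul_one]
    change c ((τ (b x • q))⁻¹ * (b x * τ q)) o = _
    have h2 : (τ (b x • q))⁻¹ • (b x • q) = o := by
      rw [inv_smul_eq_iff, hτo]
    rw [c_mul, c_mul, c_τ, hτo, mul_smul, hτo, c_gen, c_inv, h2, c_τ]
    simp only [inv_one, one_mul, mul_one]
    simp only [lab, dif_pos hk]
  have inj : Function.Injective (FreeGroup.lift v) := by
    have : ψ.comp (FreeGroup.lift v) = MonoidHom.id _ :=
      FreeGroup.ext_hom _ _ fun k => by simp [ψv]
    exact Function.LeftInverse.injective (g := ψ) (DFunLike.congr_fun this)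
  have e_gen (U : Subgroup H) (T : Set ι) (Q : Set (G ⧸ H))
      (hQ : ∀ g ∈ closure (b '' T), ∀ q ∈ Q, g • q ∈ Q)
      (hU : ∀ x ∈ T, ∀ q ∈ Q, e (b x) q ∈ U) :
      ∀ g ∈ closure (b '' T), ∀ q ∈ Q, e g q ∈ U := by
    intro g hg
    induction hg using closure_induction with
    | mem g hg => obtain ⟨x, hx, rfl⟩ := hg; exact hU x hx
    | one => intro q _; convert! one_mem U; ext; simp [e]
    | mul g g' hg hg' ih ih' =>
      intro q hq
      rw [e_mul]
      exact mul_mem (ih _ (hQ _ hg' _ hq)) (ih' _ hq)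
    | inv g hg ih =>
      intro q hq
      rw [e_inv]
      exact inv_mem (ih _ (hQ _ (inv_mem hg) _ hq))
  have e_o (h : H) : e h o = h := by
    ext
    change (τ ((h : G) • o))⁻¹ * (h * τ o) = h
    rw [hHo, τ1]; simp
  have gen_mem (x q) : e (b x) q ∈ closure (Set.range v) := by
    by_cases h : e (b x) q = 1
    · rw [h]; exact one_mem _
    · exact subset_closure ⟨⟨(x, q), h⟩, rfl⟩
  have top : closure (Set.range v) = ⊤ := by
    refine eq_top_iff.2 fun h _ => ?_
    rw [← e_o h]
    refine e_gen _ Set.univ Set.univ (fun _ _ _ _ => trivial) (fun x _ q _ => gen_mem x q) _ ?_ _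
      trivial
    rw [Set.image_univ, b.closure_range]; trivial
  let β : FreeGroupBasis κ H := (FreeGroupBasis.ofInjectiveLift v inj).map
    ((MulEquiv.subgroupCongr top).trans Subgroup.topEquiv)
  have hβ (k) : β k = v k := FreeGroupBasis.ofInjectiveLift_coe v inj k
  -- The cosets met by the factor. Their representatives lie in the factor, so the Schreier
  -- generators on edges labelled in `S` over `Q` lie in the intersection; by `e_gen` they also
  -- generate it.
  let Q : Set (G ⧸ H) := {q | ∃ a ∈ closure (b '' S), (a : G ⧸ H) = q}
  have hQ : ∀ g ∈ closure (b '' S), ∀ q ∈ Q, g • q ∈ Q := by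
    rintro g hg _ ⟨a, ha, rfl⟩
    exact ⟨g * a, mul_mem hg ha, rfl⟩
  have τQ : ∀ q ∈ Q, τ q ∈ closure (b '' S) := by rintro _ ⟨a, ha, rfl⟩; exact τA a ha
  refine ⟨κ, β, {k | k.1.1 ∈ S ∧ k.1.2 ∈ Q}, le_antisymm ?_ ?_⟩
  · intro h hh
    rw [← e_o h]
    refine e_gen _ S Q hQ (fun x hx q hq => ?_) _ hh _ ⟨1, one_mem _, rfl⟩
    by_cases h : e (b x) q = 1
    · rw [h]; exact one_mem _
    · exact subset_closure ⟨⟨(x, q), h⟩, ⟨hx, hq⟩, hβ _⟩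
  · rw [closure_le]
    rintro _ ⟨⟨⟨x, q⟩, h⟩, ⟨hx, hq⟩, rfl⟩
    rw [hβ]
    have hbx : b x ∈ closure (b '' S) := subset_closure ⟨x, hx, rfl⟩
    exact mul_mem (inv_mem (τQ _ (hQ _ hbx _ hq))) (mul_mem hbx (τQ _ hq))

/-! ### Reduced words and almost invariant sets -/

namespace FreeGroup

variable {α : Type*}

/-- The inverse of a letter. -/
def letterInv (t : α × Bool) : α × Bool := (t.1, !t.2)

@[simp] theorem letterInv_letterInv (t : α × Bool) : letterInv (letterInv t) = t := by
  simp [letterInv]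

@[simp] theorem letterInv_fst (t : α × Bool) : (letterInv t).1 = t.1 := rfl

theorem letterInv_ne (t : α × Bool) : letterInv t ≠ t := by
  intro h
  have := congrArg Prod.snd h
  simp [letterInv] at this

theorem letterInv_eq_iff {s t : α × Bool} : letterInv s = t ↔ s = letterInv t := by
  constructor <;> rintro rfl <;> simp

theorem ne_letterInv_iff {s t : α × Bool} : s ≠ letterInv t ↔ (s.1 = t.1 → s.2 = t.2) := by
  obtain ⟨a, i⟩ := s
  obtain ⟨b, j⟩ := t
  simp only [letterInv, ne_eq, Prod.mk.injEq, not_and]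
  refine imp_congr_right fun _ => ?_
  cases i <;> cases j <;> simp

theorem isReduced_iff_isChain {L : List (α × Bool)} :
    IsReduced L ↔ L.IsChain fun s t => s ≠ letterInv t :=
  List.IsChain.iff fun _ _ => ne_letterInv_iff.symm

theorem mk_letterInv (t : α × Bool) : mk [letterInv t] = (mk [t])⁻¹ := rfl

theorem fst_eq_iff {s t : α × Bool} : s.1 = t.1 ↔ s = t ∨ s = letterInv t := by
  obtain ⟨a, i⟩ := s
  obtain ⟨b, j⟩ := t
  cases i <;> cases j <;> simp [letterInv]

variable [DecidableEq α]

theorem IsReduced.toWord_mk {L : List (α × Bool)} (h : IsReduced L) : (mk L).toWord = L := by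
  rw [FreeGroup.toWord_mk, h.reduce_eq]

theorem IsReduced.norm_mk {L : List (α × Bool)} (h : IsReduced L) : (mk L).norm = L.length := by
  rw [norm, h.toWord_mk]

/-- Right multiplication by a letter either cancels the last letter or appends one. -/
theorem toWord_mul_letter (g : FreeGroup α) (s : α × Bool) :
    (g * mk [s]).toWord = g.toWord ++ [s] ∨ g.toWord = (g * mk [s]).toWord ++ [letterInv s] := by
  rcases List.eq_nil_or_concat g.toWord with h | ⟨L, t, h⟩
  · left
    rw [toWord_mul, h]; rfl
  · have hg : g = mk (L ++ [t]) := by rw [← List.concat_eq_append, ← h, mk_toWord]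
    have hr : IsReduced (L ++ [t]) := by rw [← List.concat_eq_append, ← h]; exact isReduced_toWord
    by_cases hts : t = letterInv s
    · right
      subst hts
      have : g * mk [s] = mk L := by
        rw [hg, ← mul_mk, mk_letterInv, inv_mul_cancel_right]
      rw [this, (hr.infix (List.prefix_append _ _).isInfix).toWord_mk, h, List.concat_eq_append]
    · left
      have : g * mk [s] = mk (L ++ [t] ++ [s]) := by rw [hg, mul_mk]
      rw [this, h, List.concat_eq_append]
      refine IsReduced.toWord_mk ?_
      rw [isReduced_iff_isChain] at hr ⊢
      refine List.IsChain.append hr (List.isChain_singleton _) ?_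
      simpa using hts

/-- Right multiplication by a letter edits only the end of a reduced word, so the first letter can
change only when one of the two words is empty. -/
theorem head?_toWord_mul_letter {g : FreeGroup α} {s : α × Bool} (h1 : g ≠ 1)
    (h2 : g * mk [s] ≠ 1) : (g * mk [s]).toWord.head? = g.toWord.head? := by
  rw [ne_eq, ← toWord_eq_nil_iff] at h1 h2
  rcases toWord_mul_letter g s with h | h
  · rw [h, List.head?_append_of_ne_nil _ h1]
  · rw [h, List.head?_append_of_ne_nil _ h2]

end FreeGroup

open FreeGroup in
/-- A proper nontrivial free factor `P` admits a nontrivial almost invariant set which is exactly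
invariant under right multiplication by `P`. -/
theorem IsFactor.exists_almostInvariant {G : Type} [Group G] {P : Subgroup G} (hP : IsFactor P)
    (hb : P ≠ ⊥) (ht : P ≠ ⊤) : ∃ E : Set G, (∀ g, ∀ p ∈ P, g * p ∈ E ↔ g ∈ E) ∧
      (∀ x, {g | ¬ (g ∈ E ↔ g * x ∈ E)}.Finite) ∧ E.Infinite ∧ Eᶜ.Infinite := by
  classical
  obtain ⟨ι, b, S, rfl⟩ := hP
  obtain ⟨i, hi⟩ : S.Nonempty := by
    rw [Set.nonempty_iff_ne_empty]; rintro rfl; simp at hb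
  obtain ⟨j, hj⟩ : ∃ j, j ∉ S := by
    by_contra! h
    rw [Set.eq_univ_of_forall h, Set.image_univ, b.closure_range] at ht
    exact ht rfl
  -- Elements whose reduced word starts outside `S`. A generator on the right matters only at `g =
  -- 1` and `g * b x = 1`, and for `x ∈ S` all elements concerned lie outside `E`; hence the exact
  -- invariance under `P`.
  let E : Set G := {g | ∃ t ∈ (b.repr g).toWord.head?, t.1 ∉ S}
  have hone : (1 : G) ∉ E := by simp [E]
  have hgen (x : ι) : ((b x)⁻¹ ∈ E ↔ x ∉ S) ∧ (b x ∈ E ↔ x ∉ S) := by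
    simp [E, invRev]
  have key (g : G) (x : ι) (h1 : g ≠ 1) (h2 : g * b x ≠ 1) : g * b x ∈ E ↔ g ∈ E := by
    have h3 : b.repr (g * b x) = b.repr g * mk [(x, true)] := by
      rw [_root_.map_mul, b.repr_apply_coe]; rfl
    have h4 : (b.repr (g * b x)).toWord.head? = (b.repr g).toWord.head? := by
      rw [h3]
      exact head?_toWord_mul_letter (by simpa using h1)
        (by rw [← h3, ne_eq, b.repr.map_eq_one_iff]; exact h2)
    simp only [E, Set.mem_ofPred_eq, h4]
  have hpow (x : ι) (n : ℕ) : b x ^ (n + 1) ∈ E ↔ x ∉ S := by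
    simp [E, List.replicate_succ]
  have hinj (x : ι) : Function.Injective fun n : ℕ => b x ^ (n + 1) := by
    intro m n h
    have := congrArg (fun g => (b.repr g).toWord.length) h
    simpa using this
  refine ⟨E, fun g p hp => ?_, fun x => ?_, ?_, ?_⟩
  · induction hp using closure_induction generalizing g with
    | mem p hp =>
      obtain ⟨x, hx, rfl⟩ := hp
      by_cases h1 : g = 1
      · subst h1; rw [one_mul, (hgen x).2]; simp [hx, hone]
      by_cases h2 : g * b x = 1
      · rw [h2, eq_inv_of_mul_eq_one_left h2, (hgen x).1]; simp [hx, hone]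
      exact key g x h1 h2
    | one => simp
    | mul p q _ _ ihp ihq => rw [← mul_assoc, ihq, ihp]
    | inv p _ ih => rw [← ih (g * p⁻¹)]; simp
  · have hx : x ∈ closure (Set.range b) := by rw [b.closure_range]; trivial
    induction hx using closure_induction with
    | mem x hx =>
      obtain ⟨x, rfl⟩ := hx
      refine (Set.toFinite {1, (b x)⁻¹}).subset fun g hg => ?_
      by_contra h
      simp only [Set.mem_insert_iff, Set.mem_singleton_iff, not_or] at h
      exact hg (key g x h.1 fun h' => h.2 (eq_inv_of_mul_eq_one_left h')).symm
    | one => simp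
    | mul x y _ _ ihx ihy =>
      refine (ihx.union (ihy.preimage (mul_left_injective x).injOn)).subset fun g hg => ?_
      simp only [Set.mem_ofPred_eq, Set.mem_union, Set.mem_preimage, mul_assoc] at hg ⊢
      tauto
    | inv x _ ih =>
      refine (ih.preimage (mul_left_injective x⁻¹).injOn).subset fun g hg => ?_
      simp only [Set.mem_ofPred_eq, Set.mem_preimage, inv_mul_cancel_right] at hg ⊢
      tauto
  · exact Set.infinite_of_injective_forall_mem (hinj j) fun n => (hpow j n).2 hj
  · exact Set.infinite_of_injective_forall_mem (hinj i) fun n => by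
      rw [Set.mem_compl_iff, hpow]; simpa using hi

/-! ### The cut vertex lemma -/

namespace FreeGroup

variable {α : Type}

/-- The pair of directions `x`, `y` does not separate `J` from the complement of `J ∪ {d}`. -/
def GoodTurn (d : α × Bool) (J : Set (α × Bool)) (x y : α × Bool) : Prop :=
  (x ∈ J → y ∈ J ∨ y = d) ∧ (y ∈ J → x ∈ J ∨ x = d)

theorem isCyclicallyReduced_invRev {w : List (α × Bool)} (h : IsCyclicallyReduced w) :
    IsCyclicallyReduced (invRev w) := by
  classical
  rw [isCyclicallyReduced_iff] at h ⊢
  refine ⟨?_, ?_⟩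
  · rw [isReduced_iff_reduce_eq, reduce_invRev, h.1.reduce_eq]
  · intro a ha b hb
    simp only [invRev, List.getLast?_reverse, List.head?_reverse, List.head?_map,
      List.getLast?_map, Option.mem_def, Option.map_eq_some_iff] at ha hb
    obtain ⟨a', ha, rfl⟩ := ha
    obtain ⟨b', hb, rfl⟩ := hb
    intro hab
    simp [h.2 b' hb a' ha hab.symm]

/-- Reduced words of powers of a cyclically reduced word after a compatible prefix. -/
theorem isReduced_append_pow {v w : List (α × Bool)} (hv : IsReduced v)
    (hw : IsCyclicallyReduced w) (hvw : ∀ s ∈ v.getLast?, ∀ t ∈ w.head?, s ≠ letterInv t)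
    (n : ℕ) : IsReduced (v ++ (List.replicate n w).flatten) := by
  have h1 : IsReduced (List.replicate n w).flatten := (hw.flatten_replicate n).isReduced
  rw [isReduced_iff_isChain] at hv h1 ⊢
  refine hv.append h1 fun s hs t ht => ?_
  cases n with
  | zero => simp at ht
  | succ n =>
    rcases eq_or_ne w [] with rfl | hne
    · simp at ht
    · rw [List.replicate_succ, List.flatten_cons, List.head?_append_of_ne_nil _ hne] at ht
      exact hvw s hs t ht

/-- Almost invariant sets are constant on sufficiently deep cones. -/
theorem exists_length_bound [Finite α] {E : Set (FreeGroup α)}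
    (hE : ∀ x, {g | ¬ (g ∈ E ↔ g * x ∈ E)}.Finite) :
    ∃ n : ℕ, ∀ v : List (α × Bool), n < v.length →
      ∀ u, IsReduced (v ++ u) → (mk (v ++ u) ∈ E ↔ mk v ∈ E) := by
  classical
  have hfin : (⋃ t : α × Bool, {g | ¬ (g ∈ E ↔ g * mk [t] ∈ E)}).Finite :=
    Set.finite_iUnion fun t => hE _
  obtain ⟨n, hn⟩ := (hfin.image norm).bddAbove
  refine ⟨n, fun v hv u => ?_⟩
  induction u using List.reverseRecOn with
  | nil => simp
  | append_singleton u t ih =>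
    intro hr
    have hr' : IsReduced (v ++ u) := hr.infix ⟨[], [t], by simp⟩
    rw [← ih hr']
    by_contra h
    have h1 : mk (v ++ u) * mk [t] = mk (v ++ (u ++ [t])) := by simp [mul_mk]
    have : norm (mk (v ++ u)) ≤ n := hn ⟨_, Set.mem_iUnion.2 ⟨t, by
      rw [Set.mem_ofPred_eq, h1]; tauto⟩, rfl⟩
    rw [hr'.norm_mk, List.length_append] at this
    omega

/-- **Cut vertex lemma.** The Whitehead graph of the cyclically reduced words conjugate into a
proper nontrivial free factor is disconnected or has a cut vertex `d`. -/
theorem exists_cut [Finite α] [Nontrivial α] {P : Subgroup (FreeGroup α)} (hP : IsFactor P)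
    (hb : P ≠ ⊥) (ht : P ≠ ⊤) : ∃ (d : α × Bool) (J : Set (α × Bool)), d ∉ J ∧ J.Nonempty ∧
      (∃ i, i ∉ J ∧ i ≠ d) ∧
      ∀ w : List (α × Bool), IsCyclicallyReduced w → (∃ c, c * mk w * c⁻¹ ∈ P) →
        ∀ s ∈ w.getLast?, ∀ t ∈ w.head?, GoodTurn d J (letterInv s) t := by
  classical
  obtain ⟨E, hEP, hEx, hE1, hE2⟩ := hP.exists_almostInvariant hb ht
  -- `C v` is the cone of elements whose reduced word begins with `v`, and `M` collects the cones on
  -- which both `E` and its complement are infinite. A longest `v` in `M` is the vertex at which `E`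
  -- is split: each outgoing cone there is finite for `E` or for its complement.
  let C : List (α × Bool) → Set (FreeGroup α) := fun v => {g | v <+: g.toWord}
  have hCr {v : List (α × Bool)} {U : Set (FreeGroup α)} (h : (C v ∩ U).Infinite) :
      IsReduced v := by
    obtain ⟨g, hg, -⟩ := h.nonempty
    exact isReduced_toWord.infix hg.isInfix
  let M : Set (List (α × Bool)) := {v | (C v ∩ E).Infinite ∧ (C v ∩ Eᶜ).Infinite}
  have hM0 : [] ∈ M := by
    have : C [] = Set.univ := by ext; simp [C]
    simp only [M, Set.mem_ofPred_eq, this, Set.univ_inter]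
    exact ⟨hE1, hE2⟩
  obtain ⟨n, hn⟩ := exists_length_bound hEx
  have hbdd : BddAbove (List.length '' M) := by
    refine ⟨n, ?_⟩
    rintro _ ⟨v, hv, rfl⟩
    by_contra! hlt
    have hconst (g) (hg : g ∈ C v) : g ∈ E ↔ mk v ∈ E := by
      obtain ⟨u, hu⟩ := hg
      rw [← hn v hlt u (by rw [hu]; exact isReduced_toWord), hu, mk_toWord]
    obtain ⟨g, hg, hgE⟩ := hv.1.nonempty
    obtain ⟨g', hg', hgE'⟩ := hv.2.nonempty
    exact hgE' ((hconst g' hg').2 ((hconst g hg).1 hgE))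
  obtain ⟨v, hvM, hvl⟩ := Nat.sSup_mem (s := List.length '' M) ⟨_, [], hM0, rfl⟩ hbdd
  have hmax (t) : v ++ [t] ∉ M := fun h => by
    have := le_csSup hbdd ⟨_, h, rfl⟩
    rw [← hvl] at this
    simp at this
  have hvr : IsReduced v := hCr hvM.1
  have hsplit (U : Set (FreeGroup α)) (h : (C v ∩ U).Infinite) :
      ∃ t, (C (v ++ [t]) ∩ U).Infinite := by
    by_contra! hcon
    refine h ((((Set.finite_singleton (mk v)).union (Set.finite_iUnion hcon))).subset ?_)
    rintro g ⟨⟨u, hu⟩, hgU⟩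
    match u, hu with
    | [], hu => left; rw [List.append_nil] at hu; rw [hu, mk_toWord]; rfl
    | t :: u, hu => exact Or.inr (Set.mem_iUnion.2 ⟨t, ⟨u, by simpa using hu⟩, hgU⟩)
  obtain ⟨j, hj⟩ := hsplit E hvM.1
  obtain ⟨i, hi⟩ := hsplit Eᶜ hvM.2
  -- `d` is the direction back to the root, the inverse of the last letter of `v`. At the root there
  -- is no such direction, and any letter other than `i` and `j` will do.
  obtain ⟨d, hjd, hid, hd⟩ : ∃ d, j ≠ d ∧ i ≠ d ∧
      ∀ s ∈ v.getLast?, ∀ t, t ≠ d → s ≠ letterInv t := by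
    rcases List.eq_nil_or_concat v with rfl | ⟨v', s, rfl⟩
    · obtain ⟨x, hx⟩ := exists_ne j.1
      by_cases h : i = (x, true)
      · exact ⟨(x, false), by rintro rfl; exact hx rfl, by rintro rfl; simp at h, by simp⟩
      · exact ⟨(x, true), by rintro rfl; exact hx rfl, h, by simp⟩
    · have hcan : ¬ IsReduced (v'.concat s ++ [letterInv s]) := by
        intro h
        have := h.infix (L₁ := [s, letterInv s]) ⟨v', [], by simp⟩
        rw [isReduced_iff_isChain] at this
        simp at this
      refine ⟨letterInv s, ?_, ?_, ?_⟩
      · rintro rfl; exact hcan (hCr hj)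
      · rintro rfl; exact hcan (hCr hi)
      · intro s' hs' t ht
        simp only [List.concat_eq_append, List.getLast?_append, List.getLast?_singleton,
          Option.some_or, Option.mem_def, Option.some.injEq] at hs'
        subst hs'
        rintro rfl
        simp at ht
  let J : Set (α × Bool) := {t | (C (v ++ [t]) ∩ E).Infinite ∧ t ≠ d}
  -- powers of a cyclically reduced word run into the cone in the direction of its first letter
  have hrun (w : List (α × Bool)) (hw : IsCyclicallyReduced w) (t) (ht : t ∈ w.head?)
      (htd : t ≠ d) : (∀ n : ℕ, mk v * mk w ^ (n + 1) ∈ C (v ++ [t])) ∧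
      Function.Injective fun n : ℕ => mk v * mk w ^ (n + 1) := by
    have hwne : w ≠ [] := by rintro rfl; simp at ht
    have hred := isReduced_append_pow hvr hw fun s hs t' ht' => by
      rw [Option.mem_def] at ht ht'
      rw [ht, Option.some.injEq] at ht'
      exact hd s hs t' (ht' ▸ htd)
    have heq (n : ℕ) : mk v * mk w ^ n = mk (v ++ (List.replicate n w).flatten) := by
      rw [pow_mk, mul_mk]
    refine ⟨fun n => ?_, fun m n hmn => ?_⟩
    · change _ <+: _
      rw [heq, (hred _).toWord_mk, List.replicate_succ, List.flatten_cons,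
        List.prefix_append_right_inj]
      obtain ⟨w', rfl⟩ : ∃ w', w = t :: w' := by
        cases w with
        | nil => simp at ht
        | cons a l => simp at ht; exact ⟨l, by rw [ht]⟩
      exact ⟨w' ++ _, by simp; rfl⟩
    · have := congrArg norm hmn
      simp only [heq, (hred _).norm_mk, List.length_append, List.length_flatten,
        List.map_replicate, List.sum_replicate, smul_eq_mul] at this
      have h0 : 0 < w.length := List.length_pos_iff.2 hwne
      have : (m + 1) * w.length = (n + 1) * w.length := by omega
      have := Nat.eq_of_mul_eq_mul_right h0 this
      omega
  have main (w : List (α × Bool)) (hw : IsCyclicallyReduced w) (hc : ∃ c, c * mk w * c⁻¹ ∈ P)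
      (s) (hs : s ∈ w.getLast?) (t) (ht : t ∈ w.head?) (hsJ : letterInv s ∈ J) :
      t ∈ J ∨ t = d := by
    by_contra! hcon
    obtain ⟨c, hc⟩ := hc
    have htE : (C (v ++ [t]) ∩ E).Finite := by
      by_contra h; exact hcon.1 ⟨h, hcon.2⟩
    have hsE : (C (v ++ [letterInv s]) ∩ Eᶜ).Finite := by
      by_contra h; exact hmax _ ⟨hsJ.1, h⟩
    have hEc := hEx c⁻¹
    obtain ⟨h1, h1i⟩ := hrun w hw t ht hcon.2
    obtain ⟨h2, h2i⟩ := hrun (invRev w) (isCyclicallyReduced_invRev hw) (letterInv s)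
      (by simp only [invRev, List.head?_reverse, List.getLast?_map]
          rw [Option.mem_def] at hs; rw [hs]; rfl) hsJ.2
    rw [← inv_mk] at h2 h2i
    -- Since `w ^ k * c⁻¹ = c⁻¹ * (c * w * c⁻¹) ^ k`, invariance under `P` makes membership
    -- independent of `k`. A bad turn sends positive powers into a cone almost disjoint from `E` and
    -- negative powers into one almost contained in `E`; the shift by `c⁻¹` costs only finitely many
    -- elements.
    have hinv (g : FreeGroup α) (k : ℤ) : g * mk w ^ k * c⁻¹ ∈ E ↔ g * c⁻¹ ∈ E := by
      rw [← hEP (g * c⁻¹) ((c * mk w * c⁻¹) ^ k) (zpow_mem hc k), conj_zpow]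
      simp [mul_assoc]
    have f1 : {m : ℕ | mk v * mk w ^ (m + 1) ∈ C (v ++ [t]) ∩ E ∪
        {g | ¬ (g ∈ E ↔ g * c⁻¹ ∈ E)}}.Finite := (htE.union hEc).preimage h1i.injOn
    have f2 : {m : ℕ | mk v * (mk w)⁻¹ ^ (m + 1) ∈ C (v ++ [letterInv s]) ∩ Eᶜ ∪
        {g | ¬ (g ∈ E ↔ g * c⁻¹ ∈ E)}}.Finite := (hsE.union hEc).preimage h2i.injOn
    obtain ⟨m, hm⟩ := f1.exists_notMem
    obtain ⟨k, hk⟩ := f2.exists_notMem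
    simp only [Set.mem_ofPred_eq, Set.mem_union, Set.mem_inter_iff, h1, h2, true_and,
      Set.mem_compl_iff, not_or, not_not] at hm hk
    have e1 := hinv (mk v) ((m + 1 : ℕ) : ℤ)
    have e2 := hinv (mk v) (-((k + 1 : ℕ) : ℤ))
    rw [zpow_natCast] at e1
    rw [zpow_neg, zpow_natCast, ← inv_pow] at e2
    tauto
  refine ⟨d, J, fun h => h.2 rfl, ⟨j, hj, hjd⟩, ⟨i, fun h => hmax i ⟨h.1, hi⟩, hid⟩, ?_⟩
  intro w hw hc s hs t ht
  refine ⟨main w hw hc s hs t ht, fun htJ => ?_⟩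
  refine main (invRev w) (isCyclicallyReduced_invRev hw) ?_ (letterInv t) ?_ (letterInv s) ?_
    (by simpa using htJ)
  · obtain ⟨c, hc⟩ := hc
    exact ⟨c, by rw [← inv_mk]; simpa [mul_assoc] using inv_mem hc⟩
  · simp only [invRev, List.getLast?_reverse, List.head?_map]
    rw [Option.mem_def] at ht; rw [ht]; rfl
  · simp only [invRev, List.head?_reverse, List.getLast?_map]
    rw [Option.mem_def] at hs; rw [hs]; rfl

end FreeGroup

/-! ### Whitehead moves and the reduction step -/

namespace FreeGroup

variable {α : Type}

theorem IsCyclicallyReduced.append_comm {A B : List (α × Bool)}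
    (h : IsCyclicallyReduced (A ++ B)) : IsCyclicallyReduced (B ++ A) := by
  rcases eq_or_ne A [] with rfl | hA
  · simpa using h
  rcases eq_or_ne B [] with rfl | hB
  · simpa using h
  rw [isCyclicallyReduced_iff, IsReduced, List.isChain_append] at h ⊢
  obtain ⟨⟨h1, h2, h3⟩, h4⟩ := h
  rw [List.head?_append_of_ne_nil _ hA, List.getLast?_append_of_ne_nil _ hB] at h4
  refine ⟨⟨h2, h1, h4⟩, ?_⟩
  rwa [List.head?_append_of_ne_nil _ hB, List.getLast?_append_of_ne_nil _ hA]

/-- No cyclically reduced word conjugate into `P` has a turn between `J` and the complement of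
`J ∪ {d}`. -/
def IsCut (P : Subgroup (FreeGroup α)) (d : α × Bool) (J : Set (α × Bool)) : Prop :=
  ∀ w : List (α × Bool), IsCyclicallyReduced w → (∃ c, c * mk w * c⁻¹ ∈ P) →
    ∀ s ∈ w.getLast?, ∀ t ∈ w.head?, GoodTurn d J (letterInv s) t

/-- Rotating the cyclic word is a conjugation and brings any inner turn to the seam, which is where
`IsCut` applies. -/
theorem IsCut.goodTurn_of_infix {P : Subgroup (FreeGroup α)} {d : α × Bool} {J : Set (α × Bool)}
    (h : IsCut P d J) {w : List (α × Bool)} (hw : IsCyclicallyReduced w)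
    (hc : ∃ c, c * mk w * c⁻¹ ∈ P) {s t : α × Bool} (hst : [s, t] <:+: w) :
    GoodTurn d J (letterInv s) t := by
  obtain ⟨p, q, rfl⟩ := hst
  have e : p ++ [s, t] ++ q = (p ++ [s]) ++ (t :: q) := by simp
  rw [e] at hw hc
  refine h _ hw.append_comm ?_ s (by rw [← List.append_assoc, List.getLast?_concat]; rfl)
    t (by simp)
  obtain ⟨c, hc⟩ := hc
  refine ⟨c * mk (p ++ [s]), ?_⟩
  rw [← mul_mk] at hc
  rw [← mul_mk (L₁ := t :: q)]
  generalize mk (p ++ [s]) = x at *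
  generalize mk (t :: q) = y at *
  have : c * x * (y * x) * (c * x)⁻¹ = c * (x * y) * c⁻¹ := by group
  rwa [this]

theorem IsCut.isChain {P : Subgroup (FreeGroup α)} {d : α × Bool} {J : Set (α × Bool)}
    (h : IsCut P d J) {w : List (α × Bool)} (hw : IsCyclicallyReduced w)
    (hc : ∃ c, c * mk w * c⁻¹ ∈ P) : w.IsChain fun s t => GoodTurn d J (letterInv s) t :=
  (List.isChain_isInfix w).imp fun _ _ hst => h.goodTurn_of_infix hw hc hst

section Move

open Classical in
/-- The letter `d` if `t ∈ J`, and `1` otherwise. -/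
noncomputable def moveFactor (d : α × Bool) (J : Set (α × Bool)) (t : α × Bool) : FreeGroup α :=
  if t ∈ J then mk [d] else 1

theorem mk_pair_false (x : α) : mk [(x, false)] = (of x)⁻¹ := rfl

theorem mk_pair_true (x : α) : mk [(x, true)] = of x := rfl

/-- The homomorphism multiplying each letter of `J` on the left by `d`. -/
noncomputable def moveHom (d : α × Bool) (J : Set (α × Bool)) : FreeGroup α →* FreeGroup α :=
  lift fun x => moveFactor d J (x, true) * of x * (moveFactor d J (x, false))⁻¹

theorem moveHom_letter (d : α × Bool) (J : Set (α × Bool)) (t : α × Bool) :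
    moveHom d J (mk [t]) = moveFactor d J t * mk [t] * (moveFactor d J (letterInv t))⁻¹ := by
  obtain ⟨x, _ | _⟩ := t
  · rw [mk_pair_false, _root_.map_inv, moveHom, lift_apply_of]; simp [letterInv, mul_assoc]
  · rw [mk_pair_true, moveHom, lift_apply_of]; simp [letterInv]

theorem moveHom_self {d : α × Bool} {J : Set (α × Bool)} (h1 : d ∉ J) (h2 : letterInv d ∉ J)
    (d' : α × Bool) : moveHom d' J (mk [d]) = mk [d] := by
  rw [moveHom_letter]; simp [moveFactor, h1, h2]

theorem moveHom_moveFactor {d : α × Bool} {J : Set (α × Bool)} (h1 : d ∉ J)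
    (h2 : letterInv d ∉ J) (d' t : α × Bool) :
    moveHom d' J (moveFactor d J t) = moveFactor d J t := by
  unfold moveFactor
  split_ifs
  · exact moveHom_self h1 h2 d'
  · simp

theorem moveFactor_letterInv (d : α × Bool) (J : Set (α × Bool)) (t) :
    moveFactor (letterInv d) J t = (moveFactor d J t)⁻¹ := by
  unfold moveFactor
  split_ifs
  · exact mk_letterInv d
  · simp

/-- The Whitehead automorphism multiplying each letter of `J` on the left by `d`. -/
noncomputable def move (d : α × Bool) (J : Set (α × Bool)) (h1 : d ∉ J) (h2 : letterInv d ∉ J) :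
    FreeGroup α ≃* FreeGroup α :=
  MonoidHom.toMulEquiv (moveHom d J) (moveHom (letterInv d) J)
    (ext_hom _ _ fun x => by
      have := moveHom_moveFactor h1 h2 (letterInv d)
      rw [MonoidHom.comp_apply, ← mk_pair_true, moveHom_letter, _root_.map_mul, _root_.map_mul,
        _root_.map_inv, this, this, moveHom_letter]
      simp [moveFactor_letterInv, mul_assoc])
    (ext_hom _ _ fun x => by
      have := moveHom_moveFactor h1 h2 d
      rw [MonoidHom.comp_apply, ← mk_pair_true, moveHom_letter, _root_.map_mul, _root_.map_mul,
        _root_.map_inv, moveFactor_letterInv, moveFactor_letterInv, _root_.map_inv, _root_.map_inv,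
        this, this, moveHom_letter]
      simp [mul_assoc])

variable {d : α × Bool} {J : Set (α × Bool)} (h1 : d ∉ J) (h2 : letterInv d ∉ J)

theorem move_letter (t : α × Bool) : move d J h1 h2 (mk [t]) =
    moveFactor d J t * mk [t] * (moveFactor d J (letterInv t))⁻¹ := moveHom_letter d J t

theorem move_symm_letter (t : α × Bool) : (move d J h1 h2).symm (mk [t]) =
    (moveFactor d J t)⁻¹ * mk [t] * moveFactor d J (letterInv t) := by
  have := moveHom_letter (letterInv d) J t
  rw [moveFactor_letterInv, moveFactor_letterInv, inv_inv] at this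
  exact this

theorem moveFactor_mem {K : Subgroup (FreeGroup α)} {d : α × Bool} (hd : mk [d] ∈ K) (t) :
    moveFactor d J t ∈ K := by
  unfold moveFactor
  split_ifs
  · exact hd
  · exact one_mem _

theorem move_of_fixed {x : α} (hx : (x, true) ∉ J) (hx' : (x, false) ∉ J) :
    move d J h1 h2 (of x) = of x := by
  rw [← mk_pair_true, move_letter]; simp [moveFactor, letterInv, hx, hx']

/-- The side factor of a path in the split rose. -/
def side (d : α × Bool) (s : Bool) : FreeGroup α := if s then mk [d] else 1

/-- The direction `x` may leave from side `s`. -/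
def SideOK (d : α × Bool) (J : Set (α × Bool)) (s : Bool) (x : α × Bool) : Prop :=
  (s = true → x ∈ J ∨ x = d) ∧ (s = false → x ∉ J)

/-- Split the vertex of the rose into a side carrying `J` and a side carrying the remaining
directions, joined by a new edge that takes over the name `d`, while the old edge `d` is collapsed.
A letter travels from side `s` to side `s'` at a cost of at most one letter, and the letter `d`
leaving the `J` side, or its inverse arriving there, costs nothing. -/
theorem move_step {t : α × Bool} {s s' : Bool} (hs : SideOK d J s t)
    (hs' : SideOK d J s' (letterInv t)) :
    ∃ m : List (α × Bool), move d J h1 h2 (mk [t]) = side d s * mk m * (side d s')⁻¹ ∧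
      m.length ≤ 1 ∧ ((s = true ∧ t = d) ∨ (s' = true ∧ letterInv t = d) → m = []) := by
  rw [move_letter]
  by_cases htd : t = d
  · subst htd
    have : s' = false := by
      by_contra h
      rw [Bool.not_eq_false] at h
      rcases hs'.1 h with h | h
      · exact h2 h
      · exact letterInv_ne _ h
    subst this
    simp only [moveFactor, h1, h2, if_false, inv_one, mul_one, one_mul]
    cases s
    · exact ⟨[t], by simp [side], by simp, by simp⟩
    · exact ⟨[], by simp [side, ← one_eq_mk], by simp, by simp⟩
  by_cases htd' : letterInv t = d
  · subst htd'
    rw [letterInv_letterInv] at h2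
    have : s = false := by
      by_contra h
      rw [Bool.not_eq_false] at h
      rcases hs.1 h with h | h
      · exact h2 h
      · exact letterInv_ne _ h.symm
    subst this
    simp only [moveFactor, h1, h2, if_false, inv_one, mul_one, one_mul]
    cases s'
    · exact ⟨[t], by simp [side], by simp, by simp⟩
    · exact ⟨[], by simp [side, ← one_eq_mk, mk_letterInv], by simp, by simp⟩
  refine ⟨[t], ?_, by simp, by simp [htd, htd']⟩
  have e (s) (x) (hs : SideOK d J s x) (hx : x ≠ d) : moveFactor d J x = side d s := by
    cases s
    · simp [moveFactor, side, hs.2 rfl]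
    · simp [moveFactor, side, (hs.1 rfl).resolve_right hx]
  rw [e s t hs htd, e s' _ hs' htd']

/-- A word whose turns are all good does not become longer under the Whitehead move, and it
becomes shorter if it crosses the collapsed edge. -/
theorem move_word (L : List (α × Bool)) (hne : L ≠ [])
    (hL : L.IsChain fun s t => GoodTurn d J (letterInv s) t) (s e : Bool)
    (hs : ∀ t ∈ L.head?, SideOK d J s t) (he : ∀ t ∈ L.getLast?, SideOK d J e (letterInv t)) :
    ∃ M : List (α × Bool), move d J h1 h2 (mk L) = side d s * mk M * (side d e)⁻¹ ∧
      M.length ≤ L.length ∧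
      (((s = true ∧ d ∈ L.head?) ∨ (e = true ∧ letterInv d ∈ L.getLast?) ∨
        ∃ u t, [u, t] <:+: L ∧ ((letterInv u = d ∧ t ∈ J) ∨ (letterInv u ∈ J ∧ t = d))) →
        M.length < L.length) := by
  classical
  induction L generalizing s with
  | nil => exact absurd rfl hne
  | cons t L ih =>
    cases L with
    | nil =>
      obtain ⟨m, hm, hm1, hm2⟩ := move_step h1 h2 (hs t (by simp)) (he t (by simp))
      refine ⟨m, hm, hm1, ?_⟩
      rintro (⟨h, h'⟩ | ⟨h, h'⟩ | ⟨u, v, h, -⟩)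
      · have : t = d := by simpa using h'
        simp [hm2 (Or.inl ⟨h, this⟩)]
      · have : letterInv t = d := by rw [letterInv_eq_iff]; simpa using h'
        simp [hm2 (Or.inr ⟨h, this⟩)]
      · have := h.length_le
        simp at this
    | cons t' L =>
      rw [List.isChain_cons_cons] at hL
      -- The side on which the path passes between `t` and `t'`. A good turn lets both letters use
      -- the same side, so the side factors cancel.
      let s' : Bool := decide (letterInv t ∈ J ∨ t' ∈ J)
      have hst : SideOK d J s' (letterInv t) := by
        constructor
        · intro h
          rcases of_decide_eq_true h with h | h
          · exact Or.inl h
          · exact hL.1.2 h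
        · intro h h'
          exact of_decide_eq_false h (Or.inl h')
      have hst' : SideOK d J s' t' := by
        constructor
        · intro h
          rcases of_decide_eq_true h with h | h
          · exact hL.1.1 h
          · exact Or.inl h
        · intro h h'
          exact of_decide_eq_false h (Or.inr h')
      obtain ⟨m, hm, hm1, hm2⟩ := move_step h1 h2 (hs t (by simp)) hst
      obtain ⟨M, hM, hM1, hM2⟩ := ih (by simp) hL.2 s' (by simpa using hst') (by simpa using he)
      refine ⟨m ++ M, ?_, ?_, ?_⟩
      · have : mk (t :: t' :: L) = mk [t] * mk (t' :: L) := by rw [mul_mk]; rfl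
        rw [this, _root_.map_mul, hm, hM, ← mul_mk]
        simp only [mul_assoc, inv_mul_cancel_left]
      · simp only [List.length_append, List.length_cons] at hM1 ⊢
        omega
      · intro h
        have : m = [] ∨ M.length < (t' :: L).length := by
          rcases h with ⟨h, h'⟩ | ⟨h, h'⟩ | ⟨u, v, h, h'⟩
          · left; exact hm2 (Or.inl ⟨h, by simpa using h'⟩)
          · right; exact hM2 (Or.inr (Or.inl ⟨h, by simpa using h'⟩))
          · rw [List.infix_cons_iff] at h
            rcases h with h | h
            · obtain ⟨e1, h⟩ := List.cons_prefix_cons.1 h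
              obtain ⟨e2, -⟩ := List.cons_prefix_cons.1 h
              subst e1 e2
              rcases h' with ⟨h3, h4⟩ | ⟨h3, h4⟩
              · left; exact hm2 (Or.inr ⟨by simp [s', h4], h3⟩)
              · right; exact hM2 (Or.inl ⟨by simp [s', h3], by simp [h4]⟩)
            · right; exact hM2 (Or.inr (Or.inr ⟨u, v, h, h'⟩))
        rcases this with rfl | h
        · simp only [List.nil_append, List.length_cons] at hM1 ⊢; omega
        · simp only [List.length_append, List.length_cons] at h ⊢; omega

end Move

/-- A word that starts and ends outside `S` but visits `S` crosses from outside to inside. -/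
theorem exists_crossing {S : Set (α × Bool)} (L : List (α × Bool))
    (hL : L.IsChain fun s t => letterInv s ∈ S ↔ t ∈ S) (hh : ∀ t ∈ L.head?, t ∉ S)
    (hl : ∀ t ∈ L.getLast?, letterInv t ∉ S) (hv : ∃ t ∈ L, t ∈ S ∨ letterInv t ∈ S) :
    ∃ u t, [u, t] <:+: L ∧ letterInv u ∈ S ∧ u ∉ S ∧ t ∈ S := by
  induction L with
  | nil => simp at hv
  | cons t L ih =>
    have ht := hh t (by simp)
    cases L with
    | nil =>
      have := hl t (by simp)
      simp only [List.mem_singleton, exists_eq_left] at hv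
      tauto
    | cons t' L =>
      rw [List.isChain_cons_cons] at hL
      by_cases h : letterInv t ∈ S
      · exact ⟨t, t', ⟨[], L, by simp⟩, h, ht, hL.1.1 h⟩
      · obtain ⟨u, v, h1, h2⟩ := ih hL.2 (by simpa using fun h' => h (hL.1.2 h'))
          (by simpa using hl) (by
            obtain ⟨x, hx, hx'⟩ := hv
            rw [List.mem_cons] at hx
            rcases hx with rfl | hx
            · tauto
            · exact ⟨x, hx, hx'⟩)
        exact ⟨u, v, h1.trans ⟨[t], [], by simp⟩, h2⟩

/-- A cut has two interchangeable sides; this allows passing to whichever avoids a given set of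
directions. -/
theorem goodTurn_compl {d : α × Bool} {J : Set (α × Bool)} {x y : α × Bool}
    (h : GoodTurn d J x y) : GoodTurn d (J ∪ {d})ᶜ x y := by
  unfold GoodTurn at *
  simp only [Set.mem_compl_iff, Set.mem_union, Set.mem_singleton_iff]
  tauto

/-- Each new generator stays in the subgroup spanned by the old one and `d`. This is what makes
shortening compatible with closure under lines. -/
theorem move_symm_mem {d : α × Bool} {J : Set (α × Bool)} (h1 : d ∉ J) (h2 : letterInv d ∉ J)
    (x : α) : (move d J h1 h2).symm (of x) ∈ closure {of x, mk [d]} := by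
  rw [← mk_pair_true, move_symm_letter]
  have hd : mk [d] ∈ closure {mk [(x, true)], mk [d]} := subset_closure (by simp)
  exact mul_mem (mul_mem (inv_mem (moveFactor_mem hd _)) (subset_closure (by simp)))
    (moveFactor_mem hd _)

/-- Here no turn leads from `S` to its complement. The word must enter `S` through some letter `u`,
with `u⁻¹` in `S` and `u` not. Then `u⁻¹` can serve as cut vertex with `S` minus `u⁻¹` as its side,
and the turn following `u` makes the move strictly shortening. -/
theorem exists_shortening_of_separated [DecidableEq α] {L : List (α × Bool)} (hr : IsReduced L)
    {J S : Set (α × Bool)} (hJS : J ⊆ S)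
    (hc : L.IsChain fun s t => letterInv s ∈ S ↔ t ∈ S) (hh : ∀ t ∈ L.head?, t ∉ S)
    (hl : ∀ t ∈ L.getLast?, letterInv t ∉ S) (hv : ∃ t ∈ L, t ∈ J ∨ letterInv t ∈ J)
    (hS : ∀ x, (x, true) ∉ J → (x, false) ∉ J → (x, true) ∉ S ∧ (x, false) ∉ S) :
    ∃ (θ : FreeGroup α ≃* FreeGroup α) (d' : α × Bool), (θ (mk L)).norm < L.length ∧
      (∀ x, θ.symm (of x) ∈ closure {of x, mk [d']}) ∧
      ∀ x, (x, true) ∉ J → (x, false) ∉ J → θ (of x) = of x := by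
  have hne : L ≠ [] := by rintro rfl; simp at hv
  obtain ⟨u, t, hut, hu, hu', ht⟩ := exists_crossing L hc hh hl (by
    obtain ⟨t, ht, h⟩ := hv
    exact ⟨t, ht, h.imp (fun h => hJS h) fun h => hJS h⟩)
  have htu : t ≠ letterInv u := by
    have := hr.infix hut
    rw [isReduced_iff_isChain] at this
    simp only [List.isChain_cons_cons] at this
    intro h
    exact this.1 (by rw [h, letterInv_letterInv])
  have h1 : letterInv u ∉ S \ {letterInv u} := by simp
  have h2 : letterInv (letterInv u) ∉ S \ {letterInv u} := by simp [hu']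
  obtain ⟨M, hM, -, hM2⟩ := move_word h1 h2 L hne (hc.imp fun a b hab => by
      constructor
      · intro h
        by_cases hb : b = letterInv u
        · exact Or.inr hb
        · exact Or.inl ⟨hab.1 h.1, hb⟩
      · intro h
        by_cases ha : letterInv a = letterInv u
        · exact Or.inr ha
        · exact Or.inl ⟨hab.2 h.1, ha⟩) false false
      (fun t ht => ⟨by simp, fun _ h => hh t ht h.1⟩)
      (fun t ht => ⟨by simp, fun _ h => hl t ht h.1⟩)
  refine ⟨move _ _ h1 h2, letterInv u, ?_, move_symm_mem h1 h2, fun x hx hx' => ?_⟩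
  · rw [hM]
    simp only [side, Bool.false_eq_true, if_false, one_mul, inv_one, mul_one]
    exact norm_mk_le.trans_lt (hM2 (Or.inr (Or.inr ⟨u, t, hut, Or.inl ⟨rfl, ht, htu⟩⟩)))
  · exact move_of_fixed h1 h2 (fun h => (hS x hx hx').1 h.1) fun h => (hS x hx hx').2 h.1

/-- **Reduction step.** If the turns of a reduced word `L` do not separate `J` from the complement
of `J ∪ {d}`, and `L` visits `J` but neither starts nor ends there, then some
automorphism shortens `L`. It multiplies generators by powers of a single letter, and only those
occurring in `J`. -/
theorem exists_shortening [DecidableEq α] {L : List (α × Bool)} (hr : IsReduced L)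
    {d : α × Bool} {J : Set (α × Bool)}
    (hd : d ∉ J) (hL : L.IsChain fun s t => GoodTurn d J (letterInv s) t)
    (hh : ∀ t ∈ L.head?, t ∉ J) (hl : ∀ t ∈ L.getLast?, letterInv t ∉ J)
    (hv : ∃ t ∈ L, t ∈ J ∨ letterInv t ∈ J) :
    ∃ (θ : FreeGroup α ≃* FreeGroup α) (d' : α × Bool), (θ (mk L)).norm < L.length ∧
      (∀ x, θ.symm (of x) ∈ closure {of x, mk [d']}) ∧
      ∀ x, (x, true) ∉ J → (x, false) ∉ J → θ (of x) = of x := by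
  have hne : L ≠ [] := by rintro rfl; simp at hv
  by_cases hd' : letterInv d ∈ J
  -- The move needs both `d` and its inverse off the moving side, so the opposite side of the cut is
  -- used.
  · let I := (J ∪ {d})ᶜ
    have h1 : d ∉ I := by simp [I]
    have hI {t} (ht : t ∉ J) : t ∈ I ∨ t = d :=
      or_iff_not_imp_right.2 fun h => by simp [I, ht, h]
    have h2 : letterInv d ∉ I := by simp [I, hd']
    have hfix (x) (hx : (x, true) ∉ J) (hx' : (x, false) ∉ J) : (x, true) ≠ d ∧ (x, false) ≠ d := by
      constructor <;> rintro rfl <;> simp [letterInv] at hd' <;> contradiction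
    by_cases hcross : d ∈ L.head? ∨ letterInv d ∈ L.getLast? ∨
        ∃ u t, [u, t] <:+: L ∧ ((letterInv u = d ∧ t ∈ I) ∨ (letterInv u ∈ I ∧ t = d))
    · obtain ⟨M, hM, -, hM2⟩ := move_word h1 h2 L hne (hL.imp fun a b hab => goodTurn_compl hab)
        true true
        (fun t ht => ⟨fun _ => hI (hh t ht), by simp⟩)
        (fun t ht => ⟨fun _ => hI (hl t ht), by simp⟩)
      -- The word starts and ends on the moving side, so its image is conjugated by `d`. Undoing the
      -- conjugation also restores the generators with neither letter in `J`, since both of their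
      -- letters lie in `I`.
      refine ⟨(move _ _ h1 h2).trans (MulAut.conj (mk [d])⁻¹), d, ?_, fun x => ?_,
        fun x hx hx' => ?_⟩
      · rw [MulEquiv.trans_apply, hM]
        simp only [side, if_true, MulAut.conj_apply, inv_inv]
        have : (mk [d])⁻¹ * (mk [d] * mk M * (mk [d])⁻¹) * mk [d] = mk M := by group
        rw [this]
        exact norm_mk_le.trans_lt (hM2 (by simpa only [true_and] using hcross))
      · have h := move_symm_mem h1 h2
        rw [MulEquiv.symm_trans_apply]
        have e : (MulAut.conj (mk [d])⁻¹).symm (of x) = mk [d] * of x * (mk [d])⁻¹ := by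
          rw [MulAut.conj_symm_apply]; simp
        rw [e, _root_.map_mul, _root_.map_mul, _root_.map_inv]
        have hdd : (move d I h1 h2).symm (mk [d]) = mk [d] := by
          rw [move_symm_letter]; simp [moveFactor, h1, h2]
        rw [hdd]
        have hd : mk [d] ∈ closure {of x, mk [d]} := subset_closure (by simp)
        exact mul_mem (mul_mem hd (h x)) (inv_mem hd)
      · rw [MulEquiv.trans_apply, ← mk_pair_true, move_letter]
        obtain ⟨e1, e2⟩ := hfix x hx hx'
        have m1 : (x, true) ∈ I := by simp [I, hx, e1]
        have m2 : letterInv (x, true) ∈ I := by simp [I, letterInv, hx', e2]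
        simp only [moveFactor, m1, m2, if_true, MulAut.conj_apply, mk_pair_true]
        group
    · push Not at hcross
      -- Without a turn between `d` and `I`, the set `J ∪ {d}` is a union of components.
      refine exists_shortening_of_separated hr (S := J ∪ {d}) Set.subset_union_left ?_ ?_ ?_ hv ?_
      · refine (List.isChain_isInfix L).imp_of_mem_imp ?_
        intro a b _ _ hab
        have h3 := hcross.2.2 a b hab
        have h4 := goodTurn_compl (List.IsChain.infix hL hab).rel
        constructor
        · intro h
          by_contra hb
          rcases h4.2 hb with h5 | h5
          · exact h5 h
          · exact h3.1 h5 hb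
        · intro h
          by_contra hb
          rcases h4.1 hb with h5 | h5
          · exact h5 h
          · exact h3.2 hb h5
      · rintro t ht (h | rfl)
        · exact hh t ht h
        · exact hcross.1 ht
      · rintro t ht (h | h)
        · exact hl t ht h
        · rw [Set.mem_singleton_iff, letterInv_eq_iff] at h
          exact hcross.2.1 (h ▸ ht)
      · intro x hx hx'
        simp [hx, hx', (hfix x hx hx').1, (hfix x hx hx').2]
  · by_cases hcross : ∃ u t, [u, t] <:+: L ∧ ((letterInv u = d ∧ t ∈ J) ∨ (letterInv u ∈ J ∧ t = d))
    · obtain ⟨M, hM, -, hM2⟩ := move_word hd hd' L hne hL false false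
        (fun t ht => ⟨by simp, fun _ => hh t ht⟩) (fun t ht => ⟨by simp, fun _ => hl t ht⟩)
      refine ⟨move _ _ hd hd', d, ?_, move_symm_mem hd hd', fun x hx hx' => ?_⟩
      · rw [hM]
        simp only [side, Bool.false_eq_true, if_false, one_mul, inv_one, mul_one]
        exact norm_mk_le.trans_lt (hM2 (Or.inr (Or.inr hcross)))
      · exact move_of_fixed hd hd' hx hx'
    · push Not at hcross
      refine exists_shortening_of_separated hr subset_rfl ?_ hh hl hv fun x hx hx' => ⟨hx, hx'⟩
      refine (List.isChain_isInfix L).imp_of_mem_imp ?_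
      intro a b _ _ hab
      have := hcross a b hab
      have hg : GoodTurn d J (letterInv a) b := List.IsChain.infix hL hab |>.rel
      exact ⟨fun h => (hg.1 h).resolve_right (this.2 h),
        fun h => (hg.2 h).resolve_right fun e => this.1 e h⟩

end FreeGroup

/-! ### Coordinate factors, cyclic factors, and words containing all turns -/

namespace FreeGroup

variable {α : Type}

theorem mk_mem_closure_of {S : Set α} {L : List (α × Bool)} (h : ∀ t ∈ L, t.1 ∈ S) :
    mk L ∈ closure (of '' S) := by
  induction L with
  | nil => exact one_mem _
  | cons t L ih =>
    have : mk (t :: L) = mk [t] * mk L := by rw [mul_mk]; rfl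
    rw [this]
    refine mul_mem ?_ (ih fun s hs => h s (List.mem_cons_of_mem _ hs))
    have h1 : of t.1 ∈ closure (of '' S) := subset_closure ⟨_, h t List.mem_cons_self, rfl⟩
    obtain ⟨x, _ | _⟩ := t
    · exact inv_mem h1
    · exact h1

theorem fst_mem_of_mem_toWord [DecidableEq α] {S : Set α} {g : FreeGroup α}
    (h : g ∈ closure (of '' S)) {t : α × Bool} (ht : t ∈ g.toWord) : t.1 ∈ S := by
  induction h using closure_induction generalizing t with
  | mem x hx =>
    obtain ⟨i, hi, rfl⟩ := hx
    rw [toWord_of, List.mem_singleton] at ht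
    subst ht; exact hi
  | one => simp at ht
  | mul x y _ _ hx hy =>
    rcases List.mem_append.1 ((toWord_mul_sublist x y).subset ht) with h | h
    · exact hx h
    · exact hy h
  | inv x _ hx =>
    rw [toWord_inv, invRev, List.mem_reverse, List.mem_map] at ht
    obtain ⟨s, hs, rfl⟩ := ht
    have := hx hs
    exact this

theorem mem_closure_of_iff [DecidableEq α] {S : Set α} {g : FreeGroup α} :
    g ∈ closure (of '' S) ↔ ∀ t ∈ g.toWord, t.1 ∈ S :=
  ⟨fun h _ => fst_mem_of_mem_toWord h, fun h => by
    have := mk_mem_closure_of h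
    rwa [mk_toWord] at this⟩

theorem of_mem_closure_iff {S : Set α} {x : α} : of x ∈ closure (of '' S) ↔ x ∈ S := by
  classical
  simp [mem_closure_of_iff]

theorem mk_letter_mem_closure_iff {S : Set α} {t : α × Bool} :
    mk [t] ∈ closure (of '' S) ↔ t.1 ∈ S := by
  obtain ⟨x, _ | _⟩ := t
  · rw [mk_pair_false, inv_mem_iff]; exact of_mem_closure_iff
  · exact of_mem_closure_iff

/-- The automorphism replacing the generator of a letter `t` so that `t` maps to `u * t * v`, for
`u` and `v` not involving this generator. -/
theorem exists_mulEquiv_letter (t : α × Bool) {u v : FreeGroup α}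
    (hu : u ∈ closure (of '' {t.1}ᶜ)) (hv : v ∈ closure (of '' {t.1}ᶜ)) :
    ∃ η : FreeGroup α ≃* FreeGroup α, η (mk [t]) = u * mk [t] * v ∧
      ∀ x, x ≠ t.1 → η (of x) = of x := by
  classical
  wlog ht : t.2 = true generalizing t u v
  · obtain ⟨η, h1, h2⟩ := this (letterInv t) (u := v⁻¹) (v := u⁻¹) (inv_mem hv) (inv_mem hu) (by
      simpa [letterInv] using ht)
    refine ⟨η, ?_, h2⟩
    rw [mk_letterInv, _root_.map_inv] at h1
    rw [← inv_inj, h1]; group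
  obtain ⟨c, _⟩ := t
  subst ht
  simp only [mk_pair_true] at *
  let f (u v : FreeGroup α) : FreeGroup α →* FreeGroup α := lift (Function.update of c (u * of c * v))
  have f1 (u v) : f u v (of c) = u * of c * v := by simp [f]
  have f2 (u v) (x) (hx : x ≠ c) : f u v (of x) = of x := by simp [f, hx]
  have f3 (u v) {w} (hw : w ∈ closure (of '' {c}ᶜ)) : f u v w = w := by
    have : closure (of '' {c}ᶜ) ≤ (f u v).eqLocus (MonoidHom.id _) := by
      rw [closure_le]
      rintro _ ⟨x, hx, rfl⟩
      exact f2 u v x hx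
    exact this hw
  have e (u v u' v') (hu : u ∈ closure (of '' {c}ᶜ)) (hv : v ∈ closure (of '' {c}ᶜ))
      (h1 : u * u' = 1) (h2 : v' * v = 1) :
      (f u' v').comp (f u v) = MonoidHom.id _ := ext_hom _ _ fun x => by
    by_cases hx : x = c
    · subst hx
      rw [MonoidHom.comp_apply, f1, _root_.map_mul, _root_.map_mul, f1, f3 _ _ hu, f3 _ _ hv]
      calc u * (u' * of x * v') * v = (u * u') * of x * (v' * v) := by group
        _ = _ := by rw [h1, h2]; simp
    · rw [MonoidHom.comp_apply, f2 _ _ _ hx, f2 _ _ _ hx]; rfl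
  refine ⟨MonoidHom.toMulEquiv (f u v) (f u⁻¹ v⁻¹) (e _ _ _ _ hu hv (by simp) (by simp))
    (e _ _ _ _ (inv_mem hu) (inv_mem hv) (by simp) (by simp)), f1 u v, f2 u v⟩

@[simp] theorem coe_ofFreeGroup : ⇑(FreeGroupBasis.ofFreeGroup α) = of :=
  funext fun _ => FreeGroupBasis.ofFreeGroup_apply _

theorem isFactor_closure_of (S : Set α) : IsFactor (closure (of '' S)) :=
  ⟨α, FreeGroupBasis.ofFreeGroup α, S, by simp⟩

theorem isFactor_closure_singleton_mulEquiv {w : FreeGroup α} (h : IsFactor (closure {w}))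
    (e : FreeGroup α ≃* FreeGroup α) : IsFactor (closure {e w}) := by
  have := h.map_equiv e
  rw [MonoidHom.map_closure, Set.image_singleton] at this
  exact this

theorem isFactor_closure_singleton_letter (t : α × Bool) : IsFactor (closure {mk [t]}) := by
  have : closure {mk [t]} = closure (of '' {t.1}) := by
    rw [Set.image_singleton]
    obtain ⟨x, _ | _⟩ := t
    · rw [mk_pair_false, ← zpowers_eq_closure, ← zpowers_eq_closure, zpowers_inv]
    · rfl
  rw [this]
  exact isFactor_closure_of _

end FreeGroup

namespace IsFactor

open FreeGroup

variable {G : Type} [Group G]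

/-- The subgroups generated by parts of a basis determine those parts. -/
theorem mem_closure_image_iff {ι : Type} (b : FreeGroupBasis ι G) {S : Set ι} {x : ι} :
    b x ∈ closure (b '' S) ↔ x ∈ S := by
  refine ⟨fun hx => ?_, fun hx => subset_closure ⟨x, hx, rfl⟩⟩
  have := mem_map_of_mem b.repr.toMonoidHom hx
  rw [MonoidHom.map_closure, ← Set.image_comp] at this
  have e : ⇑b.repr.toMonoidHom ∘ ⇑b = of := by
    funext i; exact b.repr_apply_coe i
  rw [e] at this
  have h2 : b.repr.toMonoidHom (b x) = of x := congrFun e x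
  rw [h2] at this
  exact of_mem_closure_iff.1 this

theorem closure_image_eq_top_iff {ι : Type} (b : FreeGroupBasis ι G) {S : Set ι} :
    closure (b '' S) = ⊤ ↔ S = Set.univ := by
  constructor
  · intro h
    rw [Set.eq_univ_iff_forall]
    intro x
    rw [← mem_closure_image_iff b, h]
    trivial
  · rintro rfl
    rw [Set.image_univ, b.closure_range]

/-- Two generators of an infinite cyclic group are equal or inverse to each other. -/
theorem eq_or_eq_inv_of_closure_singleton_eq {ι : Type} (c : FreeGroupBasis ι G) {v w : G}
    (h : closure {v} = closure {w}) : v = w ∨ v = w⁻¹ := by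
  by_cases hv : v = 1
  · subst hv
    rw [closure_singleton_one, eq_comm, closure_eq_bot_iff] at h
    left
    exact (h rfl).symm
  have : IsMulTorsionFree G := Function.Injective.isMulTorsionFree c.repr.toMonoidHom
    c.repr.injective
  have : ¬ IsOfFinOrder v := not_isOfFinOrder_of_isMulTorsionFree hv
  rw [← zpowers_eq_closure, ← zpowers_eq_closure, eq_comm] at h
  rcases (zpowers_eq_zpowers_iff this).1 h.symm with h | h
  · exact Or.inl h
  · exact Or.inr (by rw [← h, inv_inv])

theorem exists_basis_apply {w : G} (h : IsFactor (closure {w})) (hw : w ≠ 1) {κ : Type}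
    (c : FreeGroupBasis κ G) : ∃ (b : FreeGroupBasis κ G) (i : κ), b i = w := by
  classical
  obtain ⟨b, S, hS⟩ := h.exists_basis c
  have hcomm (x y) (hx : x ∈ closure {w}) (hy : y ∈ closure {w}) : x * y = y * x := by
    rw [← zpowers_eq_closure] at hx hy
    obtain ⟨m, rfl⟩ := hx
    obtain ⟨n, rfl⟩ := hy
    exact zpow_mul_comm w m n
  obtain ⟨i, hi⟩ : S.Nonempty := by
    rw [Set.nonempty_iff_ne_empty]
    rintro rfl
    rw [Set.image_empty, Subgroup.closure_empty, closure_eq_bot_iff] at hS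
    exact hw (hS rfl)
  -- Distinct members of a basis do not commute.
  have hSi : S = {i} := by
    refine Set.eq_singleton_iff_unique_mem.2 ⟨hi, fun j hj => ?_⟩
    by_contra hij
    have := hcomm (b i) (b j) (hS ▸ subset_closure ⟨i, hi, rfl⟩) (hS ▸ subset_closure ⟨j, hj, rfl⟩)
    have h2 := congrArg b.repr this
    simp only [_root_.map_mul, FreeGroupBasis.repr_apply_coe] at h2
    have h3 := congrArg toWord h2
    simp [toWord_mul, FreeGroup.reduce, Ne.symm hij] at h3
  subst hSi
  rw [Set.image_singleton] at hS
  rcases eq_or_eq_inv_of_closure_singleton_eq c hS with h | h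
  · exact ⟨b, i, h.symm⟩
  -- If the generator comes out inverted, invert the whole basis.
  · have hf (j) : b.lift (fun i => (b i)⁻¹) (b j) = (b j)⁻¹ := b.lift_coe _ j
    obtain ⟨b', hb'⟩ := b.exists_of_inverse _ _ (fun j => by rw [hf, _root_.map_inv, hf, inv_inv])
      fun j => by rw [hf, _root_.map_inv, hf, inv_inv]
    exact ⟨b', i, by rw [hb', hf, h]⟩

end IsFactor

namespace FreeGroup

variable {α : Type}

/-- A reduced word in the letters of `T` containing all turns of `T`. -/
theorem exists_word_all_turns [Finite α] (T : Set α) (t₀ : α × Bool) (ht₀ : t₀.1 ∈ T) :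
    ∃ W : List (α × Bool), IsReduced W ∧ (∀ t ∈ W, t.1 ∈ T) ∧ W.head? = some t₀ ∧
      (∀ l ∈ W.getLast?, l ≠ letterInv t₀) ∧
      ∀ x y : α × Bool, x.1 ∈ T → y.1 ∈ T → x ≠ y →
        [letterInv x, y] <:+: W ∨ [letterInv y, x] <:+: W := by
  classical
  have key (Q : Finset ((α × Bool) × (α × Bool))) :
      (∀ p ∈ Q, p.1.1 ∈ T ∧ p.2.1 ∈ T ∧ p.1 ≠ p.2) →
      ∃ W : List (α × Bool), IsReduced W ∧ (∀ t ∈ W, t.1 ∈ T) ∧ W.head? = some t₀ ∧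
      (∀ l ∈ W.getLast?, l ≠ letterInv t₀) ∧
      ∀ p ∈ Q, [letterInv p.1, p.2] <:+: W ∨ [letterInv p.2, p.1] <:+: W := by
    induction Q using Finset.induction_on with
    | empty =>
      intro _
      exact ⟨[t₀], by simp, by simpa using ht₀, rfl, by simp [(letterInv_ne t₀).symm], by simp⟩
    | insert p Q _ ih =>
      intro hQ
      obtain ⟨W, h1, h2, h3, h4, h5⟩ := ih fun p hp => hQ p (Finset.mem_insert_of_mem hp)
      obtain ⟨hx, hy, hxy⟩ := hQ p (Finset.mem_insert_self _ _)
      obtain ⟨x, y⟩ := p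
      have ext (x y : α × Bool) (hx : x.1 ∈ T) (hy : y.1 ∈ T) (hxy : x ≠ y)
          (hl : ∀ l ∈ W.getLast?, l ≠ x) (hy' : y ≠ letterInv t₀) :
          IsReduced (W ++ [letterInv x, y]) ∧ (∀ t ∈ W ++ [letterInv x, y], t.1 ∈ T) ∧
          (W ++ [letterInv x, y]).head? = some t₀ ∧
          (∀ l ∈ (W ++ [letterInv x, y]).getLast?, l ≠ letterInv t₀) := by
        refine ⟨?_, ?_, ?_, ?_⟩
        · rw [isReduced_iff_isChain] at h1 ⊢
          refine h1.append ?_ ?_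
          · simp only [List.isChain_cons_cons, List.isChain_singleton, and_true]
            intro h
            rw [letterInv_eq_iff, letterInv_letterInv] at h
            exact hxy h
          · simpa using hl
        · intro t ht
          simp only [List.mem_append, List.mem_cons, List.not_mem_nil, or_false] at ht
          rcases ht with ht | rfl | rfl
          · exact h2 t ht
          · exact hx
          · exact hy
        · simp [h3]
        · simpa using hy'
      have fin (V : List (α × Bool)) (hV : V = [letterInv x, y] ∨ V = [letterInv y, x]) :
          ∀ p ∈ insert (x, y) Q, [letterInv p.1, p.2] <:+: W ++ V ∨
            [letterInv p.2, p.1] <:+: W ++ V := by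
        intro p hp
        rcases Finset.mem_insert.1 hp with rfl | hp
        · rcases hV with rfl | rfl
          · exact Or.inl (List.suffix_append _ _).isInfix
          · exact Or.inr (List.suffix_append _ _).isInfix
        · exact (h5 p hp).imp (fun h => h.trans (List.prefix_append _ _).isInfix)
            fun h => h.trans (List.prefix_append _ _).isInfix
      -- The missing turn can be appended in either orientation. If one orientation cancels against
      -- `W` or ends in the inverse of `t₀`, the other does neither.
      by_cases hc : (∀ l ∈ W.getLast?, l ≠ x) ∧ y ≠ letterInv t₀
      · obtain ⟨k1, k2, k3, k4⟩ := ext x y hx hy hxy hc.1 hc.2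
        exact ⟨_, k1, k2, k3, k4, fin _ (Or.inl rfl)⟩
      · have : (∀ l ∈ W.getLast?, l ≠ y) ∧ x ≠ letterInv t₀ := by
          by_cases hy' : y = letterInv t₀
          · exact ⟨hy' ▸ h4, fun h => hxy (h.trans hy'.symm)⟩
          · simp only [hy', ne_eq, not_false_eq_true, and_true] at hc
            push Not at hc
            obtain ⟨l, hl, rfl⟩ := hc
            refine ⟨fun l' hl' h => hxy ?_, h4 l hl⟩
            rw [← h]
            exact Option.mem_unique hl hl'
        obtain ⟨k1, k2, k3, k4⟩ := ext y x hy hx hxy.symm this.1 this.2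
        exact ⟨_, k1, k2, k3, k4, fin _ (Or.inr rfl)⟩
  have := Fintype.ofFinite α
  obtain ⟨W, h1, h2, h3, h4, h5⟩ := key
    (Finset.univ.filter fun p => p.1.1 ∈ T ∧ p.2.1 ∈ T ∧ p.1 ≠ p.2) (by simp)
  exact ⟨W, h1, h2, h3, h4, fun x y hx hy hxy => h5 (x, y) (by simp [hx, hy, hxy])⟩

theorem GoodTurn.symm {d : α × Bool} {J : Set (α × Bool)} {x y : α × Bool}
    (h : GoodTurn d J x y) : GoodTurn d J y x := ⟨h.2, h.1⟩

end FreeGroup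

/-! ### Primitive elements generated through lines -/

namespace Subgroup

variable {G : Type} [Group G]

theorem closure_singleton_subgroupOf {A : Subgroup G} {w : G} (hw : w ∈ A) :
    (closure {w}).subgroupOf A = closure {(⟨w, hw⟩ : A)} := by
  apply map_injective A.subtype_injective
  rw [MonoidHom.map_closure, Set.image_singleton, subgroupOf_map_subtype,
    inf_eq_left.2 (by simpa [closure_le] using hw)]
  rfl

theorem commute_of_mem_closure_singleton {w x y : G} (hx : x ∈ closure {w})
    (hy : y ∈ closure {w}) : x * y = y * x := by
  rw [← zpowers_eq_closure] at hx hy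
  obtain ⟨m, rfl⟩ := hx
  obtain ⟨n, rfl⟩ := hy
  exact zpow_mul_comm w m n

end Subgroup

theorem FreeGroupBasis.eq_of_commute {ι G : Type} [Group G] (b : FreeGroupBasis ι G) {i j : ι}
    (h : b i * b j = b j * b i) : i = j := by
  classical
  by_contra hij
  have h2 := congrArg b.repr h
  simp only [map_mul, FreeGroupBasis.repr_apply_coe] at h2
  have h3 := congrArg FreeGroup.toWord h2
  simp [FreeGroup.toWord_mul, FreeGroup.reduce, Ne.symm hij] at h3

namespace IsFactor

variable {G : Type} [Group G]

/-- Primitivity in a factor agrees with primitivity in the group: factors of factors are factors,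
and factors restrict to subgroups. -/
theorem singleton_subgroup_iff {A : Subgroup G} (hA : IsFactor A) {w : A} :
    IsFactor (closure {w}) ↔ IsFactor (closure {(w : G)}) := by
  constructor
  · intro h
    have := hA.trans h
    rwa [MonoidHom.map_closure, Set.image_singleton] at this
  · intro h
    have := h.subgroupOf A
    rwa [closure_singleton_subgroupOf w.2] at this

end IsFactor

namespace FreeGroup

theorem closure_singleton_ne_top {α : Type} [Nontrivial α] (w : FreeGroup α) :
    closure {w} ≠ ⊤ := by
  intro h
  obtain ⟨x, y, hxy⟩ := exists_pair_ne α
  refine hxy ((FreeGroupBasis.ofFreeGroup α).eq_of_commute ?_)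
  exact commute_of_mem_closure_singleton (h ▸ mem_top _) (h ▸ mem_top _)

theorem mul_mul_norm_lt {α : Type} [DecidableEq α] {w : FreeGroup α} {s t : α × Bool}
    (hs : s ∈ w.toWord.getLast?) (ht : t ∈ w.toWord.head?) (hst : s = letterInv t) :
    ((mk [t])⁻¹ * w * mk [t]).norm < w.norm := by
  subst hst
  obtain ⟨L, hL⟩ : ∃ L, w.toWord = t :: L := by
    cases h : w.toWord with
    | nil => simp [h] at ht
    | cons a L => simp [h] at ht; exact ⟨L, by rw [ht]⟩
  rcases List.eq_nil_or_concat L with rfl | ⟨M, u, rfl⟩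
  · rw [hL] at hs
    simp at hs
    exact absurd hs.symm (letterInv_ne t)
  · rw [List.concat_eq_append] at hL
    have hu : u = letterInv t := by
      rw [hL, ← List.cons_append] at hs
      simpa only [List.getLast?_concat, Option.mem_def, Option.some.injEq] using hs
    subst hu
    have hw : w = mk [t] * mk M * (mk [t])⁻¹ := by
      rw [← mk_letterInv, mul_mk, mul_mk, ← mk_toWord (x := w), hL]; rfl
    have : (mk [t])⁻¹ * w * mk [t] = mk M := by rw [hw]; group
    rw [this, norm, norm, hL]
    refine norm_mk_le.trans_lt ?_
    simp only [List.length_cons, List.length_append]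
    omega

/-- A set of primitive elements containing a basis, and containing all primitive elements of the
span of any two of its elements that belong to a basis, contains all primitive elements. -/
theorem primitive_mem_of_lineClosed {α : Type} [Finite α] (C : FreeGroup α → Prop)
    (hC1 : ∀ x, C (of x))
    (hC2 : ∀ (b : FreeGroupBasis α (FreeGroup α)) (i j : α), C (b i) → C (b j) →
      ∀ w ∈ closure {b i, b j}, w ≠ 1 → IsFactor (closure {w}) → C w)
    {w : FreeGroup α} (hw1 : w ≠ 1) (hw : IsFactor (closure {w})) : C w := by
  classical
  induction hn : Nat.card α using Nat.strong_induction_on generalizing α with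
  | _ n ih =>
  by_contra hCw
  -- An automorphism keeping each generator in its span with one letter `d` changes a basis in `C`
  -- to another basis in `C`, one line at a time.
  have step (ψ θ : FreeGroup α ≃* FreeGroup α) (d : α × Bool) (hψ : ∀ x, C (ψ (of x)))
      (hθ : ∀ x, θ (of x) ∈ closure {of x, mk [d]}) (x : α) : C ((θ.trans ψ) (of x)) := by
    refine hC2 ((FreeGroupBasis.ofFreeGroup α).map ψ) x d.1 (by simpa using hψ x)
      (by simpa using hψ d.1) _ ?_ ?_ ?_
    · have h1 := mem_map_of_mem ψ.toMonoidHom (hθ x)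
      rw [MonoidHom.map_closure, Set.image_pair] at h1
      refine (closure_le _).2 ?_ h1
      rintro _ (rfl | rfl)
      · exact subset_closure (by simp)
      · have h2 : ψ (of d.1) ∈ closure {((FreeGroupBasis.ofFreeGroup α).map ψ) x,
            ((FreeGroupBasis.ofFreeGroup α).map ψ) d.1} := subset_closure (by simp)
        obtain ⟨y, _ | _⟩ := d
        · change ψ (mk [(y, false)]) ∈ _
          rw [mk_pair_false, _root_.map_inv]
          exact inv_mem h2
        · exact h2
    · rw [ne_eq, MulEquiv.map_eq_one_iff]; exact of_ne_one x
    · exact isFactor_closure_singleton_mulEquiv (isFactor_closure_singleton_letter (x, true)) _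
  -- If `w` omits a generator of a basis in `C`, it lies in a factor of smaller rank, and the
  -- induction hypothesis applies there.
  have full (ψ : FreeGroup α ≃* FreeGroup α) (hψ : ∀ x, C (ψ (of x))) (x : α) :
      ∃ t ∈ (ψ.symm w).toWord, t.1 = x := by
    by_contra hx
    push Not at hx
    let b := FreeGroupBasis.ofFreeGroup α
    let T : Set α := {x}ᶜ
    let A := closure (b '' T)
    have hA : IsFactor A := ⟨α, b, T, rfl⟩
    have hwA : ψ.symm w ∈ A := by
      simp only [A, b, coe_ofFreeGroup]
      exact mem_closure_of_iff.2 hx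
    let e : FreeGroup T ≃* A := (b.restrict T).repr.symm
    have he (y : T) : (e (of y) : FreeGroup α) = of y.1 := by
      have : e (of y) = b.restrict T y := rfl
      simp [this, b]
    have hfac (v : FreeGroup T) : IsFactor (closure {v}) ↔
        IsFactor (closure {(ψ (e v : FreeGroup α))}) := by
      have h1 : IsFactor (closure {v}) ↔ IsFactor (closure {e v}) := by
        constructor
        · intro h
          have := h.map_equiv e
          rwa [MonoidHom.map_closure, Set.image_singleton] at this
        · intro h
          have := h.map_equiv e.symm
          rw [MonoidHom.map_closure, Set.image_singleton] at this
          simpa using this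
      rw [h1, hA.singleton_subgroup_iff]
      refine ⟨fun h => isFactor_closure_singleton_mulEquiv h ψ, fun h => ?_⟩
      have := isFactor_closure_singleton_mulEquiv h ψ.symm
      rwa [MulEquiv.symm_apply_apply] at this
    have hew : ψ (e (e.symm ⟨_, hwA⟩) : FreeGroup α) = w := by simp
    have hcard : Nat.card T < n := by
      rw [← hn, Nat.card_coe_set_eq, ← Set.ncard_univ]
      exact Set.ncard_lt_ncard (by
        rw [Set.ssubset_univ_iff]; intro h; exact (h ▸ Set.mem_univ x : x ∈ T) rfl) (Set.toFinite _)
    refine hCw (hew ▸ ih _ hcard (fun v => C (ψ (e v : FreeGroup α))) (fun y => ?_) ?_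
      (w := e.symm ⟨_, hwA⟩) ?_ ?_ rfl)
    · rw [he]; exact hψ _
    · intro β i j hi hj v hv hv1 hvf
      obtain ⟨b', ε, -, hb'⟩ := IsFactor.exists_extend b T (β.map e)
      have hb'' (k) : b'.map ψ (ε k) = ψ (e (β k) : FreeGroup α) := by
        rw [FreeGroupBasis.map_apply, hb', FreeGroupBasis.map_apply]
      refine hC2 (b'.map ψ) (ε i) (ε j) ?_ ?_ _ ?_ ?_ ((hfac v).1 hvf)
      · rwa [hb'']
      · rwa [hb'']
      · rw [hb'', hb'']
        have := mem_map_of_mem (ψ.toMonoidHom.comp (A.subtype.comp e.toMonoidHom)) hv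
        rwa [MonoidHom.map_closure, Set.image_pair] at this
      · simpa using hv1
    · simpa using hw1
    · rw [hfac, hew]; exact hw
  -- a reachable basis in which `w` is shortest
  obtain ⟨ψ, hψ, hmin⟩ : ∃ ψ : FreeGroup α ≃* FreeGroup α, (∀ x, C (ψ (of x))) ∧
      ∀ ψ' : FreeGroup α ≃* FreeGroup α, (∀ x, C (ψ' (of x))) →
        (ψ.symm w).norm ≤ (ψ'.symm w).norm := by
    obtain ⟨ψ, hψ, h⟩ := (InvImage.wf (fun ψ : FreeGroup α ≃* FreeGroup α => (ψ.symm w).norm)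
      wellFounded_lt).has_min {ψ | ∀ x, C (ψ (of x))} ⟨MulEquiv.refl _, hC1⟩
    exact ⟨ψ, hψ, fun ψ' hψ' => not_lt.1 (h ψ' hψ')⟩
  set g := ψ.symm w with hg
  have hg1 : g ≠ 1 := by simpa [hg] using hw1
  have hgL : mk g.toWord = g := mk_toWord
  -- Conjugation by a letter is also a permitted change of basis, so a shortest word is cyclically
  -- reduced.
  have hcyc : IsCyclicallyReduced g.toWord := by
    rw [isCyclicallyReduced_iff]
    refine ⟨isReduced_toWord, fun s hs t ht => ne_letterInv_iff.1 fun hst => ?_⟩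
    refine (mul_mul_norm_lt hs ht hst).not_ge ?_
    have := hmin ((MulAut.conj (mk [t])).trans ψ) (step ψ _ t hψ fun x => by
      have h : mk [t] ∈ closure {of x, mk [t]} := subset_closure (by simp)
      exact mul_mem (mul_mem h (subset_closure (Set.mem_insert _ _))) (inv_mem h))
    rwa [MulEquiv.symm_trans_apply, MulAut.conj_symm_apply] at this
  have hgf : IsFactor (closure {g}) := isFactor_closure_singleton_mulEquiv hw ψ.symm
  have hα : Nontrivial α := by
    rw [← not_subsingleton_iff_nontrivial]
    intro hα
    obtain ⟨t, ht⟩ : ∃ t, t ∈ w.toWord := List.exists_mem_of_ne_nil _ (by simpa using hw1)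
    refine hCw (hC2 (FreeGroupBasis.ofFreeGroup α) t.1 t.1 ?_ ?_ w ?_ hw1 hw)
    · simpa using hC1 t.1
    · simpa using hC1 t.1
    · have : w ∈ closure (of '' {t.1}) := mem_closure_of_iff.2 fun s _ => Subsingleton.elim _ _
      simpa using this
  obtain ⟨d, J, hdJ, hJ, ⟨i, hiJ, hid⟩, hcut⟩ :=
    exists_cut hgf (by simpa [closure_eq_bot_iff] using hg1) (closure_singleton_ne_top g)
  have hgP : ∃ c, c * mk g.toWord * c⁻¹ ∈ closure {g} :=
    ⟨1, by rw [hgL]; simp⟩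
  have fin (K : Set (α × Bool)) (hdK : d ∉ K) (hK : K.Nonempty)
      (hch : g.toWord.IsChain fun s t => GoodTurn d K (letterInv s) t)
      (hh : ∀ t ∈ g.toWord.head?, t ∉ K) (hl : ∀ t ∈ g.toWord.getLast?, letterInv t ∉ K) :
      False := by
    obtain ⟨k, hk⟩ := hK
    obtain ⟨t, ht, htk⟩ := full ψ hψ k.1
    obtain ⟨θ, d', h1, h2, -⟩ := exists_shortening isReduced_toWord hdK hch hh hl
      ⟨t, ht, by
        rcases fst_eq_iff.1 htk with rfl | rfl
        · exact Or.inl hk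
        · right; rwa [letterInv_letterInv]⟩
    rw [hgL] at h1
    exact (hmin (θ.symm.trans ψ) (step ψ _ d' hψ h2)).not_gt h1
  have hch := IsCut.isChain hcut hcyc hgP
  obtain ⟨s, hs⟩ : ∃ s, s ∈ g.toWord.getLast? := by
    have : g.toWord ≠ [] := by simpa using hg1
    exact ⟨_, List.getLast?_eq_getLast_of_ne_nil this⟩
  obtain ⟨t, ht⟩ : ∃ s, s ∈ g.toWord.head? := by
    have : g.toWord ≠ [] := by simpa using hg1
    exact ⟨_, List.head?_eq_some_head this⟩
  have hturn := hcut _ hcyc hgP s hs t ht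
  -- `exists_shortening` needs a side containing neither end direction. The closing turn is good, so
  -- one of the two sides qualifies.
  by_cases hjunction : t ∉ J ∧ letterInv s ∉ J
  · refine fin J hdJ hJ hch (fun t' ht' => ?_) (fun s' hs' => ?_)
    · rw [Option.mem_unique ht' ht]; exact hjunction.1
    · rw [Option.mem_unique hs' hs]; exact hjunction.2
  · have hI : t ∉ (J ∪ {d})ᶜ ∧ letterInv s ∉ (J ∪ {d})ᶜ := by
      unfold GoodTurn at hturn
      simp only [Set.mem_compl_iff, Set.mem_union, Set.mem_singleton_iff, not_not]
      tauto
    refine fin (J ∪ {d})ᶜ (by simp) ⟨i, by simp [hiJ, hid]⟩ (hch.imp fun _ _ => goodTurn_compl)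
      (fun t' ht' => ?_) (fun s' hs' => ?_)
    · rw [Option.mem_unique ht' ht]; exact hI.1
    · rw [Option.mem_unique hs' hs]; exact hI.2

end FreeGroup

/-! ### Shortest representatives modulo a factor -/

namespace FreeGroup

variable {α : Type}

/-- Take the first letter `f` as cut vertex and remove it from `J`; the word then starts outside.
The second occurrence of `f` or its inverse forces a visit to the rest of `J`: if `f` recurs, the
preceding letter arrives through `J`, and after an inverse of `f` the next letter departs through
`J`. Reducedness keeps these directions different from `f`. -/
theorem exists_shortening_of_head [DecidableEq α] {L : List (α × Bool)} (hr : IsReduced L)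
    {J : Set (α × Bool)} (hc : L.IsChain fun s t => letterInv s ∈ J ↔ t ∈ J) {f : α × Bool}
    (hf : f ∈ L.head?) (hfJ : f ∈ J) (hl : ∀ t ∈ L.getLast?, letterInv t ∉ J)
    (hocc : 2 ≤ L.countP fun t => t.1 = f.1) :
    ∃ θ : FreeGroup α ≃* FreeGroup α, (θ (mk L)).norm < L.length ∧
      ∀ x, (x, true) ∉ J → (x, false) ∉ J → θ (of x) = of x := by
  have hsep {s t} (h : [s, t] <:+: L) : letterInv s ∈ J ↔ t ∈ J := (List.IsChain.infix hc h).rel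
  have hred {s t} (h : [s, t] <:+: L) : s ≠ letterInv t :=
    (List.IsChain.infix (isReduced_iff_isChain.1 hr) h).rel
  obtain ⟨L', rfl⟩ : ∃ L', L = f :: L' := by
    cases L with
    | nil => simp at hf
    | cons a L => simp at hf; exact ⟨L, by rw [hf]⟩
  obtain ⟨θ, -, h1, -, h2⟩ := exists_shortening hr (d := f) (J := J \ {f}) (by simp)
    (List.IsChain.imp (fun a b hab => ⟨fun h => by
          by_cases hb : b = f
          · exact Or.inr hb
          · exact Or.inl ⟨hab.1 h.1, hb⟩, fun h => by
          by_cases ha : letterInv a = f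
          · exact Or.inr ha
          · exact Or.inl ⟨hab.2 h.1, ha⟩⟩) hc)
    (by simp) (fun t ht h => hl t ht h.1) (by
      rw [List.countP_cons_of_pos (by simp)] at hocc
      obtain ⟨t, ht, htf⟩ := List.countP_pos_iff.1 (show 0 < L'.countP (fun t => t.1 = f.1) by omega)
      obtain ⟨p, q, rfl⟩ := List.append_of_mem ht
      rcases fst_eq_iff.1 (of_decide_eq_true htf) with rfl | rfl
      · obtain ⟨p', u, hu⟩ : ∃ p' u, t :: p = p' ++ [u] :=
          ⟨_, _, (List.dropLast_append_getLast (List.cons_ne_nil t p)).symm⟩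
        have hi : [u, t] <:+: t :: (p ++ t :: q) :=
          ⟨p', q, by rw [← List.cons_append, hu]; simp⟩
        have hut : letterInv u ≠ t := fun h => hred hi (letterInv_eq_iff.1 h)
        refine ⟨u, ?_, Or.inr ⟨(hsep hi).2 hfJ, hut⟩⟩
        rw [← List.cons_append, hu]; simp
      · cases q with
        | nil =>
          refine absurd hfJ ?_
          have := hl (letterInv f) (by rw [← List.cons_append, List.getLast?_concat]; rfl)
          rwa [letterInv_letterInv] at this
        | cons v q =>
          have hi : [letterInv f, v] <:+: f :: (p ++ letterInv f :: v :: q) :=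
            ⟨f :: p, q, by simp⟩
          refine ⟨v, by simp, Or.inl ⟨(hsep hi).1 (by rwa [letterInv_letterInv]), ?_⟩⟩
          rintro rfl
          exact hred hi rfl)
  refine ⟨θ, h1, fun x hx hx' => h2 x (fun h => hx h.1) fun h => hx' h.1⟩

theorem invRev_eq (L : List (α × Bool)) : invRev L = (L.map letterInv).reverse := rfl

/-- Apply `exists_shortening_of_head` to the inverse word. -/
theorem exists_shortening_of_last [DecidableEq α] {L : List (α × Bool)} (hr : IsReduced L)
    {J : Set (α × Bool)} (hc : L.IsChain fun s t => letterInv s ∈ J ↔ t ∈ J) {l : α × Bool}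
    (hl : l ∈ L.getLast?) (hlJ : letterInv l ∈ J) (hh : ∀ t ∈ L.head?, t ∉ J)
    (hocc : 2 ≤ L.countP fun t => t.1 = l.1) :
    ∃ θ : FreeGroup α ≃* FreeGroup α, (θ (mk L)).norm < L.length ∧
      ∀ x, (x, true) ∉ J → (x, false) ∉ J → θ (of x) = of x := by
  obtain ⟨θ, h1, h2⟩ := exists_shortening_of_head (L := invRev L) (f := letterInv l) (J := J)
    (by rw [isReduced_iff_reduce_eq, reduce_invRev, hr.reduce_eq])
    (by
      rw [invRev_eq, List.isChain_reverse, List.isChain_map]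
      refine hc.imp fun a b hab => ?_
      rw [letterInv_letterInv]; exact hab.symm)
    (by
      rw [invRev_eq, List.head?_reverse, List.getLast?_map]
      exact Option.mem_map_of_mem _ hl) hlJ
    (by
      intro t ht
      simp only [invRev_eq, List.getLast?_reverse, List.head?_map, Option.mem_def,
        Option.map_eq_some_iff] at ht
      obtain ⟨a, ha, rfl⟩ := ht
      rw [letterInv_letterInv]; exact hh a ha)
    (by
      rw [invRev_eq, List.countP_reverse, List.countP_map]
      exact hocc)
  rw [← inv_mk, _root_.map_inv, norm_inv_eq, invRev_length] at h1
  exact ⟨θ, h1, h2⟩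

/-- `z` is a shortest element among the images of its double coset modulo the factor spanned by
`S` under automorphisms preserving that factor. -/
structure IsShort [DecidableEq α] (S : Set α) (z : FreeGroup α) : Prop where
  intro ::
  notMem : z ∉ closure (of '' S)
  min : ∀ θ : FreeGroup α ≃* FreeGroup α, (∀ s ∈ S, θ (of s) ∈ closure (of '' S)) →
    (∀ s ∈ S, θ.symm (of s) ∈ closure (of '' S)) → ∀ u ∈ closure (of '' S),
      ∀ v ∈ closure (of '' S), z.norm ≤ (u * θ z * v).norm

namespace IsShort

variable [DecidableEq α] {S : Set α} {z : FreeGroup α} (h : IsShort S z)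

include h

theorem ne_nil : z.toWord ≠ [] := by
  rw [ne_eq, toWord_eq_nil_iff]
  rintro rfl
  exact h.notMem (one_mem _)

theorem norm_le_of_fixed (θ : FreeGroup α ≃* FreeGroup α) (hθ : ∀ s ∈ S, θ (of s) = of s) :
    z.norm ≤ (θ z).norm := by
  have hS {s} (hs : s ∈ S) : of s ∈ closure (of '' S) := subset_closure ⟨s, hs, rfl⟩
  simpa using h.min θ (fun s hs => by rw [hθ s hs]; exact hS hs)
    (fun s hs => by rw [MulEquiv.symm_apply_eq _ |>.2 (hθ s hs).symm]; exact hS hs)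
    1 (one_mem _) 1 (one_mem _)

theorem head_notMem : ∀ t ∈ z.toWord.head?, t.1 ∉ S := by
  intro t ht hS
  obtain ⟨L, hL⟩ : ∃ L, z.toWord = t :: L := by
    cases h : z.toWord with
    | nil => simp [h] at ht
    | cons a L => simp [h] at ht; exact ⟨L, by rw [ht]⟩
  have h1 := h.min (MulEquiv.refl _) (fun s hs => subset_closure ⟨s, hs, rfl⟩)
    (fun s hs => subset_closure ⟨s, hs, rfl⟩) (mk [t])⁻¹
    (inv_mem (mk_letter_mem_closure_iff.2 hS)) 1 (one_mem _)
  have h2 : (mk [t])⁻¹ * z = mk L := by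
    rw [← mk_toWord (x := z), hL, inv_mul_eq_iff_eq_mul, mul_mk]; rfl
  rw [MulEquiv.refl_apply, h2, mul_one, norm, hL, List.length_cons] at h1
  have := norm_mk_le (L₁ := L)
  omega

theorem getLast_notMem : ∀ t ∈ z.toWord.getLast?, t.1 ∉ S := by
  intro t ht hS
  obtain ⟨L, hL⟩ : ∃ L, z.toWord = L ++ [t] := by
    rcases List.eq_nil_or_concat z.toWord with h | ⟨M, u, h⟩
    · simp [h] at ht
    · rw [h, List.concat_eq_append] at ht ⊢
      rw [List.getLast?_concat] at ht
      exact ⟨M, by rw [Option.some_injective _ ht]⟩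
  have h1 := h.min (MulEquiv.refl _) (fun s hs => subset_closure ⟨s, hs, rfl⟩)
    (fun s hs => subset_closure ⟨s, hs, rfl⟩) 1 (one_mem _) (mk [t])⁻¹
    (inv_mem (mk_letter_mem_closure_iff.2 hS))
  have h2 : z * (mk [t])⁻¹ = mk L := by
    rw [← mk_toWord (x := z), hL, mul_inv_eq_iff_eq_mul, mul_mk]
  rw [MulEquiv.refl_apply, one_mul, h2, norm, hL, List.length_append, List.length_singleton] at h1
  have := norm_mk_le (L₁ := L)
  omega

/-- A move along a letter of `S` preserves the factor, and the side factors at the two ends can be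
absorbed into the double coset. A strict shortening would contradict minimality. -/
theorem not_crossing {d : α × Bool} {J : Set (α × Bool)} (hdS : d.1 ∈ S) (h1 : d ∉ J)
    (h2 : letterInv d ∉ J) (hc : z.toWord.IsChain fun s t => GoodTurn d J (letterInv s) t)
    {u t : α × Bool} (hut : [u, t] <:+: z.toWord) :
    ¬ ((letterInv u = d ∧ t ∈ J) ∨ (letterInv u ∈ J ∧ t = d)) := by
  classical
  intro hcross
  obtain ⟨f, hf⟩ : ∃ s, s ∈ z.toWord.head? := ⟨_, List.head?_eq_some_head h.ne_nil⟩
  obtain ⟨l, hl⟩ : ∃ s, s ∈ z.toWord.getLast? := ⟨_, List.getLast?_eq_getLast_of_ne_nil h.ne_nil⟩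
  obtain ⟨M, hM, -, hM2⟩ := move_word h1 h2 z.toWord h.ne_nil hc (decide (f ∈ J))
    (decide (letterInv l ∈ J))
    (fun t ht => by
      rw [Option.mem_unique ht hf]
      exact ⟨fun h => Or.inl (of_decide_eq_true h), fun h => of_decide_eq_false h⟩)
    (fun t ht => by
      rw [Option.mem_unique ht hl]
      exact ⟨fun h => Or.inl (of_decide_eq_true h), fun h => of_decide_eq_false h⟩)
  have hM3 := hM2 (Or.inr (Or.inr ⟨u, t, hut, hcross⟩))
  have hd : mk [d] ∈ closure (of '' S) := mk_letter_mem_closure_iff.2 hdS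
  have hside (s) : side d s ∈ closure (of '' S) := by
    unfold side; split_ifs
    · exact hd
    · exact one_mem _
  have hS {s} (hs : s ∈ S) : mk [(s, true)] ∈ closure (of '' S) := subset_closure ⟨s, hs, rfl⟩
  have := h.min (move d J h1 h2)
    (fun s hs => by
      rw [← mk_pair_true, move_letter]
      exact mul_mem (mul_mem (moveFactor_mem hd _) (hS hs)) (inv_mem (moveFactor_mem hd _)))
    (fun s hs => by
      rw [← mk_pair_true, move_symm_letter]
      exact mul_mem (mul_mem (inv_mem (moveFactor_mem hd _)) (hS hs)) (moveFactor_mem hd _))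
    _ (inv_mem (hside (decide (f ∈ J)))) _ (hside (decide (letterInv l ∈ J)))
  rw [mk_toWord] at hM
  rw [hM] at this
  have e (a b c : FreeGroup α) : a⁻¹ * (a * b * c⁻¹) * c = b := by group
  rw [e] at this
  exact (this.trans norm_mk_le).not_gt hM3

/-- If there are no letters of `S` in `J`, the turns of `z` and its end directions cannot
all be compatible with the cut. -/
theorem false_of_cut (hocc : ∀ c ∉ S, 2 ≤ z.toWord.countP fun t => t.1 = c)
    {d : α × Bool} {J : Set (α × Bool)} (hd : d ∉ J) (hJ : J.Nonempty) (hJS : ∀ t ∈ J, t.1 ∉ S)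
    (hc : z.toWord.IsChain fun s t => GoodTurn d J (letterInv s) t) {p q : α × Bool}
    (hp : p.1 ∈ S) (hq : q.1 ∈ S) (hpq : p ≠ q)
    (hhp : ∀ t ∈ z.toWord.head?, GoodTurn d J p t)
    (hlq : ∀ t ∈ z.toWord.getLast?, GoodTurn d J (letterInv t) q) : False := by
  have hfix (θ : FreeGroup α ≃* FreeGroup α)
      (hθ : ∀ x, (x, true) ∉ J → (x, false) ∉ J → θ (of x) = of x) :
      z.norm ≤ (θ z).norm :=
    h.norm_le_of_fixed θ fun s hs => hθ s (fun h => hJS _ h hs) fun h => hJS _ h hs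
  have hpJ {t} (ht : GoodTurn d J p t) (htJ : t ∈ J) : p = d :=
    (ht.2 htJ).resolve_left fun h => hJS _ h hp
  have hqJ {t} (ht : GoodTurn d J (letterInv t) q) (htJ : letterInv t ∈ J) : q = d :=
    (ht.1 htJ).resolve_left fun h => hJS _ h hq
  have hsep (hdS : d.1 ∈ S) : z.toWord.IsChain fun s t => letterInv s ∈ J ↔ t ∈ J := by
    refine (List.isChain_isInfix _).imp ?_
    intro a b hab
    have h3 := h.not_crossing hdS hd (fun h => hJS (letterInv d) h hdS) hc hab
    have h4 := (List.IsChain.infix hc hab).rel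
    exact ⟨fun h => (h4.1 h).resolve_right fun e => h3 (Or.inr ⟨h, e⟩),
      fun h => (h4.2 h).resolve_right fun e => h3 (Or.inl ⟨e, h⟩)⟩
  by_cases h1 : ∃ f ∈ z.toWord.head?, f ∈ J
  · obtain ⟨f, hf, hfJ⟩ := h1
    -- The end condition identifies `d` with `p`, a letter of `S`, so `J` is separated. As `p ≠ q`,
    -- the word cannot also end in `J`.
    have e := hpJ (hhp f hf) hfJ
    obtain ⟨θ, h1, h2⟩ := exists_shortening_of_head isReduced_toWord (hsep (e ▸ hp)) hf hfJ
      (fun t ht htJ => hpq (e.trans (hqJ (hlq t ht) htJ).symm)) (hocc _ (hJS _ hfJ))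
    rw [mk_toWord] at h1
    exact (hfix θ h2).not_gt h1
  by_cases h2 : ∃ l ∈ z.toWord.getLast?, letterInv l ∈ J
  · obtain ⟨l, hl, hlJ⟩ := h2
    have e := hqJ (hlq l hl) hlJ
    push Not at h1
    obtain ⟨θ, h1, h2⟩ := exists_shortening_of_last isReduced_toWord (hsep (e ▸ hq)) hl hlJ
      h1 (hocc _ (hJS (letterInv l) hlJ))
    rw [mk_toWord] at h1
    exact (hfix θ h2).not_gt h1
  push Not at h1 h2
  obtain ⟨t, ht⟩ := hJ
  obtain ⟨s, hs, hst⟩ := List.countP_pos_iff.1 (show 0 < z.toWord.countP fun x => x.1 = t.1 by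
    have := hocc _ (hJS t ht); omega)
  obtain ⟨θ, -, h3, -, h4⟩ := exists_shortening isReduced_toWord hd hc h1 h2 ⟨s, hs, by
    rcases fst_eq_iff.1 (of_decide_eq_true hst) with rfl | rfl
    · exact Or.inl ht
    · right; rwa [letterInv_letterInv]⟩
  rw [mk_toWord] at h3
  exact (hfix θ h4).not_gt h3

/-- The variant of `false_of_cut` where `J` contains one letter `e` of `S`. -/
theorem false_of_cut_of_mem {d e : α × Bool} {J : Set (α × Bool)} (hd : d ∉ J) (he : e ∈ J)
    (hdS : d.1 ∈ S) (heS : e.1 ∈ S) (hde : d.1 ≠ e.1) (hJS : ∀ t ∈ J, t.1 ∈ S → t = e)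
    (hc : z.toWord.IsChain fun s t => GoodTurn d J (letterInv s) t)
    (hocc : ∃ t ∈ z.toWord, t.1 = e.1) : False := by
  have hsep {a b} (hab : [a, b] <:+: z.toWord) : letterInv a ∈ J ↔ b ∈ J := by
    have h3 := h.not_crossing hdS hd (fun h => hde (by
      have := hJS (letterInv d) h hdS
      exact (letterInv_fst d).symm.trans (congrArg Prod.fst this))) hc hab
    have h4 := (List.IsChain.infix hc hab).rel
    exact ⟨fun h => (h4.1 h).resolve_right fun e => h3 (Or.inr ⟨h, e⟩),
      fun h => (h4.2 h).resolve_right fun e => h3 (Or.inl ⟨e, h⟩)⟩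
  have hred {s t} (h : [s, t] <:+: z.toWord) : s ≠ letterInv t :=
    (List.IsChain.infix (isReduced_iff_isChain.1 isReduced_toWord) h).rel
  -- Since `J` is now separated, `e` itself can play the cut vertex. It occurs in `z`, but not at
  -- either end, so some turn joins it to the rest of `J`; `not_crossing` excludes this.
  have hc' : z.toWord.IsChain fun s t => GoodTurn e (J \ {e}) (letterInv s) t := by
    refine (List.isChain_isInfix _).imp ?_
    intro a b hab
    refine ⟨fun h => ?_, fun h => ?_⟩
    · by_cases hb : b = e
      · exact Or.inr hb
      · exact Or.inl ⟨(hsep hab).1 h.1, hb⟩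
    · by_cases ha : letterInv a = e
      · exact Or.inr ha
      · exact Or.inl ⟨(hsep hab).2 h.1, ha⟩
  have hno {u t} (hut : [u, t] <:+: z.toWord) := h.not_crossing (d := e) (J := J \ {e}) heS
    (by simp) (fun h => letterInv_ne e (hJS _ h.1 heS)) hc' hut
  obtain ⟨t, ht, hte⟩ := hocc
  obtain ⟨p, q, hpq⟩ := List.append_of_mem ht
  rcases fst_eq_iff.1 hte with rfl | rfl
  · rcases List.eq_nil_or_concat p with rfl | ⟨p', u, rfl⟩
    · exact h.head_notMem t (by simp [hpq]) heS
    · have hi : [u, t] <:+: z.toWord := ⟨p', q, by rw [hpq]; simp⟩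
      exact hno hi (Or.inr ⟨⟨(hsep hi).2 he, fun h => hred hi (letterInv_eq_iff.1 h)⟩, rfl⟩)
  · cases q with
    | nil => exact h.getLast_notMem (letterInv e) (by rw [hpq, List.getLast?_concat]; rfl) heS
    | cons v q =>
      have hi : [letterInv e, v] <:+: z.toWord := ⟨p, q, by rw [hpq]; simp⟩
      refine hno hi (Or.inl ⟨letterInv_letterInv e, (hsep hi).1 ?_, ?_⟩)
      · rwa [letterInv_letterInv]
      · rintro rfl
        exact hred hi rfl

end IsShort

end FreeGroup

/-! ### A primitive element completing a basis of a factor -/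

namespace FreeGroup

variable {α : Type}

theorem isReduced_append_iff {L M : List (α × Bool)} : IsReduced (L ++ M) ↔
    IsReduced L ∧ IsReduced M ∧ ∀ s ∈ L.getLast?, ∀ t ∈ M.head?, s ≠ letterInv t := by
  simp only [isReduced_iff_isChain, List.isChain_append]

theorem goodTurn_of_all_turns {d : α × Bool} {J : Set (α × Bool)} {T : Set α}
    {W y : List (α × Bool)} (hW : ∀ x y : α × Bool, x.1 ∈ T → y.1 ∈ T → x ≠ y →
        [letterInv x, y] <:+: W ∨ [letterInv y, x] <:+: W) (hWy : W <:+: y)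
    (hy : ∀ s t, [s, t] <:+: y → GoodTurn d J (letterInv s) t) {x x' : α × Bool}
    (hx : x.1 ∈ T) (hx' : x'.1 ∈ T) (hxx' : x ≠ x') : GoodTurn d J x x' := by
  rcases hW x x' hx hx' hxx' with h | h
  · simpa using hy _ _ (h.trans hWy)
  · simpa using (hy _ _ (h.trans hWy)).symm

/-- If the letters of `T` are pairwise joined by turns, then one of the two sides of
a cut contains no letter of `T`. -/
theorem exists_side {d : α × Bool} {J : Set (α × Bool)} (hd : d ∉ J) (hJ : J.Nonempty)
    (hi : ∃ i, i ∉ J ∧ i ≠ d) {T : Set α}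
    (hT : ∀ x y : α × Bool, x.1 ∈ T → y.1 ∈ T → x ≠ y → GoodTurn d J x y) :
    ∃ K : Set (α × Bool), d ∉ K ∧ K.Nonempty ∧ (∀ t ∈ K, t.1 ∉ T) ∧
      ∀ x y, GoodTurn d J x y → GoodTurn d K x y := by
  by_cases h : ∃ x ∈ J, x.1 ∈ T
  · obtain ⟨x, hx, hxT⟩ := h
    obtain ⟨i, hi, hi'⟩ := hi
    refine ⟨(J ∪ {d})ᶜ, by simp, ⟨i, by simp [hi, hi']⟩, fun t ht htT => ?_,
      fun _ _ => goodTurn_compl⟩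
    simp only [Set.mem_compl_iff, Set.mem_union, Set.mem_singleton_iff, not_or] at ht
    have hxt : x ≠ t := by rintro rfl; exact ht.1 hx
    rcases (hT x t hxT htT hxt).1 hx with h | h
    · exact ht.1 h
    · exact ht.2 h
  · push Not at h
    exact ⟨J, hd, hJ, h, fun _ _ => id⟩

namespace IsShort

variable [DecidableEq α] {S : Set α} {z : FreeGroup α}

/-- Whitehead graph obstruction: for a word `y` in the letters of `S`, the cyclic word `z * y` in
a proper factor gives a cut. -/
theorem exists_cut_append [Finite α] [Nontrivial α] (h : IsShort S z) {P : Subgroup (FreeGroup α)}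
    (hP : IsFactor P) (hPt : P ≠ ⊤) {y : List (α × Bool)} (hy : IsReduced y)
    (hyS : ∀ t ∈ y, t.1 ∈ S) {p q : α × Bool} (hq : q ∈ y.head?) (hp : letterInv p ∈ y.getLast?)
    (hyP : z * mk y ∈ P) :
    ∃ (d : α × Bool) (J : Set (α × Bool)), d ∉ J ∧ J.Nonempty ∧ (∃ i, i ∉ J ∧ i ≠ d) ∧
      (z.toWord.IsChain fun s t => GoodTurn d J (letterInv s) t) ∧
      (∀ t ∈ z.toWord.head?, GoodTurn d J p t) ∧
      (∀ t ∈ z.toWord.getLast?, GoodTurn d J (letterInv t) q) ∧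
      ∀ s t, [s, t] <:+: y → GoodTurn d J (letterInv s) t := by
  have hyne : y ≠ [] := by rintro rfl; simp at hq
  have hPb : P ≠ ⊥ := by
    rintro rfl
    rw [mem_bot] at hyP
    apply h.notMem
    rw [eq_inv_of_mul_eq_one_left hyP]
    exact inv_mem (mk_mem_closure_of hyS)
  obtain ⟨d, J, hd, hJ, hi, hcut⟩ := exists_cut hP hPb hPt
  have hw : IsCyclicallyReduced (z.toWord ++ y) := by
    rw [isCyclicallyReduced_iff]
    refine ⟨isReduced_append_iff.2 ⟨isReduced_toWord, hy, fun s hs t ht e => ?_⟩, ?_⟩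
    · apply h.getLast_notMem s hs
      rw [e]; exact hyS t (List.mem_of_mem_head? ht)
    · intro s hs t ht e
      rw [List.getLast?_append_of_ne_nil _ hyne] at hs
      rw [List.head?_append_of_ne_nil _ h.ne_nil] at ht
      exact absurd (e ▸ hyS s (List.mem_of_mem_getLast? hs)) (h.head_notMem t ht)
  have hwP : ∃ c, c * mk (z.toWord ++ y) * c⁻¹ ∈ P := ⟨1, by
    rw [← mul_mk, mk_toWord]; simpa using hyP⟩
  have hinf {s t} (hst : [s, t] <:+: z.toWord ++ y) : GoodTurn d J (letterInv s) t :=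
    IsCut.goodTurn_of_infix hcut hw hwP hst
  refine ⟨d, J, hd, hJ, hi, ?_, ?_, ?_, ?_⟩
  · exact (List.isChain_isInfix _).imp fun a b hab =>
      hinf (hab.trans (List.prefix_append _ _).isInfix)
  · intro t ht
    have := hcut _ hw hwP (letterInv p) (by rwa [List.getLast?_append_of_ne_nil _ hyne]) t
      (by rwa [List.head?_append_of_ne_nil _ h.ne_nil])
    rwa [letterInv_letterInv] at this
  · intro t ht
    obtain ⟨L, hL⟩ : ∃ L, z.toWord = L ++ [t] := by
      rcases List.eq_nil_or_concat z.toWord with h | ⟨M, u, h⟩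
      · simp [h] at ht
      · rw [h, List.concat_eq_append] at ht ⊢
        rw [List.getLast?_concat] at ht
        exact ⟨M, by rw [Option.some_injective _ ht]⟩
    obtain ⟨M, hM⟩ : ∃ M, y = q :: M := by
      cases y with
      | nil => simp at hq
      | cons a L => simp at hq; exact ⟨L, by rw [hq]⟩
    exact hinf ⟨L, M, by rw [hL, hM]; simp⟩
  · intro s t hst
    exact hinf (hst.trans (List.suffix_append _ _).isInfix)

/-- A generator occurring once can be replaced in the basis by the whole word: invert the
automorphism sending that letter `t` to `L * t * M`. -/
theorem exists_equiv_letter_of_countP_eq_one {c : α} (hc : c ∉ S)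
    (h1 : z.toWord.countP (fun t => t.1 = c) = 1) :
    ∃ (θ : FreeGroup α ≃* FreeGroup α) (t : α × Bool), t.1 = c ∧ (∀ s ∈ S, θ (of s) = of s) ∧
      θ z = mk [t] := by
  obtain ⟨t, ht, htc⟩ := List.countP_pos_iff.1 (show 0 < z.toWord.countP (fun t => t.1 = c) by
    omega)
  have htc : t.1 = c := of_decide_eq_true htc
  obtain ⟨L, M, hLM⟩ := List.append_of_mem ht
  rw [hLM, List.countP_append, List.countP_cons_of_pos (by simpa using htc)] at h1
  have hL : L.countP (fun t => t.1 = c) = 0 := by omega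
  have hM : M.countP (fun t => t.1 = c) = 0 := by omega
  simp only [List.countP_eq_zero, decide_eq_true_eq] at hL hM
  subst htc
  obtain ⟨η, h2, h3⟩ := exists_mulEquiv_letter t (u := mk L) (v := mk M) (mk_mem_closure_of hL)
    (mk_mem_closure_of hM)
  refine ⟨η.symm, t, rfl, fun s hs => ?_, ?_⟩
  · rw [MulEquiv.symm_apply_eq]
    exact (h3 s (by rintro rfl; exact hc hs)).symm
  · rw [MulEquiv.symm_apply_eq, h2, mul_mk, mul_mk, ← mk_toWord (x := z), hLM]; simp

omit [DecidableEq α] in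
/-- An element of a factor spanned by part of the basis, primitive in the whole group, is moved to
a generator by an automorphism fixing the rest of the basis. -/
theorem exists_equiv_of_mem {T : Set α} (hzT : z ∈ closure (of '' T)) (hz1 : z ≠ 1)
    (hz : IsFactor (closure {z})) : ∃ (θ : FreeGroup α ≃* FreeGroup α) (x : α),
      (∀ s ∉ T, θ (of s) = of s) ∧ θ z = of x := by
  let b := FreeGroupBasis.ofFreeGroup α
  have hb : ⇑b = of := coe_ofFreeGroup
  have hzA : z ∈ closure (b '' T) := by rwa [hb]
  have hA : IsFactor (closure (b '' T)) := ⟨α, b, T, rfl⟩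
  obtain ⟨β, i, hi⟩ := IsFactor.exists_basis_apply (w := (⟨z, hzA⟩ : closure (b '' T)))
    (hA.singleton_subgroup_iff.2 hz) (by simpa [Subtype.ext_iff] using hz1) (b.restrict T)
  obtain ⟨b', e, h1, h2⟩ := IsFactor.exists_extend b T β
  refine ⟨b'.repr, e i, fun s hs => ?_, ?_⟩
  · have : b' s = of s := by rw [h1 s hs, hb]
    exact (congrArg b'.repr this).symm.trans (b'.repr_apply_coe s)
  · have : z = b' (e i) := by rw [h2, hi]
    rw [this, b'.repr_apply_coe]

end IsShort

/-- **Key theorem**, in a position where `z` is short. -/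
theorem IsShort.exists_letter [DecidableEq α] [Finite α] {S : Set α} {z g : FreeGroup α}
    (h : IsShort S z) (hS : S.Nontrivial) (hg : g ∈ closure (of '' S))
    (hz : IsFactor (closure {z * g}))
    (hP : ∀ x ∈ closure (of '' S), IsFactor (closure {x}) →
      ∃ P : Subgroup (FreeGroup α), IsFactor P ∧ P ≠ ⊤ ∧ x ∈ P ∧ z * g ∈ P)
    (htop : ∀ P : Subgroup (FreeGroup α), IsFactor P → closure (of '' S) ≤ P → z ∈ P → P = ⊤) :
    ∃ t : α × Bool, z = mk [t] ∧ Sᶜ = {t.1} := by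
  obtain ⟨s₀, hs₀, s₁, hs₁, hs₀₁⟩ := hS
  have hα : Nontrivial α := ⟨s₀, s₁, hs₀₁⟩
  have htop' (T : Set α) (hST : S ⊆ T) (hzT : z ∈ closure (of '' T)) : T = Set.univ := by
    have := htop _ (isFactor_closure_of T) (closure_mono (Set.image_mono hST)) hzT
    rw [← coe_ofFreeGroup] at this
    exact (IsFactor.closure_image_eq_top_iff _).1 this
  have hfull (c : α) (hc : c ∉ S) : ∃ t ∈ z.toWord, t.1 = c := by
    by_contra hcon
    push Not at hcon
    have := htop' {c}ᶜ (by simpa using hc) (mem_closure_of_iff.2 hcon)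
    simp at this
  by_cases hone : ∃ c ∉ S, z.toWord.countP (fun t => t.1 = c) = 1
  · obtain ⟨c, hc, h1⟩ := hone
    obtain ⟨θ, t, ht, hθ, hθz⟩ := IsShort.exists_equiv_letter_of_countP_eq_one hc h1
    -- Minimality bounds the length of `z` by one; `htop` then leaves no generator outside `S` other
    -- than this letter.
    have h2 := h.norm_le_of_fixed θ hθ
    rw [hθz, IsReduced.norm_mk (by simp), List.length_singleton, norm] at h2
    obtain ⟨s, hs, hsc⟩ := hfull c hc
    obtain ⟨s', hs'⟩ : ∃ s, z.toWord = [s] := by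
      rw [← List.length_eq_one_iff]
      have := List.length_pos_of_mem hs
      omega
    have hzs : z = mk [s'] := by rw [← hs', mk_toWord]
    rw [hs', List.mem_singleton] at hs
    subst hs
    refine ⟨s, hzs, ?_⟩
    have h3 := htop' (insert s.1 S) (Set.subset_insert _ _) (by
      rw [hzs, mk_letter_mem_closure_iff]; exact Set.mem_insert _ _)
    ext x
    have h4 : x ∈ insert s.1 S := h3 ▸ Set.mem_univ x
    rw [Set.mem_compl_iff, Set.mem_singleton_iff]
    constructor
    · exact fun h => (Set.mem_insert_iff.1 h4).resolve_right h
    · rintro rfl; rwa [hsc]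
  exfalso
  push Not at hone
  have hocc (c : α) (hc : c ∉ S) : 2 ≤ z.toWord.countP (fun t => t.1 = c) := by
    obtain ⟨t, ht, htc⟩ := hfull c hc
    have h1 := hone c hc
    have h2 : 0 < z.toWord.countP (fun t => t.1 = c) :=
      List.countP_pos_iff.2 ⟨t, ht, by simpa using htc⟩
    omega
  by_cases hg1 : g = 1
  · subst hg1
    rw [mul_one] at hz hP
    by_cases hzS : ∃ t ∈ z.toWord, t.1 ∈ S
    · obtain ⟨t, ht, htS⟩ := hzS
      obtain ⟨b, hb, hbt⟩ : ∃ b ∈ S, b ≠ t.1 := by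
        by_cases h : s₀ = t.1
        · exact ⟨s₁, hs₁, fun h' => hs₀₁ (h.trans h'.symm)⟩
        · exact ⟨s₀, hs₀, h⟩
      set a := t.1 with ha
      obtain ⟨W, hW1, hW2, hW3, hW4, hW5⟩ := exists_word_all_turns (S \ {a}) (b, true) ⟨hb, hbt⟩
      obtain ⟨l, hl⟩ : ∃ l, l ∈ W.getLast? := by
        have : W ≠ [] := by rintro rfl; simp at hW3
        exact ⟨_, List.getLast?_eq_getLast_of_ne_nil this⟩
      have hlS := hW2 l (List.mem_of_mem_getLast? hl)
      -- Primitive because it is the image of `a` under `a ↦ W * a * b`. It contains all turns of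
      -- `S` minus `a`, and its end directions `b⁻¹` and `b` are distinct as `false_of_cut`
      -- requires.
      let y := W ++ [(a, true), (b, true)]
      have hyr : IsReduced y := by
        refine isReduced_append_iff.2 ⟨hW1, ?_, ?_⟩
        · rw [isReduced_iff_isChain]
          simp [letterInv]
        · intro s hs t ht e
          rw [Option.mem_unique hs hl] at e
          simp only [List.head?_cons, Option.mem_def, Option.some.injEq] at ht
          subst ht
          exact hlS.2 (by rw [e]; rfl)
      have hyS : ∀ s ∈ y, s.1 ∈ S := by
        intro s hs
        simp only [y, List.mem_append, List.mem_cons, List.not_mem_nil, or_false] at hs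
        rcases hs with hs | rfl | rfl
        · exact (hW2 s hs).1
        · exact htS
        · exact hb
      have hyf : IsFactor (closure {mk y}) := by
        obtain ⟨η, hη, -⟩ := exists_mulEquiv_letter (a, true) (u := mk W) (v := mk [(b, true)])
          (mk_mem_closure_of fun s hs => (hW2 s hs).2)
          (mk_mem_closure_of (by simpa using hbt))
        have := isFactor_closure_singleton_mulEquiv (isFactor_closure_singleton_letter (a, true)) η
        rw [hη, mul_mk, mul_mk] at this
        simpa [y] using this
      obtain ⟨P, hPf, hPt, hyP, hzP⟩ := hP _ (mk_mem_closure_of hyS) hyf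
      obtain ⟨d, J, hd, hJ, hi, hc, hhead, hlast, hy⟩ := h.exists_cut_append hPf hPt hyr hyS
        (p := (b, false)) (q := (b, true)) (by simp [y, hW3]) (by simp [y, letterInv])
        (mul_mem hzP hyP)
      obtain ⟨K, hdK, hK, hKT, hJK⟩ := exists_side hd hJ hi fun x x' hx hx' hxx' =>
        goodTurn_of_all_turns hW5 (List.prefix_append _ _).isInfix hy hx hx' hxx'
      have hc' := hc.imp fun _ _ => hJK _ _
      have hla : GoodTurn d K (letterInv l) (a, true) := hJK _ _ <| hy _ _ <| by
        rcases List.eq_nil_or_concat W with h | ⟨M, u, h⟩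
        · simp [h] at hl
        · rw [h, List.concat_eq_append, List.getLast?_concat] at hl
          rw [Option.mem_def, Option.some.injEq] at hl
          exact ⟨M, [(b, true)], by simp [y, h, hl]⟩
      have hab : GoodTurn d K (letterInv (a, true)) (b, true) :=
        hJK _ _ <| hy _ _ (List.suffix_append _ _).isInfix
      have hne : letterInv l ≠ (b, true) := fun h => hW4 l hl (letterInv_eq_iff.1 h)
      -- The only letters of `S` possible in `K` are `a` and its inverse. The former forces `d =
      -- l⁻¹`, the latter `d = b`, so not both occur.
      have hKS (s) (hs : s ∈ K) (hsS : s.1 ∈ S) : s = (a, true) ∨ s = letterInv (a, true) := by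
        have : s.1 = a := by
          by_contra hsa
          exact hKT s hs ⟨hsS, hsa⟩
        exact fst_eq_iff.1 this
      have hlK : letterInv l ∉ K := fun h => hKT _ h hlS
      have hbK : (b, true) ∉ K := fun h => hKT _ h ⟨hb, hbt⟩
      by_cases ha1 : (a, true) ∈ K
      · have hd1 : letterInv l = d := (hla.2 ha1).resolve_left hlK
        refine h.false_of_cut_of_mem hdK ha1 (hd1 ▸ hlS.1) htS (hd1 ▸ hlS.2) (fun s hs hsS =>
          (hKS s hs hsS).resolve_right ?_) hc' ⟨t, ht, rfl⟩
        rintro rfl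
        exact hne (hd1.trans ((hab.1 hs).resolve_left hbK).symm)
      · by_cases ha2 : letterInv (a, true) ∈ K
        · have hd1 : (b, true) = d := (hab.1 ha2).resolve_left hbK
          exact h.false_of_cut_of_mem hdK ha2 (hd1 ▸ hb) htS (hd1 ▸ hbt) (fun s hs hsS =>
            (hKS s hs hsS).resolve_left (by rintro rfl; exact ha1 hs)) hc' ⟨t, ht, rfl⟩
        · refine h.false_of_cut hocc hdK hK (fun s hs hsS => ?_) hc' (p := (b, false))
            (q := (b, true)) hb hb (by simp) (fun t ht => hJK _ _ (hhead t ht))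
            fun t ht => hJK _ _ (hlast t ht)
          rcases hKS s hs hsS with rfl | rfl
          · exact ha1 hs
          · exact ha2 hs
    · push Not at hzS
      -- A primitive element free of `S` can be turned into a generator while fixing `S`, so
      -- minimality gives length one, against two occurrences of a generator.
      obtain ⟨θ, x, h1, h2⟩ := IsShort.exists_equiv_of_mem (T := Sᶜ) (mem_closure_of_iff.2 hzS)
        (fun h1 => h.notMem (h1 ▸ one_mem _)) hz
      have h3 := h.norm_le_of_fixed θ fun s hs => h1 s (by simpa using hs)
      rw [h2, norm_of, norm] at h3
      obtain ⟨t, ht⟩ := List.exists_mem_of_ne_nil _ h.ne_nil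
      have := (hocc t.1 (hzS t ht)).trans List.countP_le_length
      omega
  · have hgne : g.toWord ≠ [] := by simpa using hg1
    obtain ⟨p, hp⟩ : ∃ s, s ∈ g.toWord.head? := ⟨_, List.head?_eq_some_head hgne⟩
    obtain ⟨l, hl⟩ : ∃ s, s ∈ g.toWord.getLast? := ⟨_, List.getLast?_eq_getLast_of_ne_nil hgne⟩
    have hgS := mem_closure_of_iff.1 hg
    -- Two directions are excluded and `S` supplies at least three. `t₀ ≠ p` keeps `V⁻¹ * g`
    -- reduced; `t₀ ≠ l⁻¹` keeps the end directions of `y` distinct.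
    obtain ⟨t₀, ht₀S, ht₀p, ht₀l⟩ : ∃ t₀ : α × Bool, t₀.1 ∈ S ∧ t₀ ≠ p ∧ t₀ ≠ letterInv l := by
      by_contra hcon
      push Not at hcon
      have k1 := hcon (s₀, true) hs₀
      have k2 := hcon (s₀, false) hs₀
      have k3 := hcon (s₁, true) hs₁
      have n1 : (s₀, true) ≠ (s₀, false) := by simp
      have n2 : (s₀, true) ≠ (s₁, true) := by simpa using hs₀₁
      have n3 : (s₀, false) ≠ (s₁, true) := by simp
      by_cases e1 : (s₀, true) = p
      · exact n3 ((k2 fun e => n1 (e1.trans e.symm)).trans (k3 fun e => n2 (e1.trans e.symm)).symm)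
      · by_cases e2 : (s₀, false) = p
        · exact n2 ((k1 e1).trans (k3 fun e => n3 (e2.trans e.symm)).symm)
        · exact n1 ((k1 e1).trans (k2 e2).symm)
    obtain ⟨V, hV1, hV2, hV3, hV4, hV5⟩ := exists_word_all_turns S t₀ ht₀S
    have hVne : V ≠ [] := by rintro rfl; simp at hV3
    obtain ⟨v, hv⟩ : ∃ s, s ∈ V.getLast? := ⟨_, List.getLast?_eq_getLast_of_ne_nil hVne⟩
    obtain ⟨a, haS, hav⟩ : ∃ a ∈ S, a ≠ v.1 := by
      by_cases h : s₀ = v.1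
      · exact ⟨s₁, hs₁, fun h' => hs₀₁ (h.trans h'.symm)⟩
      · exact ⟨s₀, hs₀, h⟩
    have hVi : (invRev V).head? = some (letterInv v) := by
      rw [invRev_eq, List.head?_reverse, List.getLast?_map, hv]; rfl
    have hVi' : (invRev V).getLast? = some (letterInv t₀) := by
      rw [invRev_eq, List.getLast?_reverse, List.head?_map, hV3]; rfl
    have hVine : invRev V ≠ [] := by intro h; simp [h] at hVi
    let y := V ++ ([(a, true)] ++ (invRev V ++ g.toWord))
    have hyr : IsReduced y := by
      refine isReduced_append_iff.2 ⟨hV1, isReduced_append_iff.2 ⟨by simp,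
        isReduced_append_iff.2 ⟨?_, isReduced_toWord, ?_⟩, ?_⟩, ?_⟩
      · rw [isReduced_iff_reduce_eq, reduce_invRev, hV1.reduce_eq]
      · intro s hs t ht e
        rw [hVi', Option.mem_def, Option.some.injEq] at hs
        rw [Option.mem_unique ht hp, ← hs, letterInv_eq_iff, letterInv_letterInv] at e
        exact ht₀p e
      · intro s hs t ht e
        rw [List.head?_append_of_ne_nil _ hVine, hVi, Option.mem_def, Option.some.injEq] at ht
        simp only [List.getLast?_singleton, Option.mem_def, Option.some.injEq] at hs
        rw [← hs, ← ht, letterInv_letterInv] at e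
        exact hav (congrArg Prod.fst e)
      · intro s hs t ht e
        simp only [List.head?_append, List.head?_cons, Option.mem_def, Option.some_or,
          Option.some.injEq] at ht
        rw [Option.mem_unique hs hv, ← ht] at e
        exact hav (congrArg Prod.fst e).symm
    have hyS : ∀ s ∈ y, s.1 ∈ S := by
      intro s hs
      simp only [y, List.mem_append, List.mem_singleton] at hs
      rcases hs with hs | rfl | hs | hs
      · exact hV2 s hs
      · exact haS
      · rw [invRev_eq, List.mem_reverse, List.mem_map] at hs
        obtain ⟨s', hs', rfl⟩ := hs
        exact hV2 s' hs'
      · exact hgS s hs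
    have hmy : mk y = mk V * (of a * ((mk V)⁻¹ * g)) := by
      simp only [y]
      rw [← mul_mk, ← mul_mk, ← mul_mk, mk_toWord, inv_mk]; rfl
    -- A conjugate of a generator, hence primitive, chosen so that `g * x` is the reduced word `y =
    -- V * a * V⁻¹ * g`, which contains every turn of `S`.
    let x := g⁻¹ * mk V * of a * (g⁻¹ * mk V)⁻¹
    have hxy : z * g * x = z * mk y := by
      rw [hmy]; simp only [x]; group
    have hxS : x ∈ closure (of '' S) := by
      have h1 : g⁻¹ * mk V ∈ closure (of '' S) := mul_mem (inv_mem hg) (mk_mem_closure_of hV2)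
      exact mul_mem (mul_mem h1 (subset_closure ⟨a, haS, rfl⟩)) (inv_mem h1)
    have hxf : IsFactor (closure {x}) :=
      isFactor_closure_singleton_mulEquiv (isFactor_closure_singleton_letter (a, true))
        (MulAut.conj (g⁻¹ * mk V))
    obtain ⟨P, hPf, hPt, hxP, hzP⟩ := hP x hxS hxf
    obtain ⟨d, J, hd, hJ, hi, hc, hhead, hlast, hy⟩ := h.exists_cut_append hPf hPt hyr hyS
      (p := letterInv l) (q := t₀) (by simp [y, hV3]) (by
        rw [letterInv_letterInv]
        simp only [y]
        rwa [List.getLast?_append_of_ne_nil _ (by simp), List.getLast?_append_of_ne_nil _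
          (by simp [hgne]), List.getLast?_append_of_ne_nil _ hgne])
      (hxy ▸ mul_mem hzP hxP)
    obtain ⟨K, hdK, hK, hKT, hJK⟩ := exists_side hd hJ hi fun x x' hx hx' hxx' =>
      goodTurn_of_all_turns hV5 (List.prefix_append _ _).isInfix hy hx hx' hxx'
    exact h.false_of_cut hocc hdK hK hKT (hc.imp fun _ _ => hJK _ _)
      (p := letterInv l) (q := t₀) (hgS l (List.mem_of_mem_getLast? hl)) ht₀S ht₀l.symm
      (fun t ht => hJK _ _ (hhead t ht)) fun t ht => hJK _ _ (hlast t ht)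

end FreeGroup

namespace FreeGroup

variable {α : Type}

theorem map_closure_of_eq {S : Set α} {ψ : FreeGroup α ≃* FreeGroup α}
    (h1 : ∀ s ∈ S, ψ (of s) ∈ closure (of '' S))
    (h2 : ∀ s ∈ S, ψ.symm (of s) ∈ closure (of '' S)) :
    (closure (of '' S)).map ψ.toMonoidHom = closure (of '' S) := by
  apply le_antisymm
  · rw [MonoidHom.map_closure, closure_le]
    rintro _ ⟨_, ⟨s, hs, rfl⟩, rfl⟩
    exact h1 s hs
  · rw [closure_le]
    rintro _ ⟨s, hs, rfl⟩
    exact ⟨_, h2 s hs, ψ.apply_symm_apply _⟩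

/-- Let `S` be a part of the basis with at least two elements, spanning the factor `B`, and let
`z` be a primitive element outside `B`. If every primitive `x` in `B` lies with `z` in a proper
factor, while `B` and `z` do not, then `z` completes a basis of `B` to a basis of the
whole group. -/
theorem exists_basis_of_primitive_mem_factor [Finite α] {S : Set α} (hS : S.Nontrivial)
    {z : FreeGroup α} (hzS : z ∉ closure (of '' S)) (hz : IsFactor (closure {z}))
    (hP : ∀ x ∈ closure (of '' S), IsFactor (closure {x}) →
      ∃ P : Subgroup (FreeGroup α), IsFactor P ∧ P ≠ ⊤ ∧ x ∈ P ∧ z ∈ P)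
    (htop : ∀ P : Subgroup (FreeGroup α), IsFactor P → closure (of '' S) ≤ P → z ∈ P → P = ⊤) :
    ∃ (b : FreeGroupBasis α (FreeGroup α)) (c : α), Sᶜ = {c} ∧
      closure (b '' S) = closure (of '' S) ∧ closure {b c} = closure {z} := by
  classical
  set B := closure (of '' S) with hB
  -- Minimise `u * ψ z * v` over automorphisms preserving `B` and `u`, `v` in `B`. The minimum `w`
  -- need not be primitive, but `w * (v⁻¹ * u⁻¹)` is the image of `z` under an automorphism
  -- preserving `B`; this is the element `g` of `IsShort.exists_letter`.
  let X := {p : (FreeGroup α ≃* FreeGroup α) × FreeGroup α × FreeGroup α |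
    B.map p.1.toMonoidHom = B ∧ p.2.1 ∈ B ∧ p.2.2 ∈ B}
  obtain ⟨⟨ψ, u, v⟩, ⟨hψ, hu, hv⟩, hmin⟩ :=
    (InvImage.wf (fun p : (FreeGroup α ≃* FreeGroup α) × FreeGroup α × FreeGroup α =>
      (p.2.1 * p.1 z * p.2.2).norm) wellFounded_lt).has_min X
      ⟨(MulEquiv.refl _, 1, 1), map_id B, one_mem _, one_mem _⟩
  simp only [InvImage, not_lt] at hmin hψ hu hv
  have hmem {ψ : FreeGroup α ≃* FreeGroup α} (h : B.map ψ.toMonoidHom = B) (x) :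
      ψ x ∈ B ↔ x ∈ B := by
    conv_lhs => rw [← h]
    exact mem_map_equiv.trans (by simp)
  let ψ' := ψ.trans (MulAut.conj u)
  have hψ'B (x) : ψ' x ∈ B ↔ x ∈ B := by
    rw [← hmem hψ x]
    change u * ψ x * u⁻¹ ∈ B ↔ _
    rw [B.mul_mem_cancel_right (inv_mem hu), B.mul_mem_cancel_left hu]
  have hψ'B' (x) : ψ'.symm x ∈ B ↔ x ∈ B := by rw [← hψ'B, MulEquiv.apply_symm_apply]
  set w := u * ψ z * v with hw
  have hwg : w * (v⁻¹ * u⁻¹) = ψ' z := by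
    change _ = u * ψ z * u⁻¹
    rw [hw]; group
  have hg : v⁻¹ * u⁻¹ ∈ B := mul_mem (inv_mem hv) (inv_mem hu)
  have hshort : IsShort S w := by
    refine ⟨fun h => hzS ?_, fun θ h1 h2 u' hu' v' hv' => ?_⟩
    · rwa [hw, ← hB, B.mul_mem_cancel_right hv, B.mul_mem_cancel_left hu, hmem hψ] at h
    · have hθ := map_closure_of_eq h1 h2
      have := hmin (ψ.trans θ, u' * θ u, θ v * v') ⟨by
        change B.map (θ.toMonoidHom.comp ψ.toMonoidHom) = B
        rw [← map_map, hψ, hθ], mul_mem hu' ((hmem hθ u).2 hu), mul_mem ((hmem hθ v).2 hv) hv'⟩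
      rw [hw]
      refine this.trans_eq (congrArg _ ?_)
      change u' * θ u * θ (ψ z) * (θ v * v') = u' * θ (u * ψ z * v) * v'
      rw [_root_.map_mul, _root_.map_mul]; group
  have hmap {P : Subgroup (FreeGroup α)} {e : FreeGroup α ≃* FreeGroup α} {x : FreeGroup α} :
      e x ∈ P.map e.toMonoidHom ↔ x ∈ P := mem_map_equiv.trans (by simp)
  obtain ⟨t, hwt, hSt⟩ := hshort.exists_letter hS hg
    (hwg ▸ isFactor_closure_singleton_mulEquiv hz ψ') (fun x hx hxf => by
      obtain ⟨P, h1, h2, h3, h4⟩ := hP (ψ'.symm x) ((hψ'B' x).2 hx)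
        (isFactor_closure_singleton_mulEquiv hxf ψ'.symm)
      refine ⟨P.map ψ'.toMonoidHom, h1.map_equiv ψ', fun h => h2 ?_, ?_, ?_⟩
      · rw [eq_top_iff] at h ⊢
        intro y _
        exact hmap.1 (h (mem_top (ψ' y)))
      · rw [← hmap (e := ψ'), MulEquiv.apply_symm_apply] at h3; exact h3
      · rw [hwg]; exact hmap.2 h4) (fun P h1 h2 h3 => by
      have h4 := htop (P.map ψ'.symm.toMonoidHom) (h1.map_equiv _) (fun x hx => by
          have := hmap (e := ψ'.symm).2 (h2 ((hψ'B x).2 hx))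
          rwa [MulEquiv.symm_apply_apply] at this) (by
          have := hmap (e := ψ'.symm).2 (mul_mem h3 (h2 hg))
          rwa [hwg, MulEquiv.symm_apply_apply] at this)
      rw [eq_top_iff] at h4 ⊢
      intro y _
      exact hmap.1 (h4 (mem_top (ψ'.symm y))))
  have hS' : S = {t.1}ᶜ := by rw [← hSt, compl_compl]
  -- Multiply the letter on the right by `v⁻¹ * u⁻¹` to recover the image of `z` as a basis element
  -- up to inversion.
  obtain ⟨η, hη, hη'⟩ := exists_mulEquiv_letter t (one_mem _) (by rw [← hS']; exact hg)
  let b := ((FreeGroupBasis.ofFreeGroup α).map η).map ψ'.symm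
  have hbS (s) (hs : s ∈ S) : b s = ψ'.symm (of s) := by
    simp only [b, FreeGroupBasis.map_apply, FreeGroupBasis.ofFreeGroup_apply]
    rw [hη' s (by rw [hS'] at hs; exact hs)]
  refine ⟨b, t.1, hSt, ?_, ?_⟩
  · have : b '' S = ψ'.symm.toMonoidHom '' (of '' S) := by
      rw [← Set.image_comp]
      exact Set.image_congr hbS
    rw [this, ← MonoidHom.map_closure]
    refine le_antisymm ?_ fun x hx => ?_
    · rintro _ ⟨x, hx, rfl⟩
      exact (hψ'B' x).2 hx
    · exact ⟨ψ' x, (hψ'B x).2 hx, ψ'.symm_apply_apply x⟩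
  · have hz' : ψ'.symm (η (mk [t])) = z := by
      rw [hη, one_mul, ← hwt, hwg, MulEquiv.symm_apply_apply]
    have hbt : b t.1 = ψ'.symm (η (of t.1)) := by
      simp [b]
    obtain ⟨x, _ | _⟩ := t
    · rw [hbt, ← hz', mk_pair_false, _root_.map_inv, _root_.map_inv, ← zpowers_eq_closure,
        ← zpowers_eq_closure, zpowers_inv]
    · rw [hbt, ← hz']; rfl

end FreeGroup

/-- Version of `FreeGroup.exists_basis_of_primitive_mem_factor` for an abstract free group. -/
theorem IsFactor.exists_basis_of_primitive_mem {ι G : Type} [Group G] [Finite ι]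
    (b₀ : FreeGroupBasis ι G) {S : Set ι} (hS : S.Nontrivial)
    {z : G} (hzS : z ∉ closure (b₀ '' S)) (hz : IsFactor (closure {z}))
    (hP : ∀ x ∈ closure (b₀ '' S), IsFactor (closure {x}) →
      ∃ P : Subgroup G, IsFactor P ∧ P ≠ ⊤ ∧ x ∈ P ∧ z ∈ P)
    (htop : ∀ P : Subgroup G, IsFactor P → closure (b₀ '' S) ≤ P → z ∈ P → P = ⊤) :
    ∃ (b : FreeGroupBasis ι G) (c : ι), Sᶜ = {c} ∧
      closure (b '' S) = closure (b₀ '' S) ∧ closure {b c} = closure {z} := by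
  let e : FreeGroup ι ≃* G := b₀.repr.symm
  have he (x) : e (FreeGroup.of x) = b₀ x := rfl
  have heS : closure (b₀ '' S) = (closure (FreeGroup.of '' S)).map e.toMonoidHom := by
    rw [MonoidHom.map_closure, ← Set.image_comp]; rfl
  have hmap {P : Subgroup (FreeGroup ι)} {x : FreeGroup ι} :
      e x ∈ P.map e.toMonoidHom ↔ x ∈ P := mem_map_equiv.trans (by simp)
  have hmap' {P : Subgroup G} {x : G} :
      e.symm x ∈ P.map e.symm.toMonoidHom ↔ x ∈ P := mem_map_equiv.trans (by simp)
  have hsing {x : FreeGroup ι} : (closure {x}).map e.toMonoidHom = closure {e x} := by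
    rw [MonoidHom.map_closure, Set.image_singleton]; rfl
  have hsing' {x : G} : (closure {x}).map e.symm.toMonoidHom = closure {e.symm x} := by
    rw [MonoidHom.map_closure, Set.image_singleton]; rfl
  obtain ⟨z, rfl⟩ := e.surjective z
  rw [heS, hmap] at hzS
  rw [heS] at hP htop ⊢
  obtain ⟨b, c, h1, h2, h3⟩ := FreeGroup.exists_basis_of_primitive_mem_factor hS hzS
    (by have := hz.map_equiv e.symm; rwa [hsing', MulEquiv.symm_apply_apply] at this)
    (fun x hx hxf => by
      obtain ⟨P, k1, k2, k3, k4⟩ := hP (e x) (hmap.2 hx) (hsing ▸ hxf.map_equiv e)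
      refine ⟨P.map e.symm.toMonoidHom, k1.map_equiv _, fun h => k2 ?_, ?_, ?_⟩
      · rw [eq_top_iff] at h ⊢
        intro y _
        exact hmap'.1 (h (mem_top (e.symm y)))
      · simpa using hmap'.2 k3
      · simpa using hmap'.2 k4)
    (fun P k1 k2 k3 => by
      have := htop (P.map e.toMonoidHom) (k1.map_equiv e) (map_mono k2) (hmap.2 k3)
      rw [eq_top_iff] at this ⊢
      intro y _
      exact hmap.1 (this (mem_top (e y))))
  refine ⟨b.map e, c, h1, ?_, ?_⟩
  · rw [← h2, MonoidHom.map_closure, ← Set.image_comp]; rfl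
  · rw [FreeGroupBasis.map_apply, ← hsing, h3, hsing]

/-! ### Lines meeting a factor trivially -/

namespace IsFactor

variable {G : Type} [Group G]

theorem eq_bot_or_eq_top {ι : Type} [Subsingleton ι] (b : FreeGroupBasis ι G) {A : Subgroup G}
    (hA : IsFactor A) : A = ⊥ ∨ A = ⊤ := by
  obtain ⟨c, S, rfl⟩ := hA.exists_basis b
  rcases Set.eq_empty_or_nonempty S with rfl | h
  · left
    rw [Set.image_empty, Subgroup.closure_empty]
  · right
    rw [closure_image_eq_top_iff]
    exact Subsingleton.eq_univ_of_nonempty h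

/-- A factor meets an infinite cyclic factor in a factor of it, which is trivial or everything; so a
factor containing a nontrivial power of a primitive element contains that element. -/
theorem closure_singleton_le {M : Subgroup G} (hM : IsFactor M) {w g : G}
    (hw : IsFactor (closure {w})) (hgw : g ∈ closure {w}) (hgM : g ∈ M) (hg : g ≠ 1) :
    closure {w} ≤ M := by
  have hw1 : w ≠ 1 := by
    rintro rfl
    rw [Subgroup.closure_singleton_one, mem_bot] at hgw
    exact hg hgw
  have hM' := hM
  obtain ⟨ι, c, -⟩ := hM
  obtain ⟨b, i, rfl⟩ := hw.exists_basis_apply hw1 c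
  rw [← Set.image_singleton] at hgw ⊢
  rcases eq_bot_or_eq_top (b.restrict {i}) (hM'.subgroupOf (closure (b '' {i}))) with h | h
  · have : (⟨g, hgw⟩ : closure (b '' {i})) ∈ M.subgroupOf (closure (b '' {i})) := hgM
    rw [h, mem_bot] at this
    exact absurd (congrArg Subtype.val this) hg
  · rwa [subgroupOf_eq_top] at h

end IsFactor

namespace FreeGroup

variable {α : Type}

/-- In the Cayley tree, any path passes through all vertices of the reduced path with the same ends.
-/
theorem exists_prefix_of_prefix_toWord [DecidableEq α] (L : List (α × Bool)) {p : List (α × Bool)}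
    (hp : p <+: (mk L).toWord) : ∃ L₁, L₁ <+: L ∧ mk p = mk L₁ := by
  induction L using List.reverseRecOn generalizing p with
  | nil =>
    refine ⟨[], List.prefix_rfl, ?_⟩
    rw [← one_eq_mk, toWord_one, List.prefix_nil] at hp
    rw [hp]
  | append_singleton L t ih =>
    have h1 {p} (hp : p <+: (mk L).toWord) : ∃ L₁, L₁ <+: L ++ [t] ∧ mk p = mk L₁ := by
      obtain ⟨L₁, h1, h2⟩ := ih hp
      exact ⟨L₁, h1.trans (List.prefix_append _ _), h2⟩
    rcases toWord_mul_letter (mk L) t with h | h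
    · rw [mul_mk] at h
      rw [h, List.prefix_concat_iff] at hp
      rcases hp with rfl | hp
      · exact ⟨L ++ [t], List.prefix_rfl, by rw [← mul_mk, mk_toWord, mul_mk]⟩
      · exact h1 hp
    · rw [mul_mk] at h
      exact h1 (hp.trans (by rw [h]; exact List.prefix_append _ _))

/-- A homomorphism to `ℤ` vanishing on a finitely generated subgroup is bounded on the
prefixes of its elements. -/
theorem exists_bound_prefix [DecidableEq α] {ι : Type} [Finite ι]
    (b : FreeGroupBasis ι (FreeGroup α)) (S : Set ι)
    (l : FreeGroup α →* Multiplicative ℤ) (hl : ∀ i ∈ S, l (b i) = 1) :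
    ∃ C : ℕ, ∀ g ∈ closure (b '' S), ∀ p, p <+: g.toWord → (Multiplicative.toAdd (l (mk p))).natAbs ≤ C := by
  have : Fintype ι := Fintype.ofFinite ι
  let f (p : List (α × Bool)) : ℕ := (Multiplicative.toAdd (l (mk p))).natAbs
  have hb (g : FreeGroup α) : ∃ C : ℕ, ∀ p, p <+: g.toWord → f p ≤ C := by
    refine ⟨(g.toWord.inits.map f).sum, fun p hp => ?_⟩
    exact List.single_le_sum (by simp) _ (List.mem_map_of_mem ((List.mem_inits _ _).2 hp))
  choose C hC using hb
  -- A bound for prefixes of single basis letters. Complete basis letters before the current one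
  -- contribute nothing, because `l` kills them.
  let K := ∑ t : ι × Bool, C (b.letterVal t)
  have hK (t) : ∀ p, p <+: (b.letterVal t).toWord → f p ≤ K := fun p hp =>
    (hC _ p hp).trans (Finset.single_le_sum (f := fun t => C (b.letterVal t))
      (fun _ _ => Nat.zero_le _) (Finset.mem_univ t))
  refine ⟨K, fun g hg p hp => ?_⟩
  obtain ⟨L, hL, rfl⟩ := (b.mem_closure_iff_exists_word S g).1 hg
  obtain ⟨W, hW, hWp⟩ : ∃ W, mk W = b.wordVal L ∧ ∀ p, p <+: W → f p ≤ K := by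
    clear hp hg
    induction L with
    | nil =>
      refine ⟨[], rfl, fun p hp => ?_⟩
      rw [List.prefix_nil] at hp
      subst hp
      simp [f, ← one_eq_mk]
    | cons t L ih =>
      obtain ⟨W, h1, h2⟩ := ih fun s hs => hL s (List.mem_cons_of_mem _ hs)
      have ht : l (b.letterVal t) = 1 := by
        have := hl t.1 (hL t List.mem_cons_self)
        obtain ⟨i, _ | _⟩ := t
        · simpa [FreeGroupBasis.letterVal] using this
        · exact this
      refine ⟨(b.letterVal t).toWord ++ W, by
        rw [← mul_mk, mk_toWord, h1, FreeGroupBasis.wordVal_cons], fun p hp => ?_⟩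
      rcases List.prefix_or_prefix_of_prefix hp (List.prefix_append _ _) with h | ⟨q, rfl⟩
      · exact hK t p h
      · have := h2 q ((List.prefix_append_right_inj _).1 hp)
        simp only [f] at this ⊢
        rwa [← mul_mk, mk_toWord, _root_.map_mul, ht, one_mul]
  obtain ⟨L₁, h1, h2⟩ := exists_prefix_of_prefix_toWord W (hW ▸ hp)
  rw [h2]
  exact hWp L₁ h1

/-- The prefixes just before and just after the block have values of absolute value at most `C`, but
`2 * C + 1` equal letters change the value by at least `2 * C + 1`. -/
theorem replicate_not_infix [DecidableEq α] {M : Subgroup (FreeGroup α)} {C : ℕ}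
    {l : FreeGroup α →* Multiplicative ℤ}
    (hC : ∀ g ∈ M, ∀ p, p <+: g.toWord → (Multiplicative.toAdd (l (mk p))).natAbs ≤ C)
    {t : α × Bool} (ht : l (mk [t]) ≠ 1) {g : FreeGroup α} (hg : g ∈ M) :
    ¬ List.replicate (2 * C + 1) t <:+: g.toWord := by
  rintro ⟨p, q, hpq⟩
  have h1 := hC g hg p ⟨List.replicate (2 * C + 1) t ++ q, by rw [← hpq]; simp⟩
  have h2 := hC g hg (p ++ List.replicate (2 * C + 1) t) ⟨q, hpq⟩
  have h3 (n : ℕ) : mk (List.replicate n t) = mk [t] ^ n := by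
    induction n with
    | zero => rfl
    | succ n ih => rw [List.replicate_succ', ← mul_mk, ih, pow_succ]
  rw [← mul_mk, h3, _root_.map_mul, _root_.map_pow, toAdd_mul, toAdd_pow] at h2
  have h4 : Multiplicative.toAdd (l (mk [t])) ≠ 0 := by simpa using ht
  set x := Multiplicative.toAdd (l (mk p))
  set y := Multiplicative.toAdd (l (mk [t]))
  have h5 : ((2 * C + 1 : ℕ) • y).natAbs = (2 * C + 1) * y.natAbs := by
    rw [nsmul_eq_mul, Int.natAbs_mul]; rfl
  have h6 : 1 ≤ y.natAbs := Int.natAbs_pos.2 h4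
  have h7 : (2 * C + 1) * 1 ≤ (2 * C + 1) * y.natAbs := Nat.mul_le_mul_left _ h6
  omega

/-- Substituting a word `Q` with suitable ends for the generator `y` in a
reduced word in `x` and `y` gives a reduced word. -/
theorem exists_reduced_substitution [DecidableEq α] {x y r : α} (hrx : r ≠ x)
    {Q : List (α × Bool)} (hQ : IsReduced Q) (hQh : Q.head? = some (r, true))
    (hQl : Q.getLast? = some (r, true)) (f : FreeGroup α →* FreeGroup α) (hx : f (of x) = of x)
    (hy : f (of y) = mk Q) {g : FreeGroup α} (hg : g ∈ closure (of '' {x, y})) (hgx : ∃ t ∈ g.toWord, t.1 ≠ x) :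
    Q <:+: (f g).toWord ∨ invRev Q <:+: (f g).toWord := by
  have hxy : ∀ t ∈ g.toWord, t.1 = x ∨ t.1 = y := fun t ht => mem_closure_of_iff.1 hg t ht
  have hQi : (invRev Q).head? = some (r, false) := by
    rw [invRev_eq, List.head?_reverse, List.getLast?_map, hQl]; rfl
  have hQi' : (invRev Q).getLast? = some (r, false) := by
    rw [invRev_eq, List.getLast?_reverse, List.head?_map, hQh]; rfl
  let σ : α × Bool → List (α × Bool) := fun t =>
    if t.1 = x then [t] else if t.2 then Q else invRev Q
  have hσ (t) (ht : t.1 = x ∨ t.1 = y) : mk (σ t) = f (mk [t]) := by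
    by_cases h : t.1 = x
    · simp only [σ, h, if_true]
      obtain ⟨z, _ | _⟩ := t <;> obtain rfl : z = x := h
      · rw [mk_pair_false, _root_.map_inv, hx]
      · rw [mk_pair_true, hx]
    · have h' := ht.resolve_left h
      simp only [σ, h, if_false]
      obtain ⟨z, _ | _⟩ := t <;> obtain rfl : z = y := h'
      · rw [mk_pair_false, _root_.map_inv, hy, inv_mk]; rfl
      · rw [mk_pair_true, hy]; rfl
  have hσr (t) : IsReduced (σ t) := by
    unfold σ
    split_ifs
    · simp
    · exact hQ
    · rw [isReduced_iff_reduce_eq, reduce_invRev, hQ.reduce_eq]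
  have hhead (t) : (σ t).head? = some (if t.1 = x then t else (r, t.2)) := by
    unfold σ
    split_ifs with h1 h2
    · rfl
    · rw [hQh, h2]
    · rw [hQi]; simp only [Bool.not_eq_true] at h2; rw [h2]
  have hlast (t) : (σ t).getLast? = some (if t.1 = x then t else (r, t.2)) := by
    unfold σ
    split_ifs with h1 h2
    · rfl
    · rw [hQl, h2]
    · rw [hQi']; simp only [Bool.not_eq_true] at h2; rw [h2]
  have key (L : List (α × Bool)) (hL : IsReduced L) (hLxy : ∀ t ∈ L, t.1 = x ∨ t.1 = y) :
      IsReduced (L.flatMap σ) ∧ mk (L.flatMap σ) = f (mk L) ∧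
        ∀ t ∈ L.head?, (L.flatMap σ).head? = (σ t).head? := by
    induction L with
    | nil => exact ⟨by simp, by simp [← one_eq_mk], by simp⟩
    | cons t L ih =>
      obtain ⟨h1, h2, h3⟩ := ih (hL.infix (List.suffix_cons t L).isInfix)
        fun s hs => hLxy s (List.mem_cons_of_mem _ hs)
      have hne : σ t ≠ [] := by intro h; have := hhead t; simp [h] at this
      rw [List.flatMap_cons]
      refine ⟨isReduced_append_iff.2 ⟨hσr t, h1, fun a ha c hc => ?_⟩, ?_, ?_⟩
      · cases L with
        | nil => simp at hc
        | cons s L =>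
          rw [h3 s (by simp), hhead, Option.mem_def, Option.some.injEq] at hc
          rw [hlast, Option.mem_def, Option.some.injEq] at ha
          have hts : t ≠ letterInv s := by
            rw [isReduced_iff_isChain, List.isChain_cons_cons] at hL
            exact hL.1
          have ht := hLxy t (by simp)
          have hs := hLxy s (by simp)
          subst ha hc
          intro e
          split_ifs at e with e1 e2 e2
          · exact hts e
          · exact hrx ((congrArg Prod.fst e).symm.trans e1)
          · exact hrx ((congrArg Prod.fst e).trans e2)
          · apply hts
            have e3 := congrArg Prod.snd e
            exact Prod.ext ((ht.resolve_left e1).trans (hs.resolve_left e2).symm) e3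
      · have : mk (t :: L) = mk [t] * mk L := by rw [mul_mk]; rfl
        rw [this, _root_.map_mul, ← mul_mk, h2, hσ t (hLxy t List.mem_cons_self)]
      · intro s hs
        simp only [List.head?_cons, Option.mem_def, Option.some.injEq] at hs
        subst hs
        rw [List.head?_append_of_ne_nil _ hne]
  obtain ⟨h1, h2, -⟩ := key g.toWord isReduced_toWord hxy
  rw [mk_toWord] at h2
  rw [← h2, h1.toWord_mk]
  obtain ⟨t, ht, htx⟩ := hgx
  obtain ⟨p, q, hpq⟩ := List.append_of_mem ht
  rw [hpq, List.flatMap_append, List.flatMap_cons]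
  have : σ t <:+: p.flatMap σ ++ (σ t ++ q.flatMap σ) := ⟨p.flatMap σ, q.flatMap σ, by simp⟩
  obtain ⟨z, _ | _⟩ := t
  · right
    simpa only [σ, htx, if_false, Bool.false_eq_true] using this
  · left
    simpa only [σ, htx, if_false, if_true] using this

/-- A primitive element outside a proper factor `M` lies in a rank two factor meeting `M`
trivially. -/
theorem exists_line_disjoint_factor [Finite α] (hα : 3 ≤ Nat.card α) {M : Subgroup (FreeGroup α)}
    (hM : IsFactor M) {x : α} (hx : of x ∉ M) :
    ∃ (b : FreeGroupBasis α (FreeGroup α)) (y : α), x ≠ y ∧ b x = of x ∧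
      closure (b '' {x, y}) ⊓ M = ⊥ := by
  classical
  obtain ⟨b, S, rfl⟩ := hM.exists_basis (FreeGroupBasis.ofFreeGroup α)
  obtain ⟨i₀, hi₀⟩ : ∃ i, i ∉ S := by
    by_contra h
    push Not at h
    rw [(IsFactor.closure_image_eq_top_iff b).2 (Set.eq_univ_iff_forall.2 h)] at hx
    exact hx (mem_top _)
  -- The exponent sum of a basis element outside `S`: it vanishes on the factor but not on the whole
  -- group, so some standard generator `t` has nonzero value.
  let l : FreeGroup α →* Multiplicative ℤ :=
    b.lift fun i => if i = i₀ then Multiplicative.ofAdd 1 else 1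
  obtain ⟨C, hC⟩ := exists_bound_prefix b S l fun i hi => by
    have : i ≠ i₀ := by rintro rfl; exact hi₀ hi
    simp [l, this]
  obtain ⟨t, ht⟩ : ∃ t, l (of t) ≠ 1 := by
    by_contra h
    push Not at h
    have h1 : l = 1 := ext_hom _ _ fun t => by simpa using h t
    have h2 : l (b i₀) = Multiplicative.ofAdd 1 := by simp [l]
    rw [h1, MonoidHom.one_apply] at h2
    exact absurd h2 (by decide)
  obtain ⟨r, y, hrx, hyx, hry, hty⟩ : ∃ r y : α, r ≠ x ∧ y ≠ x ∧ r ≠ y ∧ t ≠ y := by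
    have : Fintype α := Fintype.ofFinite α
    have h3 : 2 < (Finset.univ : Finset α).card := by
      rw [Finset.card_univ, ← Nat.card_eq_fintype_card]; exact hα
    obtain ⟨y, hy1, hy2⟩ : ∃ y, y ≠ x ∧ y ≠ t := by
      by_contra hcon
      push Not at hcon
      have h5 : (Finset.univ : Finset α) ⊆ {x, t} := fun z _ => by
        by_cases hz : z = x
        · simp [hz]
        · simp [hcon z hz]
      have := (Finset.card_le_card h5).trans Finset.card_le_two
      omega
    obtain ⟨r, hr1, hr2⟩ : ∃ r, r ≠ x ∧ r ≠ y := by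
      by_contra hcon
      push Not at hcon
      have h5 : (Finset.univ : Finset α) ⊆ {x, y} := fun z _ => by
        by_cases hz : z = x
        · simp [hz]
        · simp [hcon z hz]
      have := (Finset.card_le_card h5).trans Finset.card_le_two
      omega
    exact ⟨r, y, hr1, hy1, hr2, hy2.symm⟩
  let k := 2 * C + 1
  -- The generator `y` is replaced by `r * t ^ k * y * r`, a positive word and so reduced. Its end
  -- letter `r ≠ x` prevents cancellation against `x`, so an element of the new line is a power of
  -- `x` or contains a power of `t` too long for the factor.
  let U : List (α × Bool) := (r, true) :: List.replicate k (t, true)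
  let Q : List (α × Bool) := U ++ [(y, true), (r, true)]
  have hU : ∀ s ∈ U, s.1 ≠ y := by
    intro s hs
    rcases List.mem_cons.1 hs with rfl | hs
    · exact hry
    · rw [List.eq_of_mem_replicate hs]; exact hty
  have hQ : IsReduced Q := by
    have hQt : ∀ s ∈ Q, s.2 = true := by
      intro s hs
      simp only [Q, U, List.cons_append, List.mem_cons, List.mem_append, List.mem_replicate,
        List.not_mem_nil, or_false] at hs
      rcases hs with rfl | ⟨-, rfl⟩ | rfl | rfl <;> rfl
    refine List.Pairwise.isChain (List.pairwise_of_forall_mem_list fun a ha b hb _ => ?_)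
    rw [hQt a ha, hQt b hb]
  obtain ⟨η, hη, hη'⟩ := exists_mulEquiv_letter (y, true) (u := mk U) (v := mk [(r, true)])
    (mk_mem_closure_of hU) (mk_mem_closure_of (by simpa using hry))
  have hηy : η (of y) = mk Q := by
    rw [← mk_pair_true, hη, mul_mk, mul_mk]; simp [Q]
  have hηx : η (of x) = of x := hη' x hyx.symm
  refine ⟨(FreeGroupBasis.ofFreeGroup α).map η, y, hyx.symm, by simpa using hηx, ?_⟩
  rw [eq_bot_iff]
  rintro g ⟨hg, hgM⟩
  have hcl : closure ((FreeGroupBasis.ofFreeGroup α).map η '' {x, y}) =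
      (closure (of '' {x, y})).map η.toMonoidHom := by
    rw [MonoidHom.map_closure, ← Set.image_comp]
    congr 1
  rw [hcl] at hg
  obtain ⟨g, hg, rfl⟩ := hg
  by_cases hgx : ∃ s ∈ g.toWord, s.1 ≠ x
  · exfalso
    have hrep (e : Bool) : List.replicate k (t, e) <:+: (η g).toWord → False := by
      refine replicate_not_infix hC ?_ hgM
      cases e
      · rw [mk_pair_false, _root_.map_inv, ne_eq, inv_eq_one]; exact ht
      · exact ht
    rcases exists_reduced_substitution hrx hQ (by simp [Q, U]) (by simp [Q])
      η.toMonoidHom hηx hηy hg hgx with h | h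
    · refine hrep true (List.IsInfix.trans ⟨[(r, true)], [(y, true), (r, true)], ?_⟩ h)
      simp [Q, U]
    · refine hrep false (List.IsInfix.trans ⟨[(r, false), (y, false)], [(r, false)], ?_⟩ h)
      simp [Q, U, invRev]
  · push Not at hgx
    have h1 : g ∈ closure {of x} := by
      have := mem_closure_of_iff (S := {x}).2 hgx
      rwa [Set.image_singleton] at this
    have h2 : (η g) = g := by
      have : closure {of x} ≤ η.toMonoidHom.eqLocus (MonoidHom.id _) := by
        rw [closure_le, Set.singleton_subset_iff]; exact hηx
      exact this h1
    rw [mem_bot]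
    change η g = 1
    change η g ∈ closure (b '' S) at hgM
    rw [h2] at hgM ⊢
    by_contra hg1
    exact hx (IsFactor.closure_singleton_le ⟨_, b, S, rfl⟩
      (isFactor_closure_singleton_letter (x, true)) h1 hgM hg1 (subset_closure rfl))

end FreeGroup

/-! ### Adapted bases and intersections of factors -/

namespace IsFactor

variable {G : Type} [Group G] {ι : Type}

/-- By `IsFactor.subgroupOf`, `A` is a factor of the subgroup spanned by `T`, so only the `T` part
of the basis has to change. -/
theorem exists_adapted (b : FreeGroupBasis ι G) (T : Set ι) {A : Subgroup G} (hA : IsFactor A)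
    (hAT : A ≤ closure (b '' T)) : ∃ b' : FreeGroupBasis ι G, (∀ i ∉ T, b' i = b i) ∧
      closure (b' '' T) = closure (b '' T) ∧ ∃ S ⊆ T, A = closure (b' '' S) := by
  obtain ⟨β, S, hS⟩ := (hA.subgroupOf (closure (b '' T))).exists_basis (b.restrict T)
  obtain ⟨b', h1, h2⟩ := b.exists_replace T β
  have him (S : Set T) : (closure (β '' S)).map (closure (b '' T)).subtype =
      closure (b' '' (Subtype.val '' S)) := by
    rw [MonoidHom.map_closure, ← Set.image_comp, ← Set.image_comp]
    congr 1
    exact Set.image_congr fun i _ => (h2 i).symm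
  refine ⟨b', h1, ?_, Subtype.val '' S, ?_, ?_⟩
  · have := him Set.univ
    rw [Set.image_univ, β.closure_range, ← MonoidHom.range_eq_map, range_subtype, Set.image_univ,
      Subtype.range_coe] at this
    exact this.symm
  · rintro _ ⟨i, -, rfl⟩
    exact i.2
  · rw [← him, ← hS, subgroupOf_map_subtype, inf_eq_left.2 hAT]

theorem exists_flag (c : FreeGroupBasis ι G) {A B : Subgroup G} (hA : IsFactor A)
    (hB : IsFactor B) (hAB : A ≤ B) : ∃ (b : FreeGroupBasis ι G) (S T : Set ι), S ⊆ T ∧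
      A = closure (b '' S) ∧ B = closure (b '' T) := by
  obtain ⟨b, T, rfl⟩ := hB.exists_basis c
  obtain ⟨b', -, h1, S, hS, h2⟩ := exists_adapted b T hA hAB
  exact ⟨b', S, T, hS, h2, h1.symm⟩

/-- The intersection is a factor of `B`, hence of the group. -/
theorem inf {A B : Subgroup G} (hA : IsFactor A) (hB : IsFactor B) : IsFactor (A ⊓ B) := by
  have := hB.trans (hA.subgroupOf B)
  rwa [subgroupOf_map_subtype] at this

theorem top (b : FreeGroupBasis ι G) : IsFactor (⊤ : Subgroup G) :=
  ⟨ι, b, Set.univ, by rw [Set.image_univ, b.closure_range]⟩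

theorem closure_image_le_iff (b : FreeGroupBasis ι G) {S T : Set ι} :
    closure (b '' S) ≤ closure (b '' T) ↔ S ⊆ T := by
  constructor
  · intro h i hi
    exact (mem_closure_image_iff b).1 (h (subset_closure ⟨i, hi, rfl⟩))
  · exact fun h => closure_mono (Set.image_mono h)

theorem mem_closure_iff_toWord [DecidableEq ι] (b : FreeGroupBasis ι G) {S : Set ι} {x : G} :
    x ∈ closure (b '' S) ↔ ∀ t ∈ (b.repr x).toWord, t.1 ∈ S := by
  rw [← FreeGroup.mem_closure_of_iff]
  have : (closure (b '' S)).map b.repr.toMonoidHom = closure (FreeGroup.of '' S) := by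
    rw [MonoidHom.map_closure, ← Set.image_comp]
    congr 1
    exact Set.image_congr fun i _ => b.repr_apply_coe i
  rw [← this]
  exact (mem_map_equiv.trans (by simp)).symm

end IsFactor

/-! ### Ranks, points, lines and hyperplanes -/

section Rank

variable {N : ℕ} {A B L M p q : Subgroup (FreeGroup (Fin N))}

theorem isFreeFactor_iff_isFactor : IsFreeFactor A ↔ IsFactor A :=
  ⟨fun ⟨b, S, h⟩ => ⟨_, b, S, h⟩, fun h => h.exists_basis (FreeGroupBasis.ofFreeGroup _)⟩

theorem IsFactor.exists_fin_basis (hA : IsFactor A) :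
    ∃ (b : FreeGroupBasis (Fin N) (FreeGroup (Fin N))) (S : Set (Fin N)), A = closure (b '' S) :=
  isFreeFactor_iff_isFactor.2 hA

theorem hasFreeRank_closure_iff (b : FreeGroupBasis (Fin N) (FreeGroup (Fin N)))
    {S : Set (Fin N)} {k : ℕ} : HasFreeRank (closure (b '' S)) k ↔ S.ncard = k := by
  rw [← Nat.card_coe_set_eq]
  constructor
  · rintro ⟨c⟩
    rw [Nat.card_congr ((b.restrict S).indexEquiv c), Nat.card_fin]
  · rintro rfl
    exact ⟨(b.restrict S).reindex (Finite.equivFin S)⟩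

theorem HasFreeRank.unique {k l : ℕ} (h : HasFreeRank A k) (h' : HasFreeRank A l) : k = l := by
  obtain ⟨b⟩ := h
  obtain ⟨c⟩ := h'
  simpa using Nat.card_congr (b.indexEquiv c)

theorem IsFactor.exists_rank (hA : IsFactor A) : ∃ k, HasFreeRank A k := by
  obtain ⟨b, S, rfl⟩ := hA.exists_fin_basis
  exact ⟨_, (hasFreeRank_closure_iff b).2 rfl⟩

theorem HasFreeRank.le {k l : ℕ} (hA : IsFactor A) (hB : IsFactor B) (hAB : A ≤ B)
    (h : HasFreeRank A k) (h' : HasFreeRank B l) : k ≤ l := by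
  obtain ⟨b, S, T, hST, rfl, rfl⟩ := hA.exists_flag (FreeGroupBasis.ofFreeGroup _) hB hAB
  rw [hasFreeRank_closure_iff] at h h'
  rw [← h, ← h']
  exact Set.ncard_le_ncard hST (Set.toFinite _)

theorem HasFreeRank.eq_of_le {k : ℕ} (hA : IsFactor A) (hB : IsFactor B) (hAB : A ≤ B)
    (h : HasFreeRank A k) (h' : HasFreeRank B k) : A = B := by
  obtain ⟨b, S, T, hST, rfl, rfl⟩ := hA.exists_flag (FreeGroupBasis.ofFreeGroup _) hB hAB
  rw [hasFreeRank_closure_iff] at h h'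
  rw [Set.eq_of_subset_of_ncard_le hST (by rw [h, h']) (Set.toFinite _)]

theorem HasFreeRank.lt {k l : ℕ} (hA : IsFactor A) (hB : IsFactor B) (hAB : A < B)
    (h : HasFreeRank A k) (h' : HasFreeRank B l) : k < l := by
  refine lt_of_le_of_ne (h.le hA hB hAB.le h') ?_
  rintro rfl
  exact hAB.ne (h.eq_of_le hA hB hAB.le h')

theorem hasFreeRank_top : HasFreeRank (⊤ : Subgroup (FreeGroup (Fin N))) N :=
  ⟨(FreeGroupBasis.ofFreeGroup _).map Subgroup.topEquiv.symm⟩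

theorem hasFreeRank_zero_iff : HasFreeRank A 0 ↔ A = ⊥ := by
  constructor
  · rintro ⟨b⟩
    have := b.closure_range
    rw [Set.range_eq_empty, Subgroup.closure_empty] at this
    rw [eq_bot_iff]
    intro x hx
    have h : (⟨x, hx⟩ : A) ∈ (⊥ : Subgroup A) := this ▸ mem_top _
    rw [mem_bot] at h ⊢
    exact congrArg Subtype.val h
  · rintro rfl
    have : (⊥ : Subgroup (FreeGroup (Fin N))) =
        closure ((FreeGroupBasis.ofFreeGroup (Fin N)) '' ∅) := by
      rw [Set.image_empty, Subgroup.closure_empty]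
    rw [this, hasFreeRank_closure_iff, Set.ncard_empty]

/-- Free factors of rank one. -/
def IsPoint (A : Subgroup (FreeGroup (Fin N))) : Prop := IsFactor A ∧ HasFreeRank A 1

/-- Free factors of rank two. -/
def IsLine (A : Subgroup (FreeGroup (Fin N))) : Prop := IsFactor A ∧ HasFreeRank A 2

theorem isPoint_closure_basis (b : FreeGroupBasis (Fin N) (FreeGroup (Fin N))) (i : Fin N) :
    IsPoint (closure {b i}) := by
  rw [← Set.image_singleton]
  exact ⟨⟨_, b, _, rfl⟩, (hasFreeRank_closure_iff b).2 (Set.ncard_singleton i)⟩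

theorem isLine_closure_pair (b : FreeGroupBasis (Fin N) (FreeGroup (Fin N))) {i j : Fin N}
    (hij : i ≠ j) : IsLine (closure (b '' {i, j})) :=
  ⟨⟨_, b, _, rfl⟩, (hasFreeRank_closure_iff b).2 (Set.ncard_pair hij)⟩

theorem IsPoint.exists_basis (hp : IsPoint p) :
    ∃ (b : FreeGroupBasis (Fin N) (FreeGroup (Fin N))) (i : Fin N), p = closure {b i} := by
  obtain ⟨b, S, rfl⟩ := hp.1.exists_fin_basis
  obtain ⟨i, rfl⟩ := Set.ncard_eq_one.1 ((hasFreeRank_closure_iff b).1 hp.2)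
  exact ⟨b, i, by rw [Set.image_singleton]⟩

theorem isPoint_closure_singleton {w : FreeGroup (Fin N)} (hw : w ≠ 1)
    (h : IsFactor (closure {w})) : IsPoint (closure {w}) := by
  obtain ⟨b, i, rfl⟩ := h.exists_basis_apply hw (FreeGroupBasis.ofFreeGroup _)
  exact isPoint_closure_basis b i

theorem IsPoint.exists_generator (hp : IsPoint p) :
    ∃ w : FreeGroup (Fin N), w ≠ 1 ∧ p = closure {w} := by
  obtain ⟨b, i, rfl⟩ := hp.exists_basis
  refine ⟨b i, fun h => ?_, rfl⟩
  have := b.repr_apply_coe i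
  rw [h, map_one] at this
  exact FreeGroup.of_ne_one i this.symm

/-- Each member of a basis of `A` generates a point, so a factor is determined by its points. -/
theorem IsFactor.le_of_points (hA : IsFactor A) {B : Subgroup (FreeGroup (Fin N))}
    (h : ∀ p, IsPoint p → p ≤ A → p ≤ B) : A ≤ B := by
  obtain ⟨b, S, rfl⟩ := hA.exists_fin_basis
  rw [closure_le]
  rintro _ ⟨i, hi, rfl⟩
  have hmem : b i ∈ closure (b '' S) := subset_closure ⟨i, hi, rfl⟩
  exact h _ (isPoint_closure_basis b i) (by
    rw [closure_le, Set.singleton_subset_iff]; exact hmem) (subset_closure rfl)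

theorem IsPoint.eq_of_le (hp : IsPoint p) (hq : IsPoint q) (h : p ≤ q) : p = q :=
  hp.2.eq_of_le hp.1 hq.1 h hq.2

theorem IsFactor.exists_point_le (hA : IsFactor A) (h : A ≠ ⊥) : ∃ p, IsPoint p ∧ p ≤ A := by
  by_contra hcon
  push Not at hcon
  exact h (eq_bot_iff.2 (hA.le_of_points fun p hp hpA => absurd hpA (hcon p hp)))

theorem IsFactor.exists_point_not_le (hA : IsFactor A) {B : Subgroup (FreeGroup (Fin N))}
    (h : ¬ A ≤ B) : ∃ p, IsPoint p ∧ p ≤ A ∧ ¬ p ≤ B := by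
  by_contra hcon
  push Not at hcon
  exact h (hA.le_of_points hcon)

/-- A line meeting a factor in two points is contained in it. -/
theorem IsLine.le_of_points (hL : IsLine L) (hM : IsFactor M) (hp : IsPoint p) (hq : IsPoint q)
    (hpq : p ≠ q) (hpL : p ≤ L) (hqL : q ≤ L) (hpM : p ≤ M) (hqM : q ≤ M) : L ≤ M := by
  have hf := hL.1.inf hM
  obtain ⟨k, hk⟩ := hf.exists_rank
  have h1 := hp.2.le hp.1 hf (le_inf hpL hpM) hk
  have h2 := hk.le hf hL.1 inf_le_left hL.2
  have h3 : k ≠ 1 := by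
    rintro rfl
    exact hpq ((hp.eq_of_le ⟨hf, hk⟩ (le_inf hpL hpM)).trans
      (hq.eq_of_le ⟨hf, hk⟩ (le_inf hqL hqM)).symm)
  have h4 : k = 2 := by omega
  subst h4
  have := hk.eq_of_le hf hL.1 inf_le_left hL.2
  rw [← this]; exact inf_le_right

/-- A basis adapted to `p` can be chosen without disturbing `b c`. -/
theorem exists_line_of_le_closure (b : FreeGroupBasis (Fin N) (FreeGroup (Fin N)))
    {T : Set (Fin N)} {c : Fin N} (hc : c ∉ T) (hp : IsPoint p) (hpT : p ≤ closure (b '' T)) :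
    ∃ n, IsLine n ∧ p ≤ n ∧ closure {b c} ≤ n := by
  obtain ⟨b', h1, -, S, hS, rfl⟩ := hp.1.exists_adapted b T hpT
  obtain ⟨i, rfl⟩ := Set.ncard_eq_one.1 ((hasFreeRank_closure_iff b').1 hp.2)
  have hic : i ≠ c := by rintro rfl; exact hc (hS rfl)
  refine ⟨_, isLine_closure_pair b' hic, closure_mono (Set.image_mono (by simp)), ?_⟩
  rw [← h1 c hc, ← Set.image_singleton]
  exact closure_mono (Set.image_mono (by simp))

/-- This line witnesses that `M` is not a partner of `p`: it has no proper nontrivial subfactor in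
common with `M`. -/
theorem exists_line_inf_eq_bot (hN : 3 ≤ N) (hM : IsFactor M) (hp : IsPoint p) (hpM : ¬ p ≤ M) :
    ∃ n, IsLine n ∧ p ≤ n ∧ n ⊓ M = ⊥ := by
  obtain ⟨b, i, rfl⟩ := hp.exists_basis
  let e := b.repr
  have he (x) : e.symm x ∈ M ↔ x ∈ M.map e.toMonoidHom := mem_map_equiv.symm
  have hei : e.symm (FreeGroup.of i) = b i := rfl
  obtain ⟨b', y, h1, h2, h3⟩ := FreeGroup.exists_line_disjoint_factor (by simpa using hN)
    (hM.map_equiv e) (x := i) (fun h => hpM (by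
      rw [← he, hei] at h
      rwa [closure_le, Set.singleton_subset_iff]))
  have hb'i : b'.map e.symm i = b i := by rw [FreeGroupBasis.map_apply, h2, hei]
  refine ⟨_, isLine_closure_pair (b'.map e.symm) h1, ?_, ?_⟩
  · rw [← hb'i, ← Set.image_singleton]
    exact closure_mono (Set.image_mono (by simp))
  · have hcl : closure (b'.map e.symm '' {i, y}) =
        (closure (b' '' {i, y})).map e.symm.toMonoidHom := by
      rw [MonoidHom.map_closure, ← Set.image_comp]; rfl
    rw [eq_bot_iff, hcl]
    rintro _ ⟨⟨x, hx, rfl⟩, hxM⟩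
    have : x ∈ closure (b' '' {i, y}) ⊓ M.map e.toMonoidHom := ⟨hx, (he x).1 hxM⟩
    rw [h3, mem_bot] at this
    rw [mem_bot, this, map_one]

/-- In a basis adapted to `p`, the coordinate hyperplanes through `p` intersect exactly in `p`. -/
theorem exists_hyperplane (hp : IsPoint p) (hpA : ¬ A ≤ p) :
    ∃ H, IsFactor H ∧ HasFreeRank H (N - 1) ∧ p ≤ H ∧ ¬ A ≤ H := by
  obtain ⟨b, i, rfl⟩ := hp.exists_basis
  by_contra hcon
  push Not at hcon
  apply hpA
  intro x hx
  rw [← Set.image_singleton, IsFactor.mem_closure_iff_toWord]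
  intro t ht
  by_contra hti
  have := hcon (closure (b '' {t.1}ᶜ)) ⟨_, b, _, rfl⟩ ((hasFreeRank_closure_iff b).2 (by
    rw [Set.ncard_compl, Set.ncard_singleton, Nat.card_fin])) (by
    rw [← Set.image_singleton]
    exact closure_mono (Set.image_mono (by
      rw [Set.singleton_subset_iff]
      exact fun h => hti h.symm)))
  exact (IsFactor.mem_closure_iff_toWord b).1 (this hx) t ht rfl

end Rank

/-! ### Collineations carry factors to factors -/

section Collineation

variable {N : ℕ} {A B L M p q : Subgroup (FreeGroup (Fin N))}

/-- If `z` is collinear with all points of the factor `B`, then a basis of `B` and a generator of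
`z` are part of a basis of the whole group. -/
theorem exists_basis_of_collinear {k : ℕ} (hB : IsFactor B) (hBk : HasFreeRank B k) (hk : 2 ≤ k)
    {z : Subgroup (FreeGroup (Fin N))} (hz : IsPoint z) (hzB : ¬ z ≤ B)
    (hlines : ∀ x, IsPoint x → x ≤ B → ∃ n, IsLine n ∧ x ≤ n ∧ z ≤ n) :
    ∃ (b : FreeGroupBasis (Fin N) (FreeGroup (Fin N))) (S : Set (Fin N)) (c : Fin N),
      c ∉ S ∧ B = closure (b '' S) ∧ z = closure {b c} := by
  classical
  -- Work inside a factor `D` of least rank containing `B` and `z`, so that no proper factor of `D`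
  -- contains both.
  have hex : ∃ m D, IsFactor D ∧ HasFreeRank D m ∧ B ≤ D ∧ z ≤ D :=
    ⟨N, ⊤, .top (FreeGroupBasis.ofFreeGroup _), hasFreeRank_top, le_top, le_top⟩
  obtain ⟨D, hD, hDm, hBD, hzD⟩ := Nat.find_spec hex
  have hmin {P} (hP : IsFactor P) (hBP : B ≤ P) (hzP : z ≤ P) (hPD : P ≤ D) : P = D := by
    obtain ⟨m, hm⟩ := hP.exists_rank
    have h1 := Nat.find_min' hex ⟨P, hP, hm, hBP, hzP⟩
    have h2 := le_antisymm (hm.le hP hD hPD hDm) h1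
    exact hm.eq_of_le hP hD hPD (h2 ▸ hDm)
  obtain ⟨w, hw1, rfl⟩ := hz.exists_generator
  have hwD : w ∈ D := hzD (subset_closure rfl)
  obtain ⟨b₁, T, rfl⟩ := hD.exists_fin_basis
  set D := closure (b₁ '' T) with hDdef
  obtain ⟨b₀, S₀, hS₀⟩ := (hB.subgroupOf D).exists_basis (b₁.restrict T)
  have hmapB : (B.subgroupOf D).map D.subtype = B := by
    rw [subgroupOf_map_subtype, inf_eq_left.2 hBD]
  have hval (b : FreeGroupBasis T D) : ∃ b' : FreeGroupBasis (Fin N) (FreeGroup (Fin N)),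
      (∀ i : T, b' i = b i) ∧ ∀ S : Set T,
        (closure (b '' S)).map D.subtype = closure (b' '' (Subtype.val '' S)) := by
    obtain ⟨b', -, h2⟩ := b₁.exists_replace T b
    refine ⟨b', h2, fun S => ?_⟩
    rw [MonoidHom.map_closure, ← Set.image_comp, ← Set.image_comp]
    congr 1
    exact Set.image_congr fun i _ => (h2 i).symm
  have hS₀n : S₀.Nontrivial := by
    obtain ⟨b', -, h2⟩ := hval b₀
    have h3 := h2 S₀
    rw [← hS₀, hmapB] at h3
    rw [h3, hasFreeRank_closure_iff, Set.ncard_image_of_injective _ Subtype.val_injective] at hBk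
    rw [← Set.one_lt_ncard_iff_nontrivial]
    omega
  have hsing {x} (hx : x ∈ D) : IsFactor (closure {(⟨x, hx⟩ : D)}) ↔ IsFactor (closure {x}) :=
    hD.singleton_subgroup_iff
  have hz' : closure {(⟨w, hwD⟩ : D)} ≠ ⊤ := by
    intro h
    have h1 := congrArg (Subgroup.map D.subtype) h
    rw [MonoidHom.map_closure, Set.image_singleton, ← MonoidHom.range_eq_map, range_subtype] at h1
    change closure {w} = D at h1
    have := hBk.le hB hz.1 (hBD.trans h1.ge) hz.2
    omega
  obtain ⟨b₂, c, h1, h2, h3⟩ := IsFactor.exists_basis_of_primitive_mem b₀ hS₀n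
    (z := ⟨w, hwD⟩) (by
      rw [← hS₀]
      intro h
      exact hzB (by rw [closure_le, Set.singleton_subset_iff]; exact h)) ((hsing hwD).2 hz.1)
    (fun x hx hxf => by
      rw [← hS₀] at hx
      by_cases hx1 : x = 1
      · subst hx1
        exact ⟨_, (hsing hwD).2 hz.1, hz', one_mem _, subset_closure rfl⟩
      · have hxB : closure {(x : FreeGroup (Fin N))} ≤ B := by
          rw [closure_le, Set.singleton_subset_iff]; exact hx
        obtain ⟨n, hn, hxn, hzn⟩ := hlines (closure {(x : FreeGroup (Fin N))})
          (isPoint_closure_singleton (by simpa using hx1) ((hsing x.2).1 hxf)) hxB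
        -- The trace of the line on `D` is proper: otherwise `B ≤ D ≤ n` and `k ≥ 2` give `B = n`,
        -- which contains `z`.
        refine ⟨n.subgroupOf D, hn.1.subgroupOf D, fun h => ?_, hxn (subset_closure rfl),
          hzn (subset_closure rfl)⟩
        rw [subgroupOf_eq_top] at h
        have h4 := hBk.le hB hn.1 (hBD.trans h) hn.2
        obtain rfl : k = 2 := by omega
        have h5 := hBk.eq_of_le hB hn.1 (hBD.trans h) hn.2
        exact hzB (h5 ▸ hzn))
    (fun P hP hBP hzP => by
      have h4 := hmin (hD.trans hP) (by
          rw [← hmapB]; exact map_mono (hS₀ ▸ hBP)) (by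
          rw [closure_le, Set.singleton_subset_iff]
          exact ⟨_, hzP, rfl⟩) (map_subtype_le P)
      rw [eq_top_iff]
      intro y _
      have : (y : FreeGroup (Fin N)) ∈ P.map D.subtype := by rw [h4]; exact y.2
      obtain ⟨y', hy', e⟩ := this
      rwa [← Subtype.ext (a1 := y') (a2 := y) e])
  obtain ⟨b', h4, h5⟩ := hval b₂
  refine ⟨b', Subtype.val '' S₀, c, ?_, ?_, ?_⟩
  · rintro ⟨c', hc', e⟩
    rw [Subtype.ext (a1 := c') (a2 := c) e] at hc'
    exact (h1.ge (Set.mem_singleton c)) hc'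
  · rw [← h5, h2, ← hS₀, hmapB]
  · have := congrArg (Subgroup.map D.subtype) h3
    rw [MonoidHom.map_closure, MonoidHom.map_closure, Set.image_singleton,
      Set.image_singleton] at this
    rw [h4]
    exact this.symm

/-- Mutually inverse incidence preserving bijections of points and lines. -/
structure IsCollineation (f g : Subgroup (FreeGroup (Fin N)) → Subgroup (FreeGroup (Fin N))) :
    Prop where
  point : ∀ {p}, IsPoint p → IsPoint (f p)
  line : ∀ {L}, IsLine L → IsLine (f L)
  point_inv : ∀ {p}, IsPoint p → IsPoint (g p)
  line_inv : ∀ {L}, IsLine L → IsLine (g L)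
  left_point : ∀ {p}, IsPoint p → g (f p) = p
  right_point : ∀ {p}, IsPoint p → f (g p) = p
  left_line : ∀ {L}, IsLine L → g (f L) = L
  right_line : ∀ {L}, IsLine L → f (g L) = L
  le_iff : ∀ {p L}, IsPoint p → IsLine L → (f p ≤ f L ↔ p ≤ L)

namespace IsCollineation

variable {f g : Subgroup (FreeGroup (Fin N)) → Subgroup (FreeGroup (Fin N))}

theorem symm (h : IsCollineation f g) : IsCollineation g f where
  point := h.point_inv
  line := h.line_inv
  point_inv := h.point
  line_inv := h.line
  left_point := h.right_point
  right_point := h.left_point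
  left_line := h.right_line
  right_line := h.left_line
  le_iff hp hL := by
    rw [← h.le_iff (h.point_inv hp) (h.line_inv hL), h.right_point hp, h.right_line hL]

theorem eq_of_eq (h : IsCollineation f g) (hp : IsPoint p) (hq : IsPoint q) (e : f p = f q) :
    p = q := by rw [← h.left_point hp, ← h.left_point hq, e]

/-- If the images of the points of a basis of `D` lie in a factor, then so do the images of
all points of `D`. -/
theorem le_of_basis (h : IsCollineation f g) {D : Subgroup (FreeGroup (Fin N))} (hD : IsFactor D)
    {κ : Type} [Finite κ] (β : FreeGroupBasis κ D) (hA : IsFactor A)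
    (hβ : ∀ i, f (closure {(β i : FreeGroup (Fin N))}) ≤ A) (hp : IsPoint p) (hpD : p ≤ D) :
    f p ≤ A := by
  have hext (β' : FreeGroupBasis κ D) : ∃ (b : FreeGroupBasis (Fin N) (FreeGroup (Fin N)))
      (e : κ → Fin N), Function.Injective e ∧ ∀ k, b (e k) = β' k := by
    obtain ⟨b₀, T, rfl⟩ := hD.exists_fin_basis
    obtain ⟨b, e, -, hb⟩ := IsFactor.exists_extend b₀ T β'
    exact ⟨b, fun k => e k, Subtype.val_injective.comp e.injective, hb⟩
  obtain ⟨ε, hε⟩ : ∃ ε : FreeGroup κ ≃* D, ∀ i, ε (FreeGroup.of i) = β i :=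
    ⟨β.repr.symm, fun _ => rfl⟩
  obtain ⟨w, hw1, rfl⟩ := hp.exists_generator
  have hwD : w ∈ D := hpD (subset_closure rfl)
  have hfac (v : FreeGroup κ) : IsFactor (closure {v}) ↔
      IsFactor (closure {(ε v : FreeGroup (Fin N))}) := by
    rw [← hD.singleton_subgroup_iff]
    constructor
    · intro h
      have := h.map_equiv ε
      rwa [MonoidHom.map_closure, Set.image_singleton] at this
    · intro h
      have := h.map_equiv ε.symm
      rw [MonoidHom.map_closure, Set.image_singleton] at this
      simpa using this
  -- The property of having image inside `A` is closed under lines: the image line contains two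
  -- distinct points of `A`, so it lies in `A`.
  have key := FreeGroup.primitive_mem_of_lineClosed
    (fun v : FreeGroup κ => f (closure {(ε v : FreeGroup (Fin N))}) ≤ A)
    (fun i => by rw [hε]; exact hβ i)
    (fun b i j hi hj v hv hv1 hvf => by
      obtain ⟨b', e, he, hb'⟩ := hext (b.map ε)
      have hi' : (ε (b i) : FreeGroup (Fin N)) = b' (e i) := by
        rw [hb', FreeGroupBasis.map_apply]
      have hj' : (ε (b j) : FreeGroup (Fin N)) = b' (e j) := by
        rw [hb', FreeGroupBasis.map_apply]
      rw [hi'] at hi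
      rw [hj'] at hj
      have hvp : IsPoint (closure {(ε v : FreeGroup (Fin N))}) :=
        isPoint_closure_singleton (by simpa using hv1) ((hfac v).1 hvf)
      have hv' : (ε v : FreeGroup (Fin N)) ∈ closure {b' (e i), b' (e j)} := by
        have := mem_map_of_mem (D.subtype.comp ε.toMonoidHom) hv
        rw [MonoidHom.map_closure, Set.image_pair] at this
        rw [← hi', ← hj']
        exact this
      by_cases hij : i = j
      · subst hij
        rw [Set.pair_eq_singleton] at hv'
        have := hvp.eq_of_le (isPoint_closure_basis b' (e i))
          (by rwa [closure_le, Set.singleton_subset_iff])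
        change f _ ≤ A
        rwa [this]
      · have hn := isLine_closure_pair b' (he.ne hij)
        have hpt (i) := isPoint_closure_basis b' i
        have hle {m} (hm : m ∈ ({e i, e j} : Set (Fin N))) :
            closure {b' m} ≤ closure (b' '' {e i, e j}) := by
          rw [← Set.image_singleton]
          exact closure_mono (Set.image_mono (by simpa using hm))
        have hne : f (closure {b' (e i)}) ≠ f (closure {b' (e j)}) := fun e' => by
          have h1 := h.eq_of_eq (hpt _) (hpt _) e'
          have h2 : b' (e i) ∈ closure (b' '' {e j}) := by
            rw [Set.image_singleton, ← h1]
            exact subset_closure (Set.mem_singleton _)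
          exact he.ne hij (Set.mem_singleton_iff.1 ((IsFactor.mem_closure_image_iff b').1 h2))
        have h1 := (h.line hn).le_of_points hA (h.point (hpt _)) (h.point (hpt _)) hne
          ((h.le_iff (hpt _) hn).2 (hle (by simp))) ((h.le_iff (hpt _) hn).2 (hle (by simp))) hi hj
        have hvn : closure {(ε v : FreeGroup (Fin N))} ≤ closure (b' '' {e i, e j}) := by
          rw [closure_le, Set.singleton_subset_iff, Set.image_pair, SetLike.mem_coe]
          exact hv'
        exact le_trans ((h.le_iff hvp hn).2 hvn) h1)
    (w := ε.symm ⟨w, hwD⟩) (by simpa using hw1) (by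
      rw [hfac, MulEquiv.apply_symm_apply]; exact hp.1)
  rwa [MulEquiv.apply_symm_apply] at key

/-- The image of the set of points of a factor is the set of points of a factor. -/
theorem exists_image (h : IsCollineation f g) {k : ℕ} (hk : 2 ≤ k) (hA : IsFactor A)
    (hAk : HasFreeRank A k) : ∃ A', IsFactor A' ∧ HasFreeRank A' k ∧
      ∀ p, IsPoint p → (f p ≤ A' ↔ p ≤ A) := by
  induction k, hk using Nat.le_induction generalizing A with
  | base =>
    have hL := h.line ⟨hA, hAk⟩
    exact ⟨f A, hL.1, hL.2, fun p hp => h.le_iff hp ⟨hA, hAk⟩⟩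
  | succ k hk ih =>
    obtain ⟨b, T, rfl⟩ := hA.exists_fin_basis
    rw [hasFreeRank_closure_iff] at hAk
    obtain ⟨c, hc⟩ : T.Nonempty := (Set.ncard_pos (Set.toFinite T)).1 (by omega)
    have hT₀ : (T \ {c}).ncard = k := by
      rw [Set.ncard_sdiff_singleton_of_mem hc, hAk]; rfl
    have hz := isPoint_closure_basis b c
    have hB : IsFactor (closure (b '' (T \ {c}))) := ⟨_, b, _, rfl⟩
    obtain ⟨B', hB', hBk, hBp⟩ := ih hB ((hasFreeRank_closure_iff b).2 hT₀)
    have hzB : ¬ f (closure {b c}) ≤ B' := by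
      rw [hBp _ hz, ← Set.image_singleton, IsFactor.closure_image_le_iff]
      simp
    -- Pull a point of `B'` back to `B`, join it to `b c` by a line, and push that line forward.
    obtain ⟨b', S, c', hc', rfl, hz'⟩ := exists_basis_of_collinear hB' hBk hk (h.point hz) hzB
      (fun x hx hxB => by
        have hgx := h.point_inv hx
        have e := h.right_point hx
        obtain ⟨n, hn, h1, h2⟩ := exists_line_of_le_closure b (T := T \ {c}) (c := c) (by simp) hgx
          ((hBp _ hgx).1 (by rwa [e]))
        refine ⟨f n, h.line hn, ?_, (h.le_iff hz hn).2 h2⟩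
        rw [← e]
        exact (h.le_iff hgx hn).2 h1)
    have hA' : IsFactor (closure (b' '' insert c' S)) := ⟨_, b', _, rfl⟩
    have hle (b : FreeGroupBasis (Fin N) (FreeGroup (Fin N))) {i : Fin N} {S : Set (Fin N)}
        (hi : i ∈ S) : closure {b i} ≤ closure (b '' S) := by
      rw [← Set.image_singleton]
      exact closure_mono (Set.image_mono (by simpa using hi))
    refine ⟨_, hA', ?_, fun p hp => ⟨fun hpA => ?_, fun hpA => ?_⟩⟩
    · rw [hasFreeRank_closure_iff] at hBk ⊢
      rw [Set.ncard_insert_of_notMem hc' (Set.toFinite _), hBk]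
    · rw [← h.left_point hp]
      -- Both inclusions are checked on a basis: that of `A'` under `g` here, that of `A` under `f`
      -- below.
      refine h.symm.le_of_basis hA' (b'.restrict _) hA (fun i => ?_) (h.point hp) hpA
      rw [FreeGroupBasis.restrict_coe]
      rcases i.2 with hi | hi
      · rw [hi, ← hz', h.left_point hz]
        exact hle b hc
      · have hq := isPoint_closure_basis b' i
        have := (hBp _ (h.point_inv hq)).1 (by rw [h.right_point hq]; exact hle b' hi)
        exact this.trans (closure_mono (Set.image_mono Set.sdiff_subset))
    · refine h.le_of_basis hA (b.restrict T) hA' (fun i => ?_) hp hpA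
      rw [FreeGroupBasis.restrict_coe]
      by_cases hi : (i : Fin N) = c
      · rw [hi, hz']
        exact hle b' (Set.mem_insert _ _)
      · exact ((hBp _ (isPoint_closure_basis b i)).2 (hle b ⟨i.2, hi⟩)).trans
          (closure_mono (Set.image_mono (Set.subset_insert _ _)))

end IsCollineation

end Collineation

/-! ### Graph properties invariant under automorphisms -/

section Graph

variable {V : Type} (Γ : SimpleGraph V)

/-- The link of `v` is the join of two nonempty sets of vertices. -/
def IsJoinLink (v : V) : Prop :=
  ∃ X Y : Set V, X.Nonempty ∧ Y.Nonempty ∧ (∀ n, Γ.Adj v n ↔ n ∈ X ∨ n ∈ Y) ∧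
    ∀ x ∈ X, ∀ y ∈ Y, Γ.Adj x y

/-- There is a vertex with property `P`, not adjacent to `v`, having a common neighbour with each
neighbour of `v`. -/
def HasPartner (P : V → Prop) (v : V) : Prop :=
  ∃ w, P w ∧ w ≠ v ∧ ¬ Γ.Adj v w ∧ ∀ n, Γ.Adj v n → ∃ m, Γ.Adj n m ∧ Γ.Adj m w

/-- The graph property singling out rank one factors in the free factor graph. -/
def IsPointVertex (v : V) : Prop :=
  ¬ IsJoinLink Γ v ∧ ¬ HasPartner Γ (fun w => ¬ IsJoinLink Γ w) v

/-- The graph property singling out rank two factors in the free factor graph. -/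
def IsLineVertex (v : V) : Prop :=
  ¬ IsPointVertex Γ v ∧ ∀ n, Γ.Adj v n → ¬ IsPointVertex Γ n →
    ∀ p, IsPointVertex Γ p → Γ.Adj p v → Γ.Adj p n

variable {Γ}

theorem IsJoinLink.map {v : V} (h : IsJoinLink Γ v) (e : Γ ≃g Γ) : IsJoinLink Γ (e v) := by
  obtain ⟨X, Y, hX, hY, h1, h2⟩ := h
  refine ⟨e '' X, e '' Y, hX.image e, hY.image e, fun n => ?_, ?_⟩
  · obtain ⟨n, rfl⟩ := e.surjective n
    rw [e.map_adj_iff, h1, e.injective.mem_set_image, e.injective.mem_set_image]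
  · rintro _ ⟨x, hx, rfl⟩ _ ⟨y, hy, rfl⟩
    rw [e.map_adj_iff]
    exact h2 x hx y hy

theorem isJoinLink_map_iff (e : Γ ≃g Γ) {v : V} : IsJoinLink Γ (e v) ↔ IsJoinLink Γ v :=
  ⟨fun h => by simpa using h.map e.symm, fun h => h.map e⟩

theorem HasPartner.map {P : V → Prop} {v : V} (e : Γ ≃g Γ) (hP : ∀ v, P v → P (e v))
    (h : HasPartner Γ P v) : HasPartner Γ P (e v) := by
  obtain ⟨w, h1, h2, h3, h4⟩ := h
  refine ⟨e w, hP w h1, e.injective.ne h2, by rwa [e.map_adj_iff], fun n hn => ?_⟩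
  obtain ⟨n, rfl⟩ := e.surjective n
  rw [e.map_adj_iff] at hn
  obtain ⟨m, h5, h6⟩ := h4 n hn
  exact ⟨e m, e.map_adj_iff.2 h5, e.map_adj_iff.2 h6⟩

theorem hasPartner_map_iff {P : V → Prop} {v : V} (e : Γ ≃g Γ) (hP : ∀ v, P (e v) ↔ P v) :
    HasPartner Γ P (e v) ↔ HasPartner Γ P v :=
  ⟨fun h => by
    simpa using h.map e.symm fun v hv => (hP _).1 (by simpa using hv),
    fun h => h.map e fun v hv => (hP v).2 hv⟩

theorem isPointVertex_map_iff (e : Γ ≃g Γ) {v : V} :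
    IsPointVertex Γ (e v) ↔ IsPointVertex Γ v := by
  unfold IsPointVertex
  rw [isJoinLink_map_iff, hasPartner_map_iff e fun v => by rw [isJoinLink_map_iff]]

theorem isLineVertex_map_iff (e : Γ ≃g Γ) {v : V} :
    IsLineVertex Γ (e v) ↔ IsLineVertex Γ v := by
  refine and_congr (not_congr (isPointVertex_map_iff e)) ?_
  rw [e.surjective.forall]
  refine forall_congr' fun n => ?_
  rw [e.map_adj_iff, isPointVertex_map_iff, e.surjective.forall]
  refine imp_congr Iff.rfl (imp_congr Iff.rfl (forall_congr' fun p => ?_))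
  rw [e.map_adj_iff, isPointVertex_map_iff, e.map_adj_iff]

end Graph

/-! ### Recognising ranks one and two in the free factor graph -/

section FreeFactorGraph

variable {N : ℕ}

/-- The vertex given by a factor of rank strictly between `0` and `N`. -/
def FreeFactorVertex.ofRank {A : Subgroup (FreeGroup (Fin N))} {k : ℕ} (hA : IsFactor A)
    (hk : HasFreeRank A k) (h0 : 0 < k) (hkN : k < N) : FreeFactorVertex N :=
  ⟨A, isFreeFactor_iff_isFactor.2 hA, by
    rintro rfl
    exact h0.ne (hk.unique (hasFreeRank_zero_iff.2 rfl)).symm, by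
    rintro rfl
    exact hkN.ne (hk.unique hasFreeRank_top)⟩

namespace FreeFactorVertex

theorem isFactor (v : FreeFactorVertex N) : IsFactor v.1 := isFreeFactor_iff_isFactor.1 v.2.1

theorem exists_rank (v : FreeFactorVertex N) : ∃ k, HasFreeRank v.1 k ∧ 0 < k ∧ k < N := by
  obtain ⟨k, hk⟩ := v.isFactor.exists_rank
  have h := hk.le v.isFactor (.top (FreeGroupBasis.ofFreeGroup _)) le_top hasFreeRank_top
  refine ⟨k, hk, Nat.pos_of_ne_zero ?_, lt_of_le_of_ne h ?_⟩
  · rintro rfl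
    exact v.2.2.1 (hasFreeRank_zero_iff.1 hk)
  · rintro rfl
    exact v.2.2.2 (hk.eq_of_le v.isFactor (.top (FreeGroupBasis.ofFreeGroup _)) le_top
      hasFreeRank_top)

theorem rank_lt {v w : FreeFactorVertex N} (h : v.1 < w.1) {k l : ℕ} (hv : HasFreeRank v.1 k)
    (hw : HasFreeRank w.1 l) : k < l := hv.lt v.isFactor w.isFactor h hw

theorem not_lt_point {v w : FreeFactorVertex N} (hw : HasFreeRank w.1 1) : ¬ v.1 < w.1 := by
  intro h
  obtain ⟨k, hk, h0, -⟩ := v.exists_rank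
  have := rank_lt h hk hw
  omega

theorem not_hyperplane_lt {v w : FreeFactorVertex N} (hw : HasFreeRank w.1 (N - 1)) :
    ¬ w.1 < v.1 := by
  intro h
  obtain ⟨k, hk, -, hN⟩ := v.exists_rank
  have := rank_lt h hw hk
  omega

theorem lt_of_le_of_rank {A B : Subgroup (FreeGroup (Fin N))} {k l : ℕ} (hk : HasFreeRank A k)
    (hl : HasFreeRank B l) (hkl : k ≠ l) (h : A ≤ B) : A < B :=
  lt_of_le_of_ne h fun e => hkl (by subst e; exact hk.unique hl)

/-- In the middle ranks the link is the join of the factors below and the factors above, both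
nonempty. -/
theorem isJoinLink_of_rank {v : FreeFactorVertex N} {k : ℕ} (hv : HasFreeRank v.1 k) (h1 : 1 < k)
    (h2 : k < N - 1) : IsJoinLink (freeFactorGraph N) v := by
  refine ⟨{n | n.1 < v.1}, {n | v.1 < n.1}, ?_, ?_, fun n => Or.comm, ?_⟩
  · obtain ⟨p, hp, hpv⟩ := v.isFactor.exists_point_le v.2.2.1
    exact ⟨ofRank hp.1 hp.2 one_pos (by omega), lt_of_le_of_rank hp.2 hv h1.ne hpv⟩
  · obtain ⟨b, S, hS⟩ := v.isFactor.exists_fin_basis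
    have hv' := hv
    rw [hS, hasFreeRank_closure_iff] at hv'
    obtain ⟨j, hj⟩ : ∃ j, j ∉ S := by
      by_contra hcon
      push Not at hcon
      rw [Set.eq_univ_iff_forall.2 hcon, Set.ncard_univ, Nat.card_fin] at hv'
      omega
    have hr : HasFreeRank (closure (b '' {j}ᶜ)) (N - 1) := (hasFreeRank_closure_iff b).2 (by
      rw [Set.ncard_compl, Set.ncard_singleton, Nat.card_fin])
    refine ⟨ofRank ⟨_, b, _, rfl⟩ hr (by omega) (by omega), lt_of_le_of_rank hv hr h2.ne ?_⟩
    rw [hS]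
    exact closure_mono (Set.image_mono (by simpa using hj))
  · intro x hx y hy
    exact Or.inl (lt_trans hx hy)

/-- Hyperplanes are pairwise nonadjacent, so those through the point all lie in one part of the
join. A member of the other part would lie in every one of them, against `exists_hyperplane`. -/
theorem not_isJoinLink_point (hN : 3 ≤ N) {v : FreeFactorVertex N} (hv : HasFreeRank v.1 1) :
    ¬ IsJoinLink (freeFactorGraph N) v := by
  rintro ⟨X, Y, hX, hY, h1, h2⟩
  have hp : IsPoint v.1 := ⟨v.isFactor, hv⟩
  have hlt {H : FreeFactorVertex N} (hH : HasFreeRank H.1 (N - 1)) (hvH : v.1 ≤ H.1) :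
      v.1 < H.1 := lt_of_le_of_rank hv hH (by omega) hvH
  have hyp (y : FreeFactorVertex N) (hy : v.1 < y.1) : ∃ H : FreeFactorVertex N,
      HasFreeRank H.1 (N - 1) ∧ v.1 ≤ H.1 ∧ ¬ y.1 ≤ H.1 := by
    obtain ⟨H, k1, k2, k3, k4⟩ := exists_hyperplane hp hy.not_ge
    exact ⟨ofRank k1 k2 (by omega) (by omega), k2, k3, k4⟩
  have key (X Y : Set (FreeFactorVertex N)) (hY : Y.Nonempty)
      (h1 : ∀ n, (freeFactorGraph N).Adj v n ↔ n ∈ X ∨ n ∈ Y)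
      (h2 : ∀ x ∈ X, ∀ y ∈ Y, (freeFactorGraph N).Adj x y)
      (hX : ∃ H ∈ X, HasFreeRank H.1 (N - 1)) : False := by
    obtain ⟨y, hy⟩ := hY
    obtain ⟨H₀, hH₀, hr₀⟩ := hX
    have hvy : v.1 < y.1 := ((h1 y).2 (Or.inr hy)).resolve_right (not_lt_point hv)
    obtain ⟨H, hr, hvH, hyH⟩ := hyp y hvy
    rcases (h1 H).1 (Or.inl (hlt hr hvH)) with hH | hH
    · rcases h2 H hH y hy with h | h
      · exact not_hyperplane_lt hr h
      · exact hyH h.le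
    · rcases h2 H₀ hH₀ H hH with h | h
      · exact not_hyperplane_lt hr₀ h
      · exact not_hyperplane_lt hr h
  obtain ⟨y, hy⟩ := hY
  have hvy : v.1 < y.1 := ((h1 y).2 (Or.inr hy)).resolve_right (not_lt_point hv)
  obtain ⟨H, hr, hvH, -⟩ := hyp y hvy
  rcases (h1 H).1 (Or.inl (hlt hr hvH)) with hH | hH
  · exact key X Y ⟨y, hy⟩ h1 h2 ⟨H, hH, hr⟩
  · exact key Y X hX (fun n => (h1 n).trans Or.comm)
      (fun x hx y hy => (h2 y hy x hx).symm) ⟨H, hH, hr⟩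

/-- Dually, the points of the hyperplane all lie in one part, and a member of the other part would
contain them all. -/
theorem not_isJoinLink_hyperplane (hN : 3 ≤ N) {v : FreeFactorVertex N}
    (hv : HasFreeRank v.1 (N - 1)) : ¬ IsJoinLink (freeFactorGraph N) v := by
  rintro ⟨X, Y, hX, hY, h1, h2⟩
  have hlt {p : FreeFactorVertex N} (hp : HasFreeRank p.1 1) (hpv : p.1 ≤ v.1) :
      p.1 < v.1 := lt_of_le_of_rank hp hv (by omega) hpv
  have key (X Y : Set (FreeFactorVertex N)) (hY : Y.Nonempty)
      (h1 : ∀ n, (freeFactorGraph N).Adj v n ↔ n ∈ X ∨ n ∈ Y)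
      (h2 : ∀ x ∈ X, ∀ y ∈ Y, (freeFactorGraph N).Adj x y)
      (hX : ∃ p ∈ X, HasFreeRank p.1 1) : False := by
    obtain ⟨y, hy⟩ := hY
    obtain ⟨p₀, hp₀, hr₀⟩ := hX
    have hvy : y.1 < v.1 := ((h1 y).2 (Or.inr hy)).resolve_left (not_hyperplane_lt hv)
    obtain ⟨p, hp, hpv, hpy⟩ := v.isFactor.exists_point_not_le hvy.not_ge
    let P : FreeFactorVertex N := ofRank hp.1 hp.2 one_pos (by omega)
    rcases (h1 P).1 (Or.inr (hlt hp.2 hpv)) with hP | hP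
    · rcases h2 P hP y hy with h | h
      · exact hpy h.le
      · exact not_lt_point hp.2 h
    · rcases h2 p₀ hp₀ P hP with h | h
      · exact not_lt_point hp.2 h
      · exact not_lt_point hr₀ h
  obtain ⟨p, hp, hpv⟩ := v.isFactor.exists_point_le v.2.2.1
  let P : FreeFactorVertex N := ofRank hp.1 hp.2 one_pos (by omega)
  rcases (h1 P).1 (Or.inr (hlt hp.2 hpv)) with hP | hP
  · exact key X Y hY h1 h2 ⟨P, hP, hp.2⟩
  · exact key Y X hX (fun n => (h1 n).trans Or.comm)
      (fun x hx y hy => (h2 y hy x hx).symm) ⟨P, hP, hp.2⟩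

theorem not_isJoinLink_iff (hN : 3 ≤ N) {v : FreeFactorVertex N} :
    ¬ IsJoinLink (freeFactorGraph N) v ↔ HasFreeRank v.1 1 ∨ HasFreeRank v.1 (N - 1) := by
  refine ⟨fun h => ?_, fun h => h.elim (not_isJoinLink_point hN) (not_isJoinLink_hyperplane hN)⟩
  obtain ⟨k, hk, h0, hkN⟩ := v.exists_rank
  by_contra hcon
  push Not at hcon
  refine h (isJoinLink_of_rank hk (lt_of_le_of_ne h0 ?_) (lt_of_le_of_ne (by omega) ?_))
  · rintro rfl; exact hcon.1 hk
  · rintro rfl; exact hcon.2 hk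

/-- A complementary point is a partner: together with a factor properly inside the hyperplane it
spans a proper factor. -/
theorem hasPartner_hyperplane (hN : 3 ≤ N) {v : FreeFactorVertex N}
    (hv : HasFreeRank v.1 (N - 1)) :
    HasPartner (freeFactorGraph N) (fun w => ¬ IsJoinLink (freeFactorGraph N) w) v := by
  obtain ⟨b, S, hS⟩ := v.isFactor.exists_fin_basis
  have hv' := hv
  rw [hS, hasFreeRank_closure_iff] at hv'
  obtain ⟨c, hc⟩ : ∃ j, j ∉ S := by
    by_contra hcon
    push Not at hcon
    rw [Set.eq_univ_iff_forall.2 hcon, Set.ncard_univ, Nat.card_fin] at hv'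
    omega
  have hw := isPoint_closure_basis b c
  have hwv : ¬ closure {b c} ≤ v.1 := by
    rw [hS, ← Set.image_singleton, IsFactor.closure_image_le_iff]
    simpa using hc
  let w : FreeFactorVertex N := ofRank hw.1 hw.2 one_pos (by omega)
  refine ⟨w, not_isJoinLink_point hN hw.2, ?_, ?_, fun n hn => ?_⟩
  · intro h
    exact hwv (congrArg Subtype.val h).le
  · rintro (h | h)
    · exact not_hyperplane_lt hv h
    · exact hwv h.le
  · have hnv : n.1 < v.1 := hn.resolve_left (not_hyperplane_lt hv)
    obtain ⟨b', h1, -, T, hT, hnT⟩ := n.isFactor.exists_adapted b S (hS ▸ hnv.le)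
    obtain ⟨k, hk, h0, -⟩ := n.exists_rank
    have hkN := rank_lt hnv hk hv
    have hk' := hk
    rw [hnT, hasFreeRank_closure_iff] at hk'
    have hcT : c ∉ T := fun h => hc (hT h)
    have hr : HasFreeRank (closure (b' '' insert c T)) (k + 1) := by
      rw [hasFreeRank_closure_iff, Set.ncard_insert_of_notMem hcT (Set.toFinite _), hk']
    refine ⟨ofRank ⟨_, b', _, rfl⟩ hr (by omega) (by omega), Or.inl ?_, Or.inr ?_⟩
    · refine lt_of_le_of_rank hk hr (by omega) ?_
      rw [hnT]
      exact closure_mono (Set.image_mono (Set.subset_insert _ _))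
    · refine lt_of_le_of_rank hw.2 hr (by omega) ?_
      change closure {b c} ≤ closure (b' '' insert c T)
      rw [← h1 c hc, ← Set.image_singleton]
      exact closure_mono (Set.image_mono (by simp))

/-- Another point is defeated by a hyperplane through `v` missing it, and a hyperplane missing `v`
by a line through `v` meeting it trivially. -/
theorem not_hasPartner_point (hN : 3 ≤ N) {v : FreeFactorVertex N} (hv : HasFreeRank v.1 1) :
    ¬ HasPartner (freeFactorGraph N) (fun w => ¬ IsJoinLink (freeFactorGraph N) w) v := by
  rintro ⟨w, hw, hwv, hadj, h⟩
  have hp : IsPoint v.1 := ⟨v.isFactor, hv⟩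
  rcases (not_isJoinLink_iff hN).1 hw with hw | hw
  · have hwv' : ¬ w.1 ≤ v.1 := fun hle =>
      hwv (Subtype.ext ((IsPoint.eq_of_le ⟨w.isFactor, hw⟩ hp hle)))
    obtain ⟨H, h1, h2, h3, h4⟩ := exists_hyperplane hp hwv'
    obtain ⟨m, hm1, hm2⟩ := h (ofRank h1 h2 (by omega) (by omega))
      (Or.inl (lt_of_le_of_rank hv h2 (by omega) h3))
    have k1 : m.1 < H := hm1.resolve_left (not_hyperplane_lt h2)
    have k2 : w.1 < m.1 := hm2.resolve_left (not_lt_point hw)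
    exact h4 (k2.trans k1).le
  · have hvw : ¬ v.1 ≤ w.1 := fun hle =>
      hadj (Or.inl (lt_of_le_of_rank hv hw (by omega) hle))
    obtain ⟨n, h1, h2, h3⟩ := exists_line_inf_eq_bot hN w.isFactor hp hvw
    obtain ⟨m, hm1, hm2⟩ := h (ofRank h1.1 h1.2 (by omega) (by omega))
      (Or.inl (lt_of_le_of_rank hv h1.2 (by omega) h2))
    have k1 : m.1 < w.1 := hm2.resolve_right (not_hyperplane_lt hw)
    rcases hm1 with hm1 | hm1
    · exact hvw (h2.trans (hm1.le.trans k1.le))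
    · exact m.2.2.1 (eq_bot_iff.2 ((le_inf hm1.le k1.le).trans h3.le))

theorem isPointVertex_iff (hN : 3 ≤ N) {v : FreeFactorVertex N} :
    IsPointVertex (freeFactorGraph N) v ↔ HasFreeRank v.1 1 := by
  constructor
  · rintro ⟨h1, h2⟩
    exact ((not_isJoinLink_iff hN).1 h1).resolve_right fun h => h2 (hasPartner_hyperplane hN h)
  · exact fun h => ⟨not_isJoinLink_point hN h, not_hasPartner_point hN h⟩

/-- A line has no subfactors other than points, and factors above it contain its points. A factor of
rank `k ≥ 3` has a subfactor of rank `k - 1` missing one of its points. -/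
theorem isLineVertex_iff (hN : 3 ≤ N) {v : FreeFactorVertex N} :
    IsLineVertex (freeFactorGraph N) v ↔ HasFreeRank v.1 2 := by
  unfold IsLineVertex
  simp only [isPointVertex_iff hN]
  constructor
  · rintro ⟨h1, h2⟩
    obtain ⟨k, hk, h0, hkN⟩ := v.exists_rank
    have hk1 : k ≠ 1 := by rintro rfl; exact h1 hk
    by_contra hk2
    have hk2 : k ≠ 2 := by rintro rfl; exact hk2 hk
    obtain ⟨b, S, hS⟩ := v.isFactor.exists_fin_basis
    have hk' := hk
    rw [hS, hasFreeRank_closure_iff] at hk'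
    obtain ⟨i, hi⟩ : S.Nonempty := (Set.ncard_pos (Set.toFinite S)).1 (by omega)
    have hp := isPoint_closure_basis b i
    have hr : HasFreeRank (closure (b '' (S \ {i}))) (k - 1) := by
      rw [hasFreeRank_closure_iff, Set.ncard_sdiff_singleton_of_mem hi, hk']
    rcases h2 (ofRank ⟨_, b, _, rfl⟩ hr (by omega) (by omega)) (Or.inr (by
        refine lt_of_le_of_rank hr hk (by omega) ?_
        rw [hS]
        exact closure_mono (Set.image_mono Set.sdiff_subset)))
      (fun h => by have := hr.unique h; omega)
      (ofRank hp.1 hp.2 one_pos (by omega)) hp.2 (Or.inl (by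
        refine lt_of_le_of_rank hp.2 hk (by omega) ?_
        change closure {b i} ≤ v.1
        rw [hS, ← Set.image_singleton]
        exact closure_mono (Set.image_mono (by simpa using hi)))) with h | h
    · have h' := h.le
      change closure {b i} ≤ closure (b '' (S \ {i})) at h'
      rw [← Set.image_singleton, IsFactor.closure_image_le_iff] at h'
      exact (h' rfl).2 rfl
    · exact not_lt_point hp.2 h
  · intro hv
    refine ⟨fun h => by have := hv.unique h; omega, fun n hn hn1 p hp hpv => ?_⟩
    have h1 : p.1 < v.1 := hpv.resolve_right (not_lt_point hp)
    rcases hn with hn | hn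
    · exact Or.inl (h1.trans hn)
    · obtain ⟨k, hk, h0, -⟩ := n.exists_rank
      have := rank_lt hn hk hv
      obtain rfl : k = 1 := by omega
      exact absurd hk hn1

theorem mem_rankOneTwoVertices_map_iff (hN : 3 ≤ N) (Φ : freeFactorGraph N ≃g freeFactorGraph N)
    (v : FreeFactorVertex N) : v ∈ rankOneTwoVertices N ↔ Φ v ∈ rankOneTwoVertices N := by
  change HasFreeRank v.1 1 ∨ HasFreeRank v.1 2 ↔ HasFreeRank (Φ v).1 1 ∨ HasFreeRank (Φ v).1 2
  rw [← isPointVertex_iff hN, ← isPointVertex_iff hN, ← isLineVertex_iff hN,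
    ← isLineVertex_iff hN, isPointVertex_map_iff, isLineVertex_map_iff]

end FreeFactorVertex

end FreeFactorGraph

/-! ### Extending automorphisms uniquely -/

section Extension

variable {N : ℕ}

namespace FreeFactorVertex

theorem lt_line {p L : FreeFactorVertex N} (hp : HasFreeRank p.1 1) (hL : HasFreeRank L.1 2) :
    p.1 < L.1 ↔ p.1 ≤ L.1 :=
  ⟨le_of_lt, lt_of_le_of_rank hp hL (by norm_num)⟩

/-- The partner is a basis point off the line; by `exists_line_of_le_closure` it is joined to every
point of the line. -/
theorem hasPartner_line (hN : 3 ≤ N) {u : rankOneTwoVertices N} (hu : HasFreeRank u.1.1 2) :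
    HasPartner (rankOneTwoGraph N) (fun _ => True) u := by
  obtain ⟨b, T, hT⟩ := u.1.isFactor.exists_fin_basis
  have hu' := hu
  rw [hT, hasFreeRank_closure_iff] at hu'
  obtain ⟨c, hc⟩ : ∃ j, j ∉ T := by
    by_contra hcon
    push Not at hcon
    rw [Set.eq_univ_iff_forall.2 hcon, Set.ncard_univ, Nat.card_fin] at hu'
    omega
  have hw := isPoint_closure_basis b c
  have hwu : ¬ closure {b c} ≤ u.1.1 := by
    rw [hT, ← Set.image_singleton, IsFactor.closure_image_le_iff]
    simpa using hc
  refine ⟨⟨ofRank hw.1 hw.2 one_pos (by omega), Or.inl hw.2⟩, trivial, fun h => ?_, ?_,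
    fun n hn => ?_⟩
  · exact hwu (congrArg (fun x => x.1.1) h).le
  · rintro (h | h)
    · exact not_lt_point hw.2 h
    · exact hwu h.le
  · have hn1 : HasFreeRank n.1.1 1 := n.2.resolve_right fun h => by
      rcases hn with h' | h' <;> exact absurd (rank_lt h' ‹_› ‹_›) (by norm_num)
    have hnu : n.1.1 < u.1.1 := Or.resolve_left hn (not_lt_point hn1)
    obtain ⟨m, hm, h1, h2⟩ := exists_line_of_le_closure b hc ⟨n.1.isFactor, hn1⟩ (hT ▸ hnu.le)
    exact ⟨⟨ofRank hm.1 hm.2 two_pos (by omega), Or.inr hm.2⟩,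
      Or.inl (lt_of_le_of_rank hn1 hm.2 (by norm_num) h1),
      Or.inr (lt_of_le_of_rank hw.2 hm.2 (by norm_num) h2)⟩

/-- A neighbour of a line in this graph is a point. It has no point below it, which excludes a
partner of rank one; a partner of rank two is excluded by a line through `u` meeting it trivially.
-/
theorem not_hasPartner_rankOne (hN : 3 ≤ N) {u : rankOneTwoVertices N}
    (hu : HasFreeRank u.1.1 1) : ¬ HasPartner (rankOneTwoGraph N) (fun _ => True) u := by
  rintro ⟨w, -, hwu, hadj, h⟩
  have hp : IsPoint u.1.1 := ⟨u.1.isFactor, hu⟩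
  have hline {n : Subgroup (FreeGroup (Fin N))} (hn : IsLine n) (hpn : u.1.1 ≤ n) :
      ∃ m : rankOneTwoVertices N, m.1.1 < n ∧ (rankOneTwoGraph N).Adj m w := by
    obtain ⟨m, h1, h2⟩ := h ⟨ofRank hn.1 hn.2 two_pos (by omega), Or.inr hn.2⟩
      (Or.inl (lt_of_le_of_rank hu hn.2 (by norm_num) hpn))
    refine ⟨m, Or.resolve_left h1 fun h => ?_, h2⟩
    rcases m.2 with hm | hm
    · exact not_lt_point hm h
    · exact lt_irrefl _ (rank_lt h hn.2 hm)
  rcases w.2 with hw | hw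
  · obtain ⟨b, i, hi⟩ := hp.exists_basis
    have : Nontrivial (Fin N) := Fin.nontrivial_iff_two_le.2 (by omega)
    obtain ⟨j, hj⟩ := exists_ne i
    obtain ⟨m, h1, h2⟩ := hline (isLine_closure_pair b hj.symm) (by
      rw [hi, ← Set.image_singleton]
      exact closure_mono (Set.image_mono (by simp)))
    have h3 : w.1.1 < m.1.1 := Or.resolve_left h2 (not_lt_point hw)
    have hn := isLine_closure_pair b hj.symm
    obtain ⟨k, hk, h0, -⟩ := m.1.exists_rank
    have h4 := rank_lt h3 hw hk
    have h5 := hk.lt m.1.isFactor hn.1 h1 hn.2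
    omega
  · have hpw : ¬ u.1.1 ≤ w.1.1 := fun hle => hadj (Or.inl ((lt_line hu hw).2 hle))
    obtain ⟨n, hn, hpn, hnw⟩ := exists_line_inf_eq_bot hN w.1.isFactor hp hpw
    obtain ⟨m, h1, h2⟩ := hline hn hpn
    have h3 : m.1.1 < w.1.1 := Or.resolve_right h2 fun h => by
      rcases m.2 with hm | hm
      · exact not_lt_point hm h
      · exact lt_irrefl _ (rank_lt h hw hm)
    exact m.1.2.2.1 (eq_bot_iff.2 ((le_inf h1.le h3.le).trans hnw.le))

theorem hasFreeRank_two_iff (hN : 3 ≤ N) {u : rankOneTwoVertices N} :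
    HasFreeRank u.1.1 2 ↔ HasPartner (rankOneTwoGraph N) (fun _ => True) u :=
  ⟨hasPartner_line hN, fun h => u.2.resolve_left fun h' => not_hasPartner_rankOne hN h' h⟩

theorem hasFreeRank_two_map_iff (hN : 3 ≤ N) (φ : rankOneTwoGraph N ≃g rankOneTwoGraph N)
    (u : rankOneTwoVertices N) : HasFreeRank (φ u).1.1 2 ↔ HasFreeRank u.1.1 2 := by
  rw [hasFreeRank_two_iff hN, hasFreeRank_two_iff hN, hasPartner_map_iff φ fun _ => Iff.rfl]

theorem hasFreeRank_one_map (hN : 3 ≤ N) (φ : rankOneTwoGraph N ≃g rankOneTwoGraph N)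
    {u : rankOneTwoVertices N} (hu : HasFreeRank u.1.1 1) : HasFreeRank (φ u).1.1 1 :=
  (φ u).2.resolve_right fun h =>
    absurd (hu.unique ((hasFreeRank_two_map_iff hN φ u).1 h)) (by norm_num)

theorem _root_.IsPoint.exists_vertex (hN : 3 ≤ N) {p : Subgroup (FreeGroup (Fin N))}
    (hp : IsPoint p) : ∃ u : rankOneTwoVertices N, u.1.1 = p :=
  ⟨⟨ofRank hp.1 hp.2 one_pos (by omega), Or.inl hp.2⟩, rfl⟩

theorem _root_.IsLine.exists_vertex (hN : 3 ≤ N) {L : Subgroup (FreeGroup (Fin N))}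
    (hL : IsLine L) : ∃ u : rankOneTwoVertices N, u.1.1 = L :=
  ⟨⟨ofRank hL.1 hL.2 two_pos (by omega), Or.inr hL.2⟩, rfl⟩

open Classical in
/-- The action of a permutation of the factors of rank one and two on subgroups, trivial on the
other subgroups. -/
noncomputable def subgroupMap (φ : rankOneTwoVertices N → rankOneTwoVertices N)
    (A : Subgroup (FreeGroup (Fin N))) : Subgroup (FreeGroup (Fin N)) :=
  if h : ∃ u : rankOneTwoVertices N, u.1.1 = A then (φ h.choose).1.1 else A

theorem subgroupMap_apply (φ : rankOneTwoVertices N → rankOneTwoVertices N)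
    (u : rankOneTwoVertices N) : subgroupMap φ u.1.1 = (φ u).1.1 := by
  have h : ∃ w : rankOneTwoVertices N, w.1.1 = u.1.1 := ⟨u, rfl⟩
  rw [subgroupMap, dif_pos h, Subtype.ext (Subtype.ext h.choose_spec)]

theorem isCollineation_subgroupMap (hN : 3 ≤ N) (φ : rankOneTwoGraph N ≃g rankOneTwoGraph N) :
    IsCollineation (subgroupMap φ) (subgroupMap φ.symm) where
  point hp := by
    obtain ⟨u, rfl⟩ := hp.exists_vertex hN
    rw [subgroupMap_apply]
    exact ⟨(φ u).1.isFactor, hasFreeRank_one_map hN φ hp.2⟩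
  line hL := by
    obtain ⟨u, rfl⟩ := hL.exists_vertex hN
    rw [subgroupMap_apply]
    exact ⟨(φ u).1.isFactor, (hasFreeRank_two_map_iff hN φ u).2 hL.2⟩
  point_inv hp := by
    obtain ⟨u, rfl⟩ := hp.exists_vertex hN
    rw [subgroupMap_apply]
    exact ⟨(φ.symm u).1.isFactor, hasFreeRank_one_map hN φ.symm hp.2⟩
  line_inv hL := by
    obtain ⟨u, rfl⟩ := hL.exists_vertex hN
    rw [subgroupMap_apply]
    exact ⟨(φ.symm u).1.isFactor, (hasFreeRank_two_map_iff hN φ.symm u).2 hL.2⟩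
  left_point hp := by
    obtain ⟨u, rfl⟩ := hp.exists_vertex hN
    rw [subgroupMap_apply, subgroupMap_apply, φ.symm_apply_apply]
  right_point hp := by
    obtain ⟨u, rfl⟩ := hp.exists_vertex hN
    rw [subgroupMap_apply, subgroupMap_apply, φ.apply_symm_apply]
  left_line hL := by
    obtain ⟨u, rfl⟩ := hL.exists_vertex hN
    rw [subgroupMap_apply, subgroupMap_apply, φ.symm_apply_apply]
  right_line hL := by
    obtain ⟨u, rfl⟩ := hL.exists_vertex hN
    rw [subgroupMap_apply, subgroupMap_apply, φ.apply_symm_apply]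
  le_iff hp hL := by
    obtain ⟨u, rfl⟩ := hp.exists_vertex hN
    obtain ⟨w, rfl⟩ := hL.exists_vertex hN
    rw [subgroupMap_apply, subgroupMap_apply]
    have key {x y : rankOneTwoVertices N} (hx : HasFreeRank x.1.1 1) (hy : HasFreeRank y.1.1 2) :
        x.1.1 ≤ y.1.1 ↔ (rankOneTwoGraph N).Adj x y :=
      ⟨fun h => Or.inl ((lt_line hx hy).2 h),
        fun h => (Or.resolve_right h (not_lt_point hx)).le⟩
    rw [key hp.2 hL.2, key (hasFreeRank_one_map hN φ hp.2)
      ((hasFreeRank_two_map_iff hN φ w).2 hL.2), φ.map_adj_iff]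

end FreeFactorVertex

namespace IsCollineation

variable {f g : Subgroup (FreeGroup (Fin N)) → Subgroup (FreeGroup (Fin N))}

theorem exists_vertex_image (h : IsCollineation f g) (v : FreeFactorVertex N) :
    ∃ w : FreeFactorVertex N, ∀ p, IsPoint p → (f p ≤ w.1 ↔ p ≤ v.1) := by
  obtain ⟨k, hk, h0, hkN⟩ := v.exists_rank
  by_cases h2 : 2 ≤ k
  · obtain ⟨A, hA, hAk, hp⟩ := h.exists_image h2 v.isFactor hk
    exact ⟨.ofRank hA hAk h0 hkN, hp⟩
  · obtain rfl : k = 1 := by omega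
    have hv : IsPoint v.1 := ⟨v.isFactor, hk⟩
    refine ⟨.ofRank (h.point hv).1 (h.point hv).2 h0 hkN, fun p hp => ⟨fun hle => ?_, fun hle => ?_⟩⟩
    · exact (h.eq_of_eq hp hv ((h.point hp).eq_of_le (h.point hv) hle)).le
    · rw [hp.eq_of_le hv hle]
      exact le_rfl

/-- The action of a collineation on the vertices of the free factor graph. -/
noncomputable def vertexMap (h : IsCollineation f g) (v : FreeFactorVertex N) :
    FreeFactorVertex N :=
  (h.exists_vertex_image v).choose

theorem le_vertexMap_iff (h : IsCollineation f g) (v : FreeFactorVertex N)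
    {p : Subgroup (FreeGroup (Fin N))} (hp : IsPoint p) : f p ≤ (h.vertexMap v).1 ↔ p ≤ v.1 :=
  (h.exists_vertex_image v).choose_spec p hp

/-- Since `f` is onto the points, the condition prescribes all points of `w`, and these determine
`w`. -/
theorem eq_vertexMap (h : IsCollineation f g) {v w : FreeFactorVertex N}
    (hw : ∀ p, IsPoint p → (f p ≤ w.1 ↔ p ≤ v.1)) : h.vertexMap v = w := by
  have key {x y : FreeFactorVertex N} (hx : ∀ p, IsPoint p → (f p ≤ x.1 ↔ p ≤ v.1))
      (hy : ∀ p, IsPoint p → (f p ≤ y.1 ↔ p ≤ v.1)) : x.1 ≤ y.1 :=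
    x.isFactor.le_of_points fun p hp hpx => by
      have e := h.right_point hp
      rw [← e, hy _ (h.point_inv hp), ← hx _ (h.point_inv hp), e]
      exact hpx
  exact Subtype.ext (le_antisymm (key (fun p hp => h.le_vertexMap_iff v hp) hw)
    (key hw fun p hp => h.le_vertexMap_iff v hp))

theorem vertexMap_symm_vertexMap (h : IsCollineation f g) (v : FreeFactorVertex N) :
    h.symm.vertexMap (h.vertexMap v) = v :=
  h.symm.eq_vertexMap fun p hp => by
    rw [← h.le_vertexMap_iff v (h.point_inv hp), h.right_point hp]

theorem vertexMap_le_iff (h : IsCollineation f g) {v w : FreeFactorVertex N} :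
    (h.vertexMap v).1 ≤ (h.vertexMap w).1 ↔ v.1 ≤ w.1 := by
  have key {f g} (h : IsCollineation f g) {v w : FreeFactorVertex N} (hvw : v.1 ≤ w.1) :
      (h.vertexMap v).1 ≤ (h.vertexMap w).1 :=
    (h.vertexMap v).isFactor.le_of_points fun p hp hle => by
      rw [← h.right_point hp] at hle ⊢
      have hg := h.point_inv hp
      exact (h.le_vertexMap_iff w hg).2 (((h.le_vertexMap_iff v hg).1 hle).trans hvw)
  refine ⟨fun hle => ?_, key h⟩
  simpa only [vertexMap_symm_vertexMap] using key h.symm hle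

/-- The automorphism of the free factor graph given by a collineation. -/
noncomputable def graphIso (h : IsCollineation f g) :
    freeFactorGraph N ≃g freeFactorGraph N where
  toFun := h.vertexMap
  invFun := h.symm.vertexMap
  left_inv := h.vertexMap_symm_vertexMap
  right_inv := h.symm.vertexMap_symm_vertexMap
  map_rel_iff' {v w} := by
    change _ < _ ∨ _ < _ ↔ _ < _ ∨ _ < _
    simp only [lt_iff_le_not_ge]
    exact or_congr (and_congr h.vertexMap_le_iff (not_congr h.vertexMap_le_iff))
      (and_congr h.vertexMap_le_iff (not_congr h.vertexMap_le_iff))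

end IsCollineation

open FreeFactorVertex

theorem exists_isExtension (hN : 3 ≤ N) (φ : rankOneTwoGraph N ≃g rankOneTwoGraph N) :
    ∃ Φ : freeFactorGraph N ≃g freeFactorGraph N, IsExtension φ Φ := by
  have h := isCollineation_subgroupMap hN φ
  refine ⟨h.graphIso, fun u => h.eq_vertexMap fun p hp => ?_⟩
  rw [← subgroupMap_apply φ u]
  rcases u.2 with hu | hu
  · have hu' : IsPoint u.1.1 := ⟨u.1.isFactor, hu⟩
    refine ⟨fun hle => ?_, fun hle => ?_⟩
    · exact (h.eq_of_eq hp hu' ((h.point hp).eq_of_le (h.point hu') hle)).le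
    · rw [hp.eq_of_le hu' hle]
  · exact h.le_iff hp ⟨u.1.isFactor, hu⟩

/-- A fixed point stays adjacent to the image, and a factor adjacent to a point contains it.
Applying this to the inverse too gives equality. -/
theorem FreeFactorVertex.le_of_fixes_rankOneTwo (hN : 3 ≤ N)
    (Ψ : freeFactorGraph N ≃g freeFactorGraph N) (h : ∀ v ∈ rankOneTwoVertices N, Ψ v = v)
    (v : FreeFactorVertex N) : v.1 ≤ (Ψ v).1 := by
  refine v.isFactor.le_of_points fun p hp hpv => ?_
  obtain ⟨u, rfl⟩ := hp.exists_vertex hN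
  have hu := h u.1 u.2
  rcases hpv.eq_or_lt with e | hlt
  · rw [← Subtype.ext (a1 := u.1) (a2 := v) e, hu]
  · have := Ψ.map_adj_iff.2 (Or.inl hlt : (freeFactorGraph N).Adj u.1 v)
    rw [hu] at this
    exact (Or.resolve_right this (not_lt_point hp.2)).le

theorem eq_one_of_fixes_rankOneTwo (hN : 3 ≤ N) (Ψ : freeFactorGraph N ≃g freeFactorGraph N)
    (h : ∀ v ∈ rankOneTwoVertices N, Ψ v = v) : Ψ = 1 := by
  refine RelIso.ext fun v => Subtype.ext (le_antisymm ?_ (le_of_fixes_rankOneTwo hN Ψ h v))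
  have := le_of_fixes_rankOneTwo hN Ψ.symm
    (fun v hv => (Ψ.symm_apply_eq).2 (h v hv).symm) (Ψ v)
  rwa [Ψ.symm_apply_apply] at this

/-- Restriction of automorphisms of the free factor graph to the factors of rank one and two. -/
def restrictRankOneTwo (hN : 3 ≤ N) : (freeFactorGraph N ≃g freeFactorGraph N) →*
    (rankOneTwoGraph N ≃g rankOneTwoGraph N) where
  toFun Φ :=
    { Φ.toEquiv.subtypeEquiv (mem_rankOneTwoVertices_map_iff hN Φ) with
      map_rel_iff' := Φ.map_adj_iff }
  map_one' := rfl
  map_mul' _ _ := rfl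

theorem isExtension_iff (hN : 3 ≤ N) {φ : rankOneTwoGraph N ≃g rankOneTwoGraph N}
    {Φ : freeFactorGraph N ≃g freeFactorGraph N} :
    IsExtension φ Φ ↔ restrictRankOneTwo hN Φ = φ :=
  ⟨fun h => RelIso.ext fun u => Subtype.ext (h u), by rintro rfl u; rfl⟩

theorem restrictRankOneTwo_bijective (hN : 3 ≤ N) :
    Function.Bijective (restrictRankOneTwo hN) := by
  refine ⟨(injective_iff_map_eq_one _).2 fun Ψ h => ?_, fun φ => ?_⟩
  · refine eq_one_of_fixes_rankOneTwo hN Ψ fun v hv => ?_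
    exact (isExtension_iff hN).2 h ⟨v, hv⟩
  · obtain ⟨Φ, hΦ⟩ := exists_isExtension hN φ
    exact ⟨Φ, (isExtension_iff hN).1 hΦ⟩

end Extension

theorem theoremC (N : ℕ) (hN : 3 ≤ N) :
    (∀ φ : rankOneTwoGraph N ≃g rankOneTwoGraph N,
      ∃! Φ : freeFactorGraph N ≃g freeFactorGraph N, IsExtension φ Φ) ∧
    (∃ e : (rankOneTwoGraph N ≃g rankOneTwoGraph N) ≃*
        (freeFactorGraph N ≃g freeFactorGraph N),
      ∀ φ : rankOneTwoGraph N ≃g rankOneTwoGraph N, IsExtension φ (e φ)) := by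
  simp only [isExtension_iff hN]
  exact ⟨(restrictRankOneTwo_bijective hN).existsUnique,
    (MulEquiv.ofBijective _ (restrictRankOneTwo_bijective hN)).symm,
    (MulEquiv.ofBijective _ (restrictRankOneTwo_bijective hN)).apply_symm_apply⟩
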